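/- Conventions. $k$ is a field, algebras are associative, unital and finite-dimensional over $k$, and modules are finitely generated left modules. For an algebra $R$ with radical $\operatorname{rad}R$, let $L(i)$ $(i\in I)$ be representatives of the isomorphism classes of simple $R$-modules (the weights of $R$), with projective covers $P(i)$. A two-sided ideal $J$ of $R$ is a heredity ideal if $J^2=J$, $J\operatorname{rad}(R)J=0$ and $J$ is projective as a left module. A heredity chain is a chain of two-sided ideals $0=J_{-1}\subseteq J_0\subseteq\dots\subseteq J_n=R$ such that $J_l/J_{l-1}$ is a heredity ideal of $R/J_{l-1}$ for all $l$. Each weight $i$ then has a unique level $l(i)$ such that $L(i)$ is a composition factor of $\operatorname{top}(J_{l(i)}/J_{l(i)-1})$, and the chain induces the partial order $\unlhd$ on $I$ with $i\lhd j$ if and only if $l(i)>l(j)$. The pair $(R,\unlhd)$ is quasi-hereditary if $\unlhd$ is induced by a heredity chain of $R$. The standard modules of $(R,\unlhd)$ are $\Delta(i)=P(i)/\sum_{j\not\unlhd i}\operatorname{Tr}_{P(j)}P(i)$, where $\operatorname{Tr}_{P(j)}P(i)$ is the sum of the images of all homomorphisms $P(j)\to P(i)$. The weights of $R^{op}$ are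 identified with those of $R$ by $k$-duality, $L^{R^{op}}(i)=\operatorname{Hom}_k(L^R(i),k)$. An algebra $R$ is elementary if $R/\operatorname{rad}R$ is isomorphic to a finite product of copies of $k$. Let $(A,\unlhd)$ be quasi-hereditary with weights $I$. A unital subalgebra $B\subseteq A$, with weights indexed by the same set $I$, is an exact Borel subalgebra of $(A,\unlhd)$ if $A\otimes_B-$ is exact, $A\otimes_BL^B(i)\cong\Delta^A(i)$ for all $i$, and $(B,\unlhd)$ is quasi-hereditary with $\Delta^B(i)\cong L^B(i)$ for all $i$. A unital subalgebra $C\subseteq A$, with weights indexed by $I$, is a Delta subalgebra of $(A,\unlhd)$ if $C^{op}$ is an exact Borel subalgebra of $(A^{op},\unlhd)$. The algebra $A$ is Reedy with $A^-=B$ and $A^+=C$, where $B,C$ are unital subalgebras, if there are pairwise orthogonal idempotents $e_0,\dots,e_n\in B\cap C$ with $e_0+\dots+e_n=1$ and a function $\deg\colon\{e_0,\dots,e_n\}\to\mathbb N$ such that, for all $i,j$: $e_iCe_i\cong k\cong e_iBe_i$ as vector spaces; if $i\ne j$ and $e_jCe_i\ne0$, then $\deg(e_j)>\deg(e_i)$;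 if $i\neq j$ and $e_jBe_i\neq0$, then $\deg(e_j)<\deg(e_i)$; and multiplication induces an isomorphism $\bigoplus_{l=0}^n e_jCe_l\otimes_k e_lBe_i\to e_jAe_i$. **Theorem.** Let $A$ be a nonzero finite-dimensional algebra over a field $k$, let $B$ and $C$ be unital $k$-subalgebras of $A$, and put $S=B\cap C$. The following are equivalent. (i) $A$ is Reedy with $A^-=B$ and $A^+=C$. (ii) $B$ and $C$ are elementary, $S$ is a maximal semisimple subalgebra of $B$ and of $C$, and multiplication in $A$ induces an isomorphism $C\otimes_SB\to A$ of $C$-$B$-bimodules. In addition, the weights of $B$ and $C$ can be indexed by the same set $I$ so that $L^B(i)$ and $L^C(i)$ have isomorphic restrictions to $S$ for every $i\in I$, and there is one partial order $\unlhd$ on $I$ such that $(B,\unlhd)$ is quasi-hereditary with simple standard modules and $(C,\unlhd)$ is quasi-hereditary with projective standard modules. (iii) $B$ and $C$ are elementary, $S$ is a maximal semisimple subalgebra of $B$ and of $C$, and the weights of $A$, $B$ and $C$ can be indexed by the same set $I$, with a partial order $\unlhd$ on $I$, so that $(A,\unlhd)$ is quasi-hereditary, $\operatorname{End}_A(L^A(i))=k$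 for all $i\in I$, $B$ is an exact Borel subalgebra of $(A,\unlhd)$, and $C$ is a Delta subalgebra of $(A,\unlhd)$. -/

import Mathlib

open scoped TensorProduct

universe u v

namespace ReedyAlg

/-! ### Induction along a ring homomorphism -/

section Induction

variable {R T : Type v} [Ring R] [Ring T] (φ : R →+* T)

/-- The relations `t φ(r) ⊗ m = t ⊗ r m`. Since they are stable under left multiplication by `T`,
their `T`-span is the additive subgroup they generate. -/
def inducedRel (M : Type v) [AddCommGroup M] [Module R M] : Submodule T (T ⊗[ℤ] M) :=
  Submodule.span T {z | ∃ (t : T) (r : R) (m : M), z = (t * φ r) ⊗ₜ[ℤ] m - t ⊗ₜ[ℤ] (r • m)}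

/-- The left `T`-module `T ⊗_R M`, where `R` acts on `T` from the right through `φ`. -/
abbrev Induced (M : Type v) [AddCommGroup M] [Module R M] : Type v :=
  (T ⊗[ℤ] M) ⧸ inducedRel φ M

/-- The map `T ⊗_ℤ f` for an additive map `f`. -/
def tensorMap {M N : Type v} [AddCommGroup M] [Module R M] [AddCommGroup N] [Module R N]
    (f : M →ₗ[R] N) : T ⊗[ℤ] M →ₗ[T] T ⊗[ℤ] N :=
  TensorProduct.AlgebraTensorModule.map LinearMap.id f.toAddMonoidHom.toIntLinearMap

theorem inducedRel_le_comap {M N : Type v} [AddCommGroup M] [Module R M] [AddCommGroup N]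
    [Module R N] (f : M →ₗ[R] N) :
    inducedRel φ M ≤ (inducedRel φ N).comap (tensorMap f) := by
  refine Submodule.span_le.2 ?_
  rintro _ ⟨t, r, m, rfl⟩
  refine Submodule.subset_span ⟨t, r, f m, ?_⟩
  simp [tensorMap]

/-- The functor `T ⊗_R -` on morphisms. -/
def Induced.map {M N : Type v} [AddCommGroup M] [Module R M] [AddCommGroup N] [Module R N]
    (f : M →ₗ[R] N) : Induced φ M →ₗ[T] Induced φ N :=
  (inducedRel φ M).mapQ (inducedRel φ N) (tensorMap f) (inducedRel_le_comap φ f)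

end Induction

/-! ### Weights, quasi-hereditary algebras and standard modules -/

/-- A complete irredundant set of simple modules `L i` of `R`, with projective covers
`π i : P i → L i`. -/
structure WeightSystem (R : Type v) [Ring R] (I : Type) where
  L : I → ModuleCat.{v} R
  simple : ∀ i, IsSimpleModule R (L i)
  irredundant : ∀ i j, Nonempty (L i ≃ₗ[R] L j) → i = j
  complete : ∀ M : ModuleCat.{v} R, IsSimpleModule R M → ∃ i, Nonempty (M ≃ₗ[R] L i)
  P : I → ModuleCat.{v} R
  projective : ∀ i, Module.Projective R (P i)
  π : ∀ i, P i →ₗ[R] L i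
  π_surjective : ∀ i, Function.Surjective (π i)
  π_essential : ∀ i (N : Submodule R (P i)), N ⊔ LinearMap.ker (π i) = ⊤ → N = ⊤

/-- A heredity ideal: a two-sided ideal `J` with `J² = J`, `J rad(R) J = 0`, and `J` projective as
a left module. -/
structure IsHeredityIdeal (R : Type v) [Ring R] (J : Ideal R) : Prop where
  twoSided : J.IsTwoSided
  idem : J * J = J
  rad : J * Ring.jacobson R * J = ⊥
  projective : Module.Projective R J

/-- A heredity chain `0 = J 0 ⊆ J 1 ⊆ ⋯ ⊆ J n = R` of two-sided ideals: each `J (l + 1) / J l` is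
a heredity ideal of `R / J l`. -/
structure HeredityChain (R : Type v) [Ring R] where
  n : ℕ
  J : ℕ → Ideal R
  twoSided : ∀ l, (J l).IsTwoSided
  zero : J 0 = ⊥
  last : J n = ⊤
  le_succ : ∀ l < n, J l ≤ J (l + 1)
  heredity : ∀ l < n, IsHeredityIdeal (R ⧸ J l) ((J (l + 1)).map (Ideal.Quotient.mk (J l)))

/-- The module `M`, assumed simple, is a composition factor of `top (J (l + 1) / J l)`. As the top
is semisimple, this says that there is a nonzero homomorphism `J (l + 1) → M` vanishing
on `J l`. -/
def HeredityChain.HasLevel {R : Type v} [Ring R] (c : HeredityChain R) (l : ℕ)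
    (M : Type v) [AddCommGroup M] [Module R M] : Prop :=
  l < c.n ∧ ∃ f : c.J (l + 1) →ₗ[R] M, f ≠ 0 ∧ ∀ x : c.J (l + 1), (x : R) ∈ c.J l → f x = 0

/-- `(R, ⊴)` is quasi-hereditary: there is a heredity chain of `R` that induces `⊴`, that is,
`i ◁ j` if and only if the level of `L i` is larger than the level of `L j`. -/
def IsQuasiHereditary {R : Type v} [Ring R] {I : Type} (W : WeightSystem R I)
    (le : I → I → Prop) : Prop :=
  ∃ (c : HeredityChain R) (level : I → ℕ), (∀ i, c.HasLevel (level i) (W.L i)) ∧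
    ∀ i j, le i j ↔ i = j ∨ level j < level i

/-- The sum of the traces of the `P j`, `j ⋬ i`, in `P i`. -/
def WeightSystem.traceSum {R : Type v} [Ring R] {I : Type} (W : WeightSystem R I)
    (le : I → I → Prop) (i : I) : Submodule R (W.P i) :=
  ⨆ (j : I) (_ : ¬ le j i) (f : W.P j →ₗ[R] W.P i), LinearMap.range f

/-- The standard module `Δ(i)`. -/
abbrev WeightSystem.standard {R : Type v} [Ring R] {I : Type} (W : WeightSystem R I)
    (le : I → I → Prop) (i : I) : Type v :=
  W.P i ⧸ W.traceSum le i

/-! ### Exact Borel and Delta subalgebras -/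

/-- The ring `B`, viewed as a subring of `A` through the injective homomorphism `φ`, is an exact
Borel subalgebra of the quasi-hereditary algebra `(A, ⊴)`; the weights of `A` and `B` are indexed
by the same set. -/
structure IsExactBorel {A B : Type v} [Ring A] [Ring B] (φ : B →+* A) {I : Type}
    (WA : WeightSystem A I) (WB : WeightSystem B I) (le : I → I → Prop) : Prop where
  ambient : IsQuasiHereditary WA le
  injective : Function.Injective φ
  exact : ∀ (M N K : ModuleCat.{v} B) [Module.Finite B M] [Module.Finite B N] [Module.Finite B K]
    (f : M →ₗ[B] N) (g : N →ₗ[B] K), Function.Exact f g →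
      Function.Exact (Induced.map φ f) (Induced.map φ g)
  induced_simple : ∀ i, Nonempty (Induced φ (WB.L i) ≃ₗ[A] WA.standard le i)
  quasiHereditary : IsQuasiHereditary WB le
  standard_simple : ∀ i, Nonempty (WB.standard le i ≃ₗ[B] WB.L i)

/-- The left module `N` over the opposite algebra (a right `R`-module) is isomorphic to the
`k`-dual `Hom_k(M, k)` of the left `R`-module `M`: the isomorphism is `x ↦ p x`. -/
def IsDualModule (k : Type u) [Field k] (R : Type v) [Ring R] [Algebra k R]
    (M : Type v) [AddCommGroup M] [Module R M] (N : Type v) [AddCommGroup N] [Module Rᵐᵒᵖ N] :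
    Prop :=
  ∃ p : N →+ M →+ k,
    (∀ (x : N) (a : k) (m : M), p x (algebraMap k R a • m) = a * p x m) ∧
    (∀ (x : N) (r : R) (m : M), p (MulOpposite.op r • x) m = p x (r • m)) ∧
    ∀ f : M →+ k, (∀ (a : k) (m : M), f (algebraMap k R a • m) = a * f m) → ∃! x, p x = f

/-- `C` is a Delta subalgebra of `(A, ⊴)`: the opposite algebra of `C` is an exact Borel
subalgebra of `(Aᵒᵖ, ⊴)`. The weights of the opposite algebras are identified with those of the
algebras by `k`-duality. -/
def IsDeltaSubalgebra (k : Type u) [Field k] {A : Type v} [Ring A] [Algebra k A]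
    (C : Subalgebra k A) {I : Type} (WA : WeightSystem A I) (WC : WeightSystem C I)
    (le : I → I → Prop) : Prop :=
  ∃ (WA' : WeightSystem Aᵐᵒᵖ I) (WC' : WeightSystem (C)ᵐᵒᵖ I),
    (∀ i, IsDualModule k A (WA.L i) (WA'.L i)) ∧
    (∀ i, IsDualModule k C (WC.L i) (WC'.L i)) ∧
    IsExactBorel (RingHom.op (C.val : C →+* A)) WA' WC' le

/-! ### Subalgebras and the multiplication map -/

section Subalgebras

variable (k : Type u) [Field k] {A : Type v} [Ring A] [Algebra k A]

/-- `Λ / rad Λ` is isomorphic to a finite product of copies of `k`. -/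
def IsElementary (Λ : Type v) [Ring Λ] [Algebra k Λ] : Prop :=
  ∃ m : ℕ, Nonempty ((Λ ⧸ Ring.jacobson Λ) ≃ₐ[k] (Fin m → k))

variable {k}

/-- `S` is maximal among the semisimple subalgebras of `B`. -/
def IsMaximalSemisimple (S B : Subalgebra k A) : Prop :=
  Maximal (fun T : Subalgebra k A => T ≤ B ∧ IsSemisimpleRing T) S

/-- `B` as a left module over `B ⊓ C`. -/
abbrev interModule (B C : Subalgebra k A) : Module ↥(B ⊓ C) ↥B :=
  Module.compHom B ((Subalgebra.inclusion (inf_le_left : B ⊓ C ≤ B) : ↥(B ⊓ C) →ₐ[k] ↥B) :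
    ↥(B ⊓ C) →+* ↥B)

/-- The inclusion of `B ⊓ C` in `C`. -/
def interToRight (B C : Subalgebra k A) : ↥(B ⊓ C) →+* ↥C :=
  ((Subalgebra.inclusion (inf_le_right : B ⊓ C ≤ C) : ↥(B ⊓ C) →ₐ[k] ↥C) : ↥(B ⊓ C) →+* ↥C)

/-- The multiplication `C ⊗_ℤ B → A`. -/
def mulTensor (B C : Subalgebra k A) : ↥C ⊗[ℤ] ↥B →ₗ[C] A :=
  TensorProduct.AlgebraTensorModule.lift
    { toFun := fun c => ((AddMonoidHom.mulLeft (c : A)).comp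
        (B.val : B →+* A).toAddMonoidHom).toIntLinearMap
      map_add' := fun x y => by ext; simp [add_mul]
      map_smul' := fun x y => by ext; simp [mul_assoc, Subalgebra.smul_def] }

/-- The module `C ⊗_S B` with `S = B ⊓ C`. -/
abbrev MulSource (B C : Subalgebra k A) : Type v :=
  letI := interModule B C
  Induced (interToRight B C) B

/-- The map `C ⊗_S B → A`, `c ⊗ b ↦ c b`, with `S = B ⊓ C`. It is a homomorphism of
`C`-`B`-bimodules. -/
def mulInduced (B C : Subalgebra k A) : MulSource B C →ₗ[C] A :=
  letI := interModule B C
  (inducedRel (interToRight B C) B).liftQ (mulTensor B C) (by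
    refine Submodule.span_le.2 ?_
    rintro _ ⟨t, r, m, rfl⟩
    have h : ((r • m : B) : A) = (r : A) * (m : A) := rfl
    have h' : ((interToRight B C r : C) : A) = (r : A) := rfl
    simp [mulTensor, h, h', mul_assoc])

/-- The restrictions of the `B`-module `M` and of the `C`-module `N` to `B ⊓ C` are isomorphic. -/
def RestrictionsIso (B C : Subalgebra k A) (M : Type v) [AddCommGroup M] [Module B M]
    (N : Type v) [AddCommGroup N] [Module C N] : Prop :=
  ∃ f : M ≃+ N, ∀ (s : A) (hB : s ∈ B) (hC : s ∈ C) (m : M),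
    f ((⟨s, hB⟩ : B) • m) = (⟨s, hC⟩ : C) • f m

/-! ### Reedy algebras -/

/-- The subspace `e D f` of `A`. -/
def peirce (D : Subalgebra k A) (e f : A) : Submodule k A :=
  (Subalgebra.toSubmodule D).map (LinearMap.mulLeftRight k (e, f))

/-- The multiplication map `⨁ l, e_j C e_l ⊗_k e_l B e_i → A`. -/
noncomputable def reedyMul (B C : Subalgebra k A) {n : ℕ} (e : Fin (n + 1) → A)
    (j i : Fin (n + 1)) :
    (DirectSum (Fin (n + 1)) fun l => peirce C (e j) (e l) ⊗[k] peirce B (e l) (e i)) →ₗ[k] A :=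
  DirectSum.toModule k (Fin (n + 1)) A fun l =>
    Submodule.mulMap (peirce C (e j) (e l)) (peirce B (e l) (e i))

/-- `A` is a Reedy algebra with `A⁻ = B` and `A⁺ = C`. -/
def IsReedy (B C : Subalgebra k A) : Prop :=
  ∃ (n : ℕ) (e : Fin (n + 1) → A) (deg : Fin (n + 1) → ℕ),
    CompleteOrthogonalIdempotents e ∧
    (∀ i, e i ∈ B ∧ e i ∈ C) ∧
    (∀ i, Nonempty (peirce C (e i) (e i) ≃ₗ[k] k)) ∧
    (∀ i j, i ≠ j → peirce C (e j) (e i) ≠ ⊥ → deg i < deg j) ∧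
    (∀ i, Nonempty (peirce B (e i) (e i) ≃ₗ[k] k)) ∧
    (∀ i j, i ≠ j → peirce B (e j) (e i) ≠ ⊥ → deg j < deg i) ∧
    ∀ i j, Function.Injective (reedyMul B C e j i) ∧
      LinearMap.range (reedyMul B C e j i) = peirce ⊤ (e j) (e i)

end Subalgebras

end ReedyAlg

/-! All three conditions are compared with one notion, a triangular decomposition (`IsTriangular`):
complete orthogonal idempotents e_i common to B and C, scalar corners e_i B e_i and e_i C e_i, a
degree that B strictly lowers and C strictly raises off the diagonal, A = C B, and dim A = ∑ dim C
e_l · dim e_l B. The last two properties say that ⨁ C e_l ⊗ e_l B → A is bijective. Cut into Peirce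
corners this is the Reedy condition; since B ∩ C is then ⨁ k e_l, it is also the bijectivity of C
⊗_S B → A.

A triangular decomposition makes A projective over B on the right, with an explicit dual basis
(`IsTriangular.exists_isDualBasis`) whose coordinates respect the ideals generated by the
idempotents of degree less than l (`IsDualBasis.y_eq_zero`). Modulo lower degrees e_i A e_i is
therefore k e_i, which produces the simple modules, and those ideals form a heredity chain
(`IsTriangular.isHeredityIdeal`). The standard module of weight i is A modulo lower degrees and A(1
- e_i), and this is A ⊗_B L(i), so B is an exact Borel subalgebra. The notion is self-dual
(`IsTriangular.op`), which settles C, and it is inherited by B and by C, each paired with the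
semisimple algebra spanned by the idempotents (`IsTriangular.left`, `IsTriangular.right`).

From (ii), a maximal semisimple subalgebra of an elementary algebra supplies the idempotents
(`IsMaximalSemisimple.exists_isSplit`). Simple standard modules force B to lower the level in the
heredity chain (`IsLabelled.directed_of_simple`), projective ones force C to raise it
(`IsLabelled.directed_of_projective`).

From (iii), A = C B and the dimension formula have to be recovered. Since Δ(j) is A modulo the left
ideal generated by a maximal ideal of B, e_i Δ(j) vanishes unless i ⊴ j and e_j Δ(j) = k; with the
same facts for the opposite algebras, two applications of Nakayama's lemma give A = C B. Let a_j =
dim Δ(j), let a'_j be the dimension of the standard module of the opposite algebra, b_j = dim e_j B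
and c_j = dim C e_j. Exactness of induction gives dim A = ∑ a_j b_j = ∑ a'_j c_j, the filtration by
levels gives dim A ≤ ∑ a_j a'_j, and A = C B gives a_j ≤ c_j. Hence a_j = c_j for all j, and dim A =
∑ c_j b_j. -/

namespace ReedyAlg

/-! ### Projective covers and traces of projective modules -/

section Weights

variable {R : Type v} [Ring R] {I : Type} (W : WeightSystem R I)

theorem WeightSystem.isCoatom_ker (i : I) : IsCoatom (LinearMap.ker (W.π i)) :=
  haveI := W.simple i
  LinearMap.isCoatom_ker_of_surjective (W.π_surjective i)

theorem WeightSystem.surjective_of_comp {i : I} {M : Type*} [AddCommGroup M] [Module R M]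
    (g : M →ₗ[R] W.P i) (h : Function.Surjective (W.π i ∘ₗ g)) : Function.Surjective g := by
  rw [← LinearMap.range_eq_top]
  refine W.π_essential i _ (eq_top_iff.2 fun x _ => ?_)
  obtain ⟨y, hy⟩ := h (W.π i x)
  refine Submodule.mem_sup.2 ⟨g y, ⟨y, rfl⟩, x - g y, ?_, by abel⟩
  simpa [sub_eq_zero] using hy.symm

/-- The kernel of `π` is a superfluous coatom, hence the largest proper submodule of `P j`. -/
theorem WeightSystem.ker_le_ker {j : I} {N : Type*} [AddCommGroup N] [Module R N]
    (f : W.P j →ₗ[R] N) (hf : f ≠ 0) : LinearMap.ker f ≤ LinearMap.ker (W.π j) := by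
  by_contra h
  exact hf (LinearMap.ker_eq_top.1 (W.π_essential j _
    (by simpa using (W.isCoatom_ker j).2 _ (left_lt_sup.2 h) |> fun h => (sup_comm _ _).trans h)))

/-- `L j` is a quotient of every nonzero image of `P j`, so whatever acts nontrivially on `L j` acts
nontrivially on that image. -/
theorem WeightSystem.exists_smul_apply_ne_zero {j : I} {N : Type*} [AddCommGroup N] [Module R N]
    (f : W.P j →ₗ[R] N) (hf : f ≠ 0) {r : R} {x : W.L j} (hr : r • x ≠ 0) :
    ∃ y, r • f y ≠ 0 := by
  obtain ⟨y, rfl⟩ := W.π_surjective j x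
  refine ⟨y, fun h => hr ?_⟩
  have := W.ker_le_ker f hf (x := r • y) (by simpa using h)
  simpa using this

/-- If the sum were proper, it would lie in a maximal submodule N. The simple quotient M/N is some
`L i`, and the lift of `P i → M/N` to M is one of the summands but is not contained in N. -/
theorem WeightSystem.iSup_range_eq_top {M : Type v} [AddCommGroup M] [Module R M]
    [Module.Finite R M] (p : I → Prop)
    (hp : ∀ i, (∃ g : M →ₗ[R] W.L i, g ≠ 0) → p i) :
    ⨆ (i : I) (_ : p i) (f : W.P i →ₗ[R] M), LinearMap.range f = ⊤ := by
  by_contra h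
  obtain ⟨N, hN, hle⟩ := (eq_top_or_exists_le_coatom
    (⨆ (i : I) (_ : p i) (f : W.P i →ₗ[R] M), LinearMap.range f)).resolve_left h
  have hs : IsSimpleModule R (M ⧸ N) := isSimpleModule_iff_isCoatom.2 hN
  obtain ⟨i, ⟨ε⟩⟩ := W.complete (ModuleCat.of R (M ⧸ N)) hs
  have hpi : p i := by
    refine hp i ⟨ε.toLinearMap ∘ₗ N.mkQ, fun h0 => hN.1 (eq_top_iff.2 fun x _ => ?_)⟩
    have := LinearMap.congr_fun h0 x
    have h2 : ε (N.mkQ x) = 0 := this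
    have h3 : N.mkQ x = 0 := ε.map_eq_zero_iff.1 h2
    simpa using h3
  have := W.projective i
  obtain ⟨f, hf⟩ := Module.projective_lifting_property N.mkQ (ε.symm.toLinearMap ∘ₗ W.π i)
    N.mkQ_surjective
  have hr : LinearMap.range f ≤ N := le_trans
    (le_iSup_of_le i (le_iSup_of_le hpi (le_iSup_of_le f le_rfl))) hle
  have := W.simple i
  have := IsSimpleModule.nontrivial R (W.L i)
  obtain ⟨x, hx⟩ := exists_ne (0 : W.L i)
  obtain ⟨y, rfl⟩ := W.π_surjective i x
  apply hx
  have h1 : N.mkQ (f y) = ε.symm (W.π i y) := LinearMap.congr_fun hf y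
  have h2 : N.mkQ (f y) = 0 := by simpa using hr ⟨y, rfl⟩
  rw [h2] at h1
  exact ε.symm.map_eq_zero_iff.1 h1.symm

/-- Since J(J M) = J M, no nonzero quotient of J M is annihilated by J. Only the `P i` with J `L i`
≠ 0 are therefore needed to generate it. -/
theorem WeightSystem.smul_top_le_iSup {M : Type v} [AddCommGroup M] [Module R M]
    [IsNoetherian R M] {J : Ideal R} (hJ : J * J = J) :
    J • (⊤ : Submodule R M) ≤
      ⨆ (i : I) (_ : ∃ x ∈ J, ∃ y : W.L i, x • y ≠ 0) (f : W.P i →ₗ[R] M),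
        LinearMap.range f := by
  set N : Submodule R M := J • ⊤
  have key := W.iSup_range_eq_top (M := N) (fun i => ∃ x ∈ J, ∃ y : W.L i, x • y ≠ 0) (by
    rintro i ⟨g, hg⟩
    by_contra! hcon
    apply hg
    have hN : J • N ≤ (LinearMap.ker g).map N.subtype :=
      Submodule.smul_le.2 fun r hr x hx => ⟨r • ⟨x, hx⟩,
        by rw [SetLike.mem_coe, LinearMap.mem_ker, map_smul]; exact hcon r hr _, rfl⟩
    rw [← Submodule.mul_smul, hJ] at hN
    ext x
    obtain ⟨y, hy, hxy⟩ := hN x.2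
    rw [← Subtype.ext hxy]
    exact hy)
  calc N = (⊤ : Submodule R N).map N.subtype := by simp
    _ ≤ _ := by
      rw [← key]
      simp only [Submodule.map_iSup]
      refine iSup_mono fun i => iSup_mono fun _ => iSup_le fun f => ?_
      refine le_iSup_of_le (N.subtype ∘ₗ f) ?_
      rw [LinearMap.range_comp]

/-- A simple module over an Artinian ring has a projective cover. -/
theorem exists_projectiveCover [IsArtinianRing R] (L : Type v) [AddCommGroup L] [Module R L]
    [IsSimpleModule R L] :
    ∃ (P : ModuleCat.{v} R) (π : P →ₗ[R] L), Module.Projective R P ∧ Function.Surjective π ∧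
      ∀ N : Submodule R P, N ⊔ LinearMap.ker π = ⊤ → N = ⊤ := by
  -- A minimal element among the projective left ideals that map onto L is a projective cover.
  let S : Set (Ideal R) := {P | Module.Projective R P ∧ ∃ π : P →ₗ[R] L, Function.Surjective π}
  have hS : S.Nonempty := by
    have := IsSimpleModule.nontrivial R L
    obtain ⟨x, hx⟩ := exists_ne (0 : L)
    refine ⟨⊤, Module.Projective.of_equiv Submodule.topEquiv.symm,
      LinearMap.toSpanSingleton R L x ∘ₗ Submodule.topEquiv.toLinearMap, ?_⟩
    exact (IsSimpleModule.toSpanSingleton_surjective R hx).comp Submodule.topEquiv.surjective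
  obtain ⟨P, ⟨hP, π, hπ⟩, hmin⟩ := WellFounded.has_min wellFounded_lt S hS
  refine ⟨ModuleCat.of R P, π, hP, hπ, fun N hN => ?_⟩
  have hsurj : Function.Surjective (π ∘ₗ N.subtype) := by
    intro x
    obtain ⟨p, rfl⟩ := hπ x
    obtain ⟨n, hn, z, hz, rfl⟩ := Submodule.mem_sup.1 (hN ▸ Submodule.mem_top : p ∈ N ⊔ _)
    exact ⟨⟨n, hn⟩, by simpa using hz⟩
  obtain ⟨h, hh⟩ := Module.projective_lifting_property (π ∘ₗ N.subtype) π hsurj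
  let g : Module.End R P := N.subtype ∘ₗ h
  have hg : ∀ x, π (g x) = π x := fun x => LinearMap.congr_fun hh x
  have hgn : ∀ n x, π ((g ^ n) x) = π x := by
    intro n
    induction n with
    | zero => simp
    | succ n ih => intro x; rw [pow_succ, Module.End.mul_apply, ih, hg]
  -- Fitting's lemma: P is the direct sum of the kernel and the image of g ^ n for large n. The
  -- image is projective and still maps onto L because π g = π, so by minimality it is all of P. The
  -- condition n ≥ 1 places it inside N.
  obtain ⟨n, hn1, hn⟩ := ((Filter.eventually_ge_atTop 1).and
    (LinearMap.eventually_isCompl_ker_pow_range_pow g)).exists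
  set Q := LinearMap.range (g ^ n)
  have hQ : Module.Projective R Q := by
    refine Module.Projective.of_split Q.subtype (Submodule.projectionOnto _ _ hn.symm) ?_
    exact LinearMap.ext fun x => Submodule.projectionOnto_apply_left hn.symm x
  have hQS : Q.map P.subtype ∈ S := by
    let ε := Submodule.equivMapOfInjective P.subtype P.injective_subtype Q
    refine ⟨Module.Projective.of_equiv ε, π ∘ₗ Q.subtype ∘ₗ ε.symm.toLinearMap, ?_⟩
    have : Function.Surjective (π ∘ₗ Q.subtype) := fun x => by
      obtain ⟨p, rfl⟩ := hπ x
      exact ⟨⟨_, ⟨p, rfl⟩⟩, hgn n p⟩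
    exact this.comp ε.symm.surjective
  have hQtop : Q = ⊤ := by
    by_contra hne
    refine hmin _ hQS (lt_of_le_of_ne (Submodule.map_subtype_le _ _) fun heq => hne ?_)
    rw [eq_top_iff]
    intro x _
    have hx : (x : R) ∈ Q.map P.subtype := by rw [heq]; exact x.2
    obtain ⟨y, hy, hxy⟩ := hx
    rwa [← Subtype.ext hxy]
  rw [eq_top_iff]
  intro x _
  obtain ⟨y, rfl⟩ := (hQtop ▸ Submodule.mem_top : x ∈ Q)
  obtain ⟨n, rfl⟩ := Nat.exists_eq_add_of_le' hn1
  rw [pow_succ', Module.End.mul_apply]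
  exact (h _).2

/-- A complete irredundant family of simple modules over an Artinian ring is part of a weight
system. -/
theorem exists_weightSystem [IsArtinianRing R] {I : Type} (L : I → ModuleCat.{v} R)
    (simple : ∀ i, IsSimpleModule R (L i))
    (irredundant : ∀ i j, Nonempty (L i ≃ₗ[R] L j) → i = j)
    (complete : ∀ M : ModuleCat.{v} R, IsSimpleModule R M → ∃ i, Nonempty (M ≃ₗ[R] L i)) :
    ∃ W : WeightSystem R I, W.L = L := by
  have h := fun i => have := simple i; exists_projectiveCover (R := R) (L i)
  choose P π h1 h2 h3 using h
  exact ⟨⟨L, simple, irredundant, complete, P, h1, π, h2, h3⟩, rfl⟩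

end Weights

/-! ### Heredity chains and levels -/

section Chains

variable {R : Type v} [Ring R]

theorem HeredityChain.mono (c : HeredityChain R) {l l' : ℕ} (h : l ≤ l') (hl' : l' ≤ c.n) :
    c.J l ≤ c.J l' := by
  induction l', h using Nat.le_induction with
  | base => exact le_rfl
  | succ m _ ih => exact (ih (by omega)).trans (c.le_succ m (by omega))

/-- Idempotence is only given modulo `J l`. The error lies in `J l`, which is idempotent by
induction and contained in `J (l + 1)`. -/
theorem HeredityChain.mul_self (c : HeredityChain R) {l : ℕ} (hl : l ≤ c.n) :
    c.J l * c.J l = c.J l := by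
  induction l with
  | zero => simp [c.zero]
  | succ l ih =>
    specialize ih (by omega)
    have := c.twoSided l
    have := c.twoSided (l + 1)
    refine le_antisymm Ideal.mul_le_left ?_
    have hsurj := Ideal.Quotient.mk_surjective (I := c.J l)
    have h := (c.heredity l (by omega)).idem
    have hle : (c.J (l + 1)).map (Ideal.Quotient.mk (c.J l)) *
        (c.J (l + 1)).map (Ideal.Quotient.mk (c.J l)) ≤
        (c.J (l + 1) * c.J (l + 1)).map (Ideal.Quotient.mk (c.J l)) := by
      refine Ideal.mul_le.2 fun r hr s hs => ?_
      obtain ⟨a, ha, rfl⟩ := (Ideal.mem_map_iff_of_surjective _ hsurj).1 hr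
      obtain ⟨b, hb, rfl⟩ := (Ideal.mem_map_iff_of_surjective _ hsurj).1 hs
      rw [← map_mul]
      exact Ideal.mem_map_of_mem _ (Ideal.mul_mem_mul ha hb)
    rw [h] at hle
    intro x hx
    obtain ⟨y, hy, hxy⟩ := (Ideal.mem_map_iff_of_surjective _ hsurj).1
      (hle (Ideal.mem_map_of_mem _ hx))
    have hsub : x - y ∈ c.J l := (Ideal.Quotient.eq).1 hxy.symm
    rw [← ih] at hsub
    have hm := c.mono (Nat.le_succ l) hl
    have := Ideal.mul_mono hm hm hsub
    simpa using add_mem this hy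

theorem HeredityChain.mul_jacobson_mul_mem (c : HeredityChain R) {l : ℕ} (hl : l < c.n)
    {x r y : R} (hx : x ∈ c.J (l + 1)) (hr : r ∈ Ring.jacobson R) (hy : y ∈ c.J (l + 1)) :
    x * r * y ∈ c.J l := by
  have := c.twoSided l
  have h := (c.heredity l hl).rad
  have hsurj := Ideal.Quotient.mk_surjective (I := c.J l)
  rw [← Ideal.Quotient.eq_zero_iff_mem, map_mul, map_mul, ← Ideal.mem_bot, ← h]
  refine Ideal.mul_mem_mul (Ideal.mul_mem_mul (Ideal.mem_map_of_mem _ hx) ?_)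
    (Ideal.mem_map_of_mem _ hy)
  have : RingHomSurjective (Ideal.Quotient.mk (c.J l)) := ⟨hsurj⟩
  exact Ring.le_comap_jacobson (Ideal.Quotient.mk (c.J l)) hr

theorem HeredityChain.HasLevel.smul_eq_zero {c : HeredityChain R} {l : ℕ} {M : Type v}
    [AddCommGroup M] [Module R M] [IsSimpleModule R M] (h : c.HasLevel l M) {x : R}
    (hx : x ∈ c.J l) (m : M) : x • m = 0 := by
  obtain ⟨hl, f, hf, hf0⟩ := h
  obtain ⟨z, hz⟩ : ∃ z, f z ≠ 0 := by
    by_contra! hcon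
    exact hf (LinearMap.ext hcon)
  obtain ⟨r, rfl⟩ := IsSimpleModule.toSpanSingleton_surjective R hz m
  have := c.twoSided l
  rw [LinearMap.toSpanSingleton_apply, ← map_smul, ← map_smul]
  refine hf0 _ ?_
  exact (c.J l).mul_mem_right _ hx

/-- If `J (l + 1)` annihilated M, the map f would vanish on its square, which is all of `J (l + 1)`.
-/
theorem HeredityChain.HasLevel.exists_smul_ne_zero {c : HeredityChain R} {l : ℕ} {M : Type v}
    [AddCommGroup M] [Module R M] (h : c.HasLevel l M) :
    ∃ x ∈ c.J (l + 1), ∃ m : M, x • m ≠ 0 := by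
  obtain ⟨hl, f, hf, -⟩ := h
  by_contra! hcon
  apply hf
  have key : c.J (l + 1) * c.J (l + 1) ≤
      (LinearMap.ker f).map (Submodule.subtype (c.J (l + 1))) := by
    refine Ideal.mul_le.2 fun r hr s hs => ⟨r • ⟨s, hs⟩, ?_, rfl⟩
    rw [SetLike.mem_coe, LinearMap.mem_ker, map_smul]
    exact hcon r hr _
  rw [c.mul_self (by omega)] at key
  ext x
  obtain ⟨y, hy, hxy⟩ := key x.2
  rw [← Subtype.ext hxy]
  exact hy

end Chains

/-! ### Homomorphisms between standard modules -/

section Standard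

variable {R : Type v} [Ring R] {I : Type} (W : WeightSystem R I)

theorem WeightSystem.exists_toSpanSingleton_surjective (i : I) :
    ∃ x : W.P i, Function.Surjective (LinearMap.toSpanSingleton R (W.P i) x) := by
  have := W.simple i
  have := IsSimpleModule.nontrivial R (W.L i)
  obtain ⟨y, hy⟩ := exists_ne (0 : W.L i)
  obtain ⟨x, rfl⟩ := W.π_surjective i y
  refine ⟨x, W.surjective_of_comp _ ?_⟩
  convert IsSimpleModule.toSpanSingleton_surjective R hy using 1
  ext r; simp

theorem WeightSystem.finite_P (i : I) : Module.Finite R (W.P i) :=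
  (W.exists_toSpanSingleton_surjective i).elim fun _ hx => Module.Finite.of_surjective _ hx

/-- A homomorphism from `P i` to a simple module vanishes on the kernel of `P i → L i`. -/
theorem WeightSystem.ker_eq_of_simple {i : I} {M : Type*} [AddCommGroup M] [Module R M]
    [IsSimpleModule R M] (h : W.P i →ₗ[R] M) (h0 : h ≠ 0) :
    LinearMap.ker h = LinearMap.ker (W.π i) := by
  have hs : Function.Surjective h := LinearMap.surjective_of_ne_zero h0
  have hc : IsCoatom (LinearMap.ker h) := LinearMap.isCoatom_ker_of_surjective hs
  rcases hc.le_iff.1 (W.ker_le_ker h h0) with h1 | h1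
  · exact absurd h1 (W.isCoatom_ker i).1
  · exact h1.symm

theorem WeightSystem.exists_comp_π_eq {i : I} {M : Type*} [AddCommGroup M] [Module R M]
    [IsSimpleModule R M] (h : W.P i →ₗ[R] M) : ∃ g : W.L i →ₗ[R] M, g ∘ₗ W.π i = h := by
  by_cases h0 : h = 0
  · exact ⟨0, by simp [h0]⟩
  · let ε := (W.π i).quotKerEquivOfSurjective (W.π_surjective i)
    refine ⟨(LinearMap.ker (W.π i)).liftQ h (W.ker_eq_of_simple h h0).ge ∘ₗ ε.symm.toLinearMap, ?_⟩
    ext x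
    have : ε.symm (W.π i x) = Submodule.Quotient.mk x := by
      rw [LinearEquiv.symm_apply_eq]; rfl
    simp [this]

theorem WeightSystem.comp_π_eq_zero {i j : I} (hij : i ≠ j) (h : W.P j →ₗ[R] W.P i) :
    W.π i ∘ₗ h = 0 := by
  have := W.simple i
  by_contra h0
  have hs : Function.Surjective (W.π i ∘ₗ h) := LinearMap.surjective_of_ne_zero h0
  refine hij (W.irredundant i j ⟨?_⟩)
  exact ((W.π i ∘ₗ h).quotKerEquivOfSurjective hs).symm ≪≫ₗ
    Submodule.quotEquivOfEq _ _ (W.ker_eq_of_simple _ h0) ≪≫ₗ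
    (W.π j).quotKerEquivOfSurjective (W.π_surjective j)

theorem WeightSystem.traceSum_le_ker {le : I → I → Prop} {i : I} (hi : le i i) :
    W.traceSum le i ≤ LinearMap.ker (W.π i) := by
  refine iSup_le fun j => iSup_le fun hj => iSup_le fun f => ?_
  rw [LinearMap.range_le_ker_iff]
  exact W.comp_π_eq_zero (by rintro rfl; exact hj hi) f

/-- Such a map lifts to `P i → P j`, and the image of the lift belongs to the traces divided out in
the target. -/
theorem WeightSystem.hom_standard_eq_zero {le : I → I → Prop} {i j : I} (hij : ¬ le i j)
    (f : W.standard le i →ₗ[R] W.standard le j) : f = 0 := by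
  have := W.projective i
  obtain ⟨h, hh⟩ := Module.projective_lifting_property (W.traceSum le j).mkQ
    (f ∘ₗ (W.traceSum le i).mkQ) (Submodule.mkQ_surjective _)
  have hr : LinearMap.range h ≤ W.traceSum le j :=
    le_iSup_of_le i (le_iSup_of_le hij (le_iSup_of_le h le_rfl))
  refine Submodule.linearMap_qext _ ?_
  rw [← hh]
  ext x
  simpa using hr ⟨x, rfl⟩

/-- `P i` modulo its radical is cyclic over the semisimple R / rad R. A complement there of the
image of ker π pulls back to a submodule that spans `P i` together with ker π, so it is everything,
and the image of ker π is zero. -/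
theorem WeightSystem.ker_π_le_jacobson_smul [IsArtinianRing R] (i : I) :
    LinearMap.ker (W.π i) ≤ Ring.jacobson R • (⊤ : Submodule R (W.P i)) := by
  set Y := Ring.jacobson R • (⊤ : Submodule R (W.P i))
  obtain ⟨x, hx⟩ := W.exists_toSpanSingleton_surjective i
  let g : (R ⧸ Ring.jacobson R) →ₗ[R] (W.P i ⧸ Y) :=
    (Ring.jacobson R).liftQ (Y.mkQ ∘ₗ LinearMap.toSpanSingleton R (W.P i) x) (by
      intro r hr
      rw [LinearMap.mem_ker, LinearMap.comp_apply, Submodule.mkQ_apply,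
        Submodule.Quotient.mk_eq_zero]
      exact Submodule.smul_mem_smul hr Submodule.mem_top)
  have hg : Function.Surjective g := by
    intro y
    obtain ⟨y, rfl⟩ := Y.mkQ_surjective y
    obtain ⟨r, rfl⟩ := hx y
    exact ⟨Submodule.Quotient.mk r, rfl⟩
  have : IsSemisimpleModule R (R ⧸ Ring.jacobson R) :=
    (IsArtinian.isSemisimpleModule_iff_jacobson R _).2 (Module.jacobson_quotient_jacobson R R)
  have : IsSemisimpleModule R (W.P i ⧸ Y) := IsSemisimpleModule.of_surjective g hg
  obtain ⟨N, hN⟩ := exists_isCompl ((LinearMap.ker (W.π i)).map Y.mkQ)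
  have hY : Y ≤ LinearMap.ker (W.π i) := by
    have := W.simple i
    refine Submodule.smul_le.2 fun r hr y _ => ?_
    have := IsSemisimpleModule.jacobson_le_annihilator R (W.L i) hr
    simpa using Module.mem_annihilator.1 this (W.π i y)
  have hNt : N.comap Y.mkQ = ⊤ := by
    refine W.π_essential i _ ?_
    rw [eq_top_iff]
    intro y _
    obtain ⟨a, ha, b, hb, hab⟩ := Submodule.mem_sup.1
      (hN.sup_eq_top ▸ Submodule.mem_top : Y.mkQ y ∈ (LinearMap.ker (W.π i)).map Y.mkQ ⊔ N)
    obtain ⟨a, ha, rfl⟩ := ha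
    refine Submodule.mem_sup.2 ⟨y - a, ?_, a, ha, by abel⟩
    rw [Submodule.mem_comap, map_sub, ← hab]
    simpa using hb
  have hNt' : N = ⊤ := by
    rw [eq_top_iff]
    intro y _
    obtain ⟨y, rfl⟩ := Y.mkQ_surjective y
    exact (hNt ▸ Submodule.mem_top : y ∈ N.comap Y.mkQ)
  have hb := hN.inf_eq_bot
  rw [hNt', inf_top_eq] at hb
  intro y hy
  have : Y.mkQ y ∈ (LinearMap.ker (W.π i)).map Y.mkQ := ⟨y, hy, rfl⟩
  rw [hb] at this
  simpa using this

theorem HeredityChain.level_lt_of_smul_ne_zero {W : WeightSystem R I} {c : HeredityChain R}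
    {level : I → ℕ} (hc : ∀ i, c.HasLevel (level i) (W.L i)) {l : ℕ} {h : I}
    (hx : ∃ x ∈ c.J l, ∃ y : W.L h, x • y ≠ 0) : level h < l := by
  by_contra hlt
  obtain ⟨x, hx, y, hy⟩ := hx
  have := W.simple h
  exact hy ((hc h).smul_eq_zero (c.mono (not_lt.1 hlt) (hc h).1.le hx) y)

/-- A nilpotent endomorphism of a standard module, that is, one with image in the radical,
is zero. -/
theorem WeightSystem.end_standard_eq_zero [IsArtinianRing R] {le : I → I → Prop}
    (hq : IsQuasiHereditary W le) {i : I} (g : W.P i →ₗ[R] W.P i)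
    (hg : ∀ x, W.π i (g x) = 0) (x : W.P i) : g x ∈ W.traceSum le i := by
  obtain ⟨c, level, hc, hle⟩ := hq
  have hn := (hc i).1
  set l := level i
  have := c.twoSided l
  have := c.twoSided (l + 1)
  have := W.simple i
  have := W.finite_P i
  have hsmul {x : R} (hx : x ∈ c.J l) (m : W.L i) : x • m = 0 := (hc i).smul_eq_zero hx m
  -- `J (l + 1)` does not annihilate `L i`, so `J (l + 1) P i` is not contained in the largest
  -- proper submodule.
  have htop : c.J (l + 1) • (⊤ : Submodule R (W.P i)) = ⊤ := by
    refine W.π_essential i _ ?_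
    refine (W.isCoatom_ker i).2 _ (right_lt_sup.2 fun hcon => ?_)
    obtain ⟨x, hx, m, hm⟩ := (hc i).exists_smul_ne_zero
    obtain ⟨m, rfl⟩ := W.π_surjective i m
    have := hcon (Submodule.smul_mem_smul hx (Submodule.mem_top : m ∈ ⊤))
    exact hm (by simpa using this)
  -- The endomorphism maps `P i = J (l + 1) P i` into `J (l + 1)` times the radical of `P i`.
  -- Replacing `P i` by `J (l + 1) P i` once more makes the heredity condition J rad J ⊆ `J l`
  -- applicable.
  have hrad : LinearMap.range g ≤
      c.J (l + 1) • Ring.jacobson R • c.J (l + 1) • (⊤ : Submodule R (W.P i)) := by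
    rw [LinearMap.range_eq_map]
    conv_lhs => rw [← htop]
    rw [Submodule.map_smul'', htop]
    refine Submodule.smul_mono le_rfl ?_
    refine le_trans ?_ (W.ker_π_le_jacobson_smul i)
    rintro _ ⟨y, -, rfl⟩
    exact hg y
  have hrad2 : c.J (l + 1) • Ring.jacobson R • c.J (l + 1) • (⊤ : Submodule R (W.P i)) ≤
      c.J l • ⊤ := by
    rw [← Submodule.mul_smul, ← Submodule.mul_smul]
    refine Submodule.smul_mono ?_ le_rfl
    refine Ideal.mul_le.2 fun x hx z hz => ?_
    refine Submodule.mul_induction_on hx (fun y hy r hr => c.mul_jacobson_mul_mem hn hy hr hz) ?_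
    intro x y hx hy
    rw [add_mul]
    exact add_mem hx hy
  refine (hrad.trans (hrad2.trans ((W.smul_top_le_iSup (c.mul_self hn.le)).trans ?_))) ⟨x, rfl⟩
  refine iSup_mono fun h => iSup_le fun hx => ?_
  have hlt := HeredityChain.level_lt_of_smul_ne_zero hc hx
  refine le_iSup_of_le ?_ le_rfl
  rw [hle]
  rintro (rfl | h2) <;> omega

/-- If the endomorphisms of `L i` are scalar, so are those of the standard module. -/
theorem WeightSystem.end_standard [IsArtinianRing R] {k : Type*} [CommRing k] [Algebra k R]
    {le : I → I → Prop} (hq : IsQuasiHereditary W le) {i : I}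
    (hL : ∀ f : W.L i →ₗ[R] W.L i, ∃ a : k, ∀ x, f x = algebraMap k R a • x)
    (f : W.standard le i →ₗ[R] W.standard le i) : ∃ a : k, ∀ x, f x = algebraMap k R a • x := by
  have hi : le i i := by
    obtain ⟨c, level, hc, hle⟩ := hq
    exact (hle i i).2 (Or.inl rfl)
  have := W.projective i
  have := W.simple i
  obtain ⟨h, hh⟩ := Module.projective_lifting_property (W.traceSum le i).mkQ
    (f ∘ₗ (W.traceSum le i).mkQ) (Submodule.mkQ_surjective _)
  obtain ⟨f', hf'⟩ := W.exists_comp_π_eq (W.π i ∘ₗ h)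
  obtain ⟨a, ha⟩ := hL f'
  refine ⟨a, fun x => ?_⟩
  obtain ⟨x, rfl⟩ := Submodule.mkQ_surjective _ x
  -- The scalar a is the one by which the lift h acts on the top `L i`. The difference of h and this
  -- scalar has image in the radical, hence vanishes on the standard module.
  let s : W.P i →ₗ[R] W.P i :=
    { toFun := fun x => algebraMap k R a • x
      map_add' := fun x y => smul_add _ _ _
      map_smul' := fun r x => by
        simp only [RingHom.id_apply, ← mul_smul, Algebra.commutes] }
  have := W.end_standard_eq_zero hq (h - s) (fun x => by
    have h1 := LinearMap.congr_fun hf' x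
    simp only [LinearMap.comp_apply, ha] at h1
    simp [s, ← h1]) x
  have h2 := LinearMap.congr_fun hh x
  simp only [LinearMap.comp_apply] at h2
  rw [← h2, ← map_smul, ← sub_eq_zero, ← map_sub]
  exact (Submodule.Quotient.mk_eq_zero _).2 this

end Standard
end ReedyAlg

namespace ReedyAlg

/-! ### The radical of an Artinian ring -/

section Radical

theorem mem_jacobson_of_isNilpotent {R : Type*} [Ring R] {x : R}
    (h : ∀ a : R, IsNilpotent (a * x)) : x ∈ Ring.jacobson R := by
  rw [Ring.jacobson_eq_sInf_isMaximal, Submodule.mem_sInf]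
  intro (M : Ideal R) (hM : M.IsMaximal)
  by_contra hx
  obtain ⟨y, i, hi, hy⟩ := hM.exists_inv hx
  have h1 : i = 1 - y * x := by rw [← hy]; abel
  exact hM.ne_top (M.eq_top_of_isUnit_mem hi (h1 ▸ (h y).isUnit_one_sub))

theorem isNilpotent_jacobson {R : Type*} [Ring R] [IsArtinianRing R] :
    IsNilpotent (Ring.jacobson R) := by
  rw [← Ideal.jacobson_bot]
  exact IsArtinianRing.isNilpotent_jacobson_bot

theorem isNilpotent_of_mem_jacobson {R : Type*} [Ring R] [IsArtinianRing R] {x : R}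
    (hx : x ∈ Ring.jacobson R) : IsNilpotent x := by
  obtain ⟨n, hn⟩ := isNilpotent_jacobson (R := R)
  refine ⟨n, ?_⟩
  have := Ideal.pow_mem_pow hx n
  rwa [hn] at this

theorem isSemisimpleRing_of_injective {k R ι : Type*} [Field k] [Ring R] [IsArtinianRing R]
    (q : R →+* (ι → k)) (hq : Function.Injective q) : IsSemisimpleRing R := by
  rw [IsArtinianRing.isSemisimpleRing_iff_jacobson, eq_bot_iff]
  intro x hx
  have h1 := (isNilpotent_of_mem_jacobson hx).map q
  exact hq (by rw [h1.eq_zero, map_zero])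

end Radical

/-! ### Algebras that are split modulo the radical -/

variable {k : Type u} [Field k]

/-- The homomorphism `q` identifies `R / rad R` with a product of copies of `k`, and the `e i` are
complete orthogonal idempotents lifting its standard basis. -/
structure IsSplit {R : Type*} [Ring R] [Algebra k R] {ι : Type*} [Fintype ι] [DecidableEq ι]
    (q : R →ₐ[k] (ι → k)) (e : ι → R) : Prop where
  complete : CompleteOrthogonalIdempotents e
  q_e : ∀ i, q (e i) = Pi.single i 1
  ker : ∀ x, q x = 0 ↔ x ∈ Ring.jacobson R

section Split

variable {R : Type*} [Ring R] [Algebra k R] {ι : Type*} [Fintype ι] [DecidableEq ι]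
  {q : R →ₐ[k] (ι → k)} {e : ι → R}

theorem apply_eq_zero_of_mem_jacobson (hq : Function.Surjective q) {x : R}
    (hx : x ∈ Ring.jacobson R) : q x = 0 := by
  have : RingHomSurjective (q : R →+* (ι → k)) := ⟨hq⟩
  have := Ring.le_comap_jacobson (q : R →+* (ι → k)) hx
  rw [IsSemisimpleRing.jacobson_eq_bot] at this
  exact this

theorem surjective_of_single (h : ∀ i, q (e i) = Pi.single i 1) : Function.Surjective q := by
  intro f
  refine ⟨∑ i, f i • e i, ?_⟩
  rw [map_sum]
  ext j
  simp [h, Pi.single_apply]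

theorem IsSplit.of_nil (complete : CompleteOrthogonalIdempotents e)
    (q_e : ∀ i, q (e i) = Pi.single i 1) (nil : ∀ x, q x = 0 → IsNilpotent x) :
    IsSplit q e := by
  refine ⟨complete, q_e, fun x => ⟨fun hx => mem_jacobson_of_isNilpotent fun a => nil _ ?_, ?_⟩⟩
  · rw [map_mul, hx, mul_zero]
  · exact apply_eq_zero_of_mem_jacobson (surjective_of_single q_e)

variable (h : IsSplit q e)
include h

theorem IsSplit.reindex {κ : Type*} [Fintype κ] [DecidableEq κ] (σ : κ ≃ ι) :
    IsSplit ((Pi.evalAlgHom k (fun _ : ι => k) <| σ ·) |> AlgHom.pi |>.comp q) (e ∘ σ) := by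
  refine ⟨(CompleteOrthogonalIdempotents.equiv σ).2 h.complete, fun i => ?_, fun x => ?_⟩
  · ext j
    simp [h.q_e, Pi.single_apply]
  · rw [← h.ker]
    refine ⟨fun hx => ?_, fun hx => ?_⟩
    · ext i
      have := congrFun hx (σ.symm i)
      simpa using this
    · ext i
      have := congrFun hx (σ i)
      simpa using this

theorem IsSplit.op [FiniteDimensional k R] :
    IsSplit (q.fromOpposite fun _ _ => mul_comm _ _) (MulOpposite.op ∘ e) := by
  have := IsArtinianRing.of_finite k R
  refine IsSplit.of_nil ?_ ?_ ?_
  · refine ⟨⟨fun i => ?_, fun i j hij => ?_⟩, ?_⟩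
    · exact congrArg MulOpposite.op (h.complete.idem i)
    · exact congrArg MulOpposite.op (h.complete.ortho hij.symm)
    · simpa using congrArg MulOpposite.op h.complete.complete
  · exact h.q_e
  · intro x hx
    have := isNilpotent_of_mem_jacobson ((h.ker x.unop).1 hx)
    obtain ⟨n, hn⟩ := this
    exact ⟨n, MulOpposite.unop_injective (by simpa using hn)⟩

theorem IsSplit.e_mul_e (i j : ι) : e i * e j = if i = j then e i else 0 :=
  h.complete.mul_eq i j

theorem IsSplit.e_mul_self (i : ι) : e i * e i = e i := by simp [h.e_mul_e]

theorem IsSplit.q_sub (x : R) : q (x - ∑ i, q x i • e i) = 0 := by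
  rw [map_sub, map_sum, sub_eq_zero]
  ext j
  simp [h.q_e, Pi.single_apply]

theorem IsSplit.exists_eq_add (x : R) : ∃ r, q r = 0 ∧ x = ∑ i, q x i • e i + r :=
  ⟨_, h.q_sub x, by abel⟩

theorem IsSplit.exists_ker_pow_eq_bot [FiniteDimensional k R] :
    ∃ n, LinearMap.ker q.toLinearMap ^ n = ⊥ := by
  have := IsArtinianRing.of_finite k R
  obtain ⟨n, hn⟩ := isNilpotent_jacobson (R := R)
  have h2 : ∀ n, ∀ x ∈ LinearMap.ker q.toLinearMap ^ n, x ∈ Ring.jacobson R ^ n := by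
    intro n
    induction n with
    | zero => intro x _; rw [Submodule.pow_zero, Ideal.one_eq_top]; exact Submodule.mem_top
    | succ n ih =>
      intro x hx
      rw [pow_succ] at hx
      rw [Submodule.pow_succ]
      refine Submodule.mul_induction_on hx (fun a ha b hb => ?_) fun a b ha hb => add_mem ha hb
      exact Ideal.mul_mem_mul (ih a ha) ((h.ker b).1 hb)
  refine ⟨n, ?_⟩
  rw [eq_bot_iff]
  intro x hx
  have := h2 n x hx
  rw [hn] at this
  exact this

/-- If `U ⊆ U rad R` then `U = 0`. -/
theorem IsSplit.eq_bot_of_le_mul [FiniteDimensional k R] {U : Submodule k R}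
    (hU : U ≤ U * LinearMap.ker q.toLinearMap) : U = ⊥ := by
  obtain ⟨n, hn⟩ := h.exists_ker_pow_eq_bot
  have h1 : ∀ n, U ≤ U * LinearMap.ker q.toLinearMap ^ n := by
    intro n
    induction n with
    | zero => simp
    | succ n ih =>
      calc U ≤ U * LinearMap.ker q.toLinearMap := hU
        _ ≤ (U * LinearMap.ker q.toLinearMap ^ n) * LinearMap.ker q.toLinearMap :=
          mul_le_mul' ih le_rfl
        _ = _ := by rw [mul_assoc, pow_succ]
  have := h1 n
  rwa [hn, Submodule.mul_bot, le_bot_iff] at this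

omit h in
theorem IsSplit.corner_nil (h : IsSplit q e) {i j : ι} (hij : i ≠ j) (x : R) :
    q (e i * x * e j) = 0 := by
  rw [map_mul, map_mul, h.q_e, h.q_e]
  ext a
  simp only [Pi.mul_apply, Pi.single_apply, Pi.zero_apply]
  split_ifs with h1 h2 <;> simp_all

/-- A two-sided ideal with an element of nonzero `i`-th coordinate contains `e i`. -/
theorem IsSplit.mem_of_apply_ne_zero [FiniteDimensional k R] {J : Ideal R} [J.IsTwoSided] {x : R}
    (hx : x ∈ J) {i : ι} (hi : q x i ≠ 0) : e i ∈ J := by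
  have := IsArtinianRing.of_finite k R
  -- The element y of J is congruent to e i modulo the radical. In R / J the idempotent e i thus
  -- equals the nilpotent element e i - y, so it is zero.
  set y := (q x i)⁻¹ • (e i * x * e i) with hy
  have hyJ : y ∈ J := Submodule.smul_of_tower_mem J _ (J.mul_mem_right _ (J.mul_mem_left _ hx))
  have hq : q (e i - y) = 0 := by
    rw [hy, map_sub, map_smul, map_mul, map_mul, h.q_e]
    ext a
    by_cases ha : a = i
    · subst ha; simp [hi]
    · simp [ha]
  obtain ⟨n, hn⟩ := isNilpotent_of_mem_jacobson ((h.ker _).1 hq)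
  rw [← Ideal.Quotient.eq_zero_iff_mem]
  have h1 : Ideal.Quotient.mk J (e i - y) = Ideal.Quotient.mk J (e i) := by
    rw [map_sub, Ideal.Quotient.eq_zero_iff_mem.2 hyJ, sub_zero]
  have h2 : IsIdempotentElem (Ideal.Quotient.mk J (e i)) := (h.complete.idem i).map _
  rcases n with _ | n
  · rw [pow_zero] at hn
    rw [← mul_one (e i), hn, mul_zero, map_zero]
  · rw [← h2.pow_succ_eq n, ← h1, ← map_pow, hn, map_zero]

end Split

/-! ### Simple modules of a split algebra -/

section Simple

variable {R : Type v} [Ring R] [Algebra k R] [FiniteDimensional k R]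
  {ι : Type} [Fintype ι] [DecidableEq ι] {q : R →ₐ[k] (ι → k)} {e : ι → R}

/-- `R` acts on `M` through the `i`-th coordinate of `q`. -/
def ActsBy (q : R →ₐ[k] (ι → k)) (i : ι) (M : Type*) [AddCommGroup M] [Module R M] : Prop :=
  ∀ (r : R) (x : M), r • x = algebraMap k R (q r i) • x

/-- If e i x ≠ 0, then (r - q r i) e i lies in the radical and annihilates x, so e i x is an
eigenvector. It generates M, and as scalars are central the eigenvalues are the same on all of M. -/
theorem IsSplit.exists_actsBy (h : IsSplit q e) (M : Type v) [AddCommGroup M] [Module R M]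
    [IsSimpleModule R M] : ∃ i, ActsBy q i M := by
  have := IsSimpleModule.nontrivial R M
  obtain ⟨x, hx⟩ := exists_ne (0 : M)
  obtain ⟨i, hi⟩ : ∃ i, e i • x ≠ 0 := by
    by_contra! hcon
    apply hx
    rw [← one_smul R x, ← h.complete.complete, Finset.sum_smul]
    exact Finset.sum_eq_zero fun i _ => hcon i
  refine ⟨i, ?_⟩
  have key : ∀ r : R, r • e i • x = algebraMap k R (q r i) • e i • x := by
    intro r
    rw [← sub_eq_zero, ← sub_smul, ← mul_smul]
    have h0 : q ((r - algebraMap k R (q r i)) * e i) = 0 := by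
      rw [map_mul, map_sub, h.q_e, AlgHom.commutes]
      ext a
      by_cases ha : a = i
      · subst ha; simp
      · simp [ha]
    have := IsSemisimpleModule.jacobson_le_annihilator R M ((h.ker _).1 h0)
    exact Module.mem_annihilator.1 this x
  intro r y
  obtain ⟨s, rfl⟩ := IsSimpleModule.toSpanSingleton_surjective R hi y
  rw [LinearMap.toSpanSingleton_apply, key s, ← mul_smul, ← Algebra.commutes, mul_smul, key r,
    ← mul_smul, ← mul_smul, ← mul_smul, ← mul_smul, ← map_mul, ← map_mul, mul_comm]

theorem ActsBy.e_smul (h : IsSplit q e) {M : Type*} [AddCommGroup M] [Module R M] {i : ι}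
    (hM : ActsBy q i M) (x : M) : e i • x = x := by
  rw [hM, h.q_e]; simp

theorem ActsBy.ker_toSpanSingleton {M : Type*} [AddCommGroup M] [Module R M]
    {i : ι} (hM : ActsBy q i M) {x : M} (hx : x ≠ 0) (r : R) : r • x = 0 ↔ q r i = 0 := by
  rw [hM]
  refine ⟨fun h0 => ?_, fun h0 => by simp [h0]⟩
  by_contra hne
  apply hx
  have := congrArg (algebraMap k R (q r i)⁻¹ • ·) h0
  simpa [← mul_smul, ← map_mul, hne] using this

theorem ActsBy.nonempty_equiv {M N : Type*} [AddCommGroup M] [Module R M] [IsSimpleModule R M]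
    [AddCommGroup N] [Module R N] [IsSimpleModule R N] {i : ι} (hM : ActsBy q i M)
    (hN : ActsBy q i N) : Nonempty (M ≃ₗ[R] N) := by
  have := IsSimpleModule.nontrivial R M
  have := IsSimpleModule.nontrivial R N
  obtain ⟨x, hx⟩ := exists_ne (0 : M)
  obtain ⟨y, hy⟩ := exists_ne (0 : N)
  refine ⟨((LinearMap.toSpanSingleton R M x).quotKerEquivOfSurjective
    (IsSimpleModule.toSpanSingleton_surjective R hx)).symm ≪≫ₗ Submodule.quotEquivOfEq _ _ ?_ ≪≫ₗ
    ((LinearMap.toSpanSingleton R N y).quotKerEquivOfSurjective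
    (IsSimpleModule.toSpanSingleton_surjective R hy))⟩
  ext r
  simp [hM.ker_toSpanSingleton hx, hN.ker_toSpanSingleton hy]

/-- The kernel of the `i`-th coordinate of `q`. -/
def coordKer (q : R →ₐ[k] (ι → k)) (i : ι) : Ideal R :=
  RingHom.ker ((Pi.evalRingHom (fun _ : ι => k) i).comp (q : R →+* (ι → k)))

omit [FiniteDimensional k R] [Fintype ι] [DecidableEq ι] in
theorem mem_coordKer {i : ι} {r : R} : r ∈ coordKer q i ↔ q r i = 0 := Iff.rfl

theorem IsSplit.isSimpleModule (h : IsSplit q e) (i : ι) :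
    IsSimpleModule R (R ⧸ coordKer q i) := by
  rw [isSimpleModule_iff_isCoatom]
  have hs : Function.Surjective
      ((Pi.evalRingHom (fun _ : ι => k) i).comp (q : R →+* (ι → k))) :=
    (Function.surjective_eval i).comp (surjective_of_single h.q_e)
  exact (RingHom.ker_isMaximal_of_surjective _ hs).out

theorem IsSplit.actsBy_quotient (i : ι) :
    ActsBy q i (R ⧸ coordKer q i) := by
  intro r x
  obtain ⟨x, rfl⟩ := Submodule.Quotient.mk_surjective _ x
  rw [← Submodule.Quotient.mk_smul, ← Submodule.Quotient.mk_smul, Submodule.Quotient.eq,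
    mem_coordKer]
  simp

theorem ActsBy.index_eq (h : IsSplit q e) {M : Type*} [AddCommGroup M] [Module R M]
    [Nontrivial M] {i j : ι} (hi : ActsBy q i M) (hj : ActsBy q j M) : i = j := by
  obtain ⟨x, hx⟩ := exists_ne (0 : M)
  by_contra hij
  have h1 := hi.e_smul h x
  rw [hj, h.q_e, Pi.single_eq_of_ne (Ne.symm hij)] at h1
  exact hx (by simpa using h1.symm)

theorem ActsBy.congr {M N : Type*} [AddCommGroup M] [Module R M] [AddCommGroup N] [Module R N]
    {i : ι} (hM : ActsBy q i M) (f : M ≃ₗ[R] N) : ActsBy q i N := by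
  intro r x
  obtain ⟨x, rfl⟩ := f.surjective x
  rw [← map_smul, hM, map_smul]

/-- The weights of a split algebra correspond to the factors of `R / rad R`. -/
theorem IsSplit.exists_equiv (h : IsSplit q e) {I : Type} (W : WeightSystem R I) :
    ∃ σ : I ≃ ι, ∀ i, ActsBy q (σ i) (W.L i) := by
  have hex := fun i => have := W.simple i; h.exists_actsBy (W.L i)
  choose σ hσ using hex
  refine ⟨Equiv.ofBijective σ ⟨fun i j hij => ?_, fun a => ?_⟩, hσ⟩
  · have := W.simple i
    have := W.simple j
    exact W.irredundant i j ((hσ i).nonempty_equiv (hij ▸ hσ j))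
  · have := h.isSimpleModule a
    obtain ⟨i, ⟨f⟩⟩ := W.complete (ModuleCat.of R (R ⧸ coordKer q a)) this
    have := W.simple i
    have := IsSimpleModule.nontrivial R (W.L i)
    exact ⟨i, (hσ i).index_eq h ((IsSplit.actsBy_quotient a).congr f)⟩

/-- A split algebra whose factors are indexed by the weights. -/
structure IsLabelled {I : Type} [Fintype I] [DecidableEq I] (W : WeightSystem R I)
    (q : R →ₐ[k] (I → k)) (e : I → R) : Prop extends IsSplit q e where
  acts : ∀ i, ActsBy q i (W.L i)

theorem IsSplit.exists_isLabelled (h : IsSplit q e) {I : Type} [Fintype I] [DecidableEq I]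
    (W : WeightSystem R I) : ∃ (σ : I ≃ ι) (q' : R →ₐ[k] (I → k)),
      (∀ r i, q' r i = q r (σ i)) ∧ IsLabelled W q' (e ∘ σ) := by
  obtain ⟨σ, hσ⟩ := h.exists_equiv W
  exact ⟨σ, _, fun _ _ => rfl, h.reindex σ, hσ⟩

end Simple
end ReedyAlg

namespace ReedyAlg

variable {k : Type u} [Field k]

/-! ### Directedness forced by simple or by projective standard modules -/

section Directed

variable {R : Type v} [Ring R] [Algebra k R] [FiniteDimensional k R]
  {I : Type} [Fintype I] [DecidableEq I] {W : WeightSystem R I}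
  {q : R →ₐ[k] (I → k)} {e : I → R}

/-- The projective cover `P i` is isomorphic to `R e i`. -/
theorem IsLabelled.exists_generator (h : IsLabelled W q e) (i : I) :
    ∃ p : W.P i, e i • p = p ∧ Function.Surjective (LinearMap.toSpanSingleton R (W.P i) p) ∧
      ∀ a : R, a • p = 0 → a * e i = 0 := by
  have := W.simple i
  have := W.projective i
  have := IsSimpleModule.nontrivial R (W.L i)
  have := IsArtinianRing.of_finite k R
  obtain ⟨y, hy⟩ := exists_ne (0 : W.L i)
  obtain ⟨p', rfl⟩ := W.π_surjective i y
  set p := e i • p'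
  have hp : e i • p = p := by rw [← mul_smul, h.e_mul_self]
  have hπ : W.π i p ≠ 0 := by
    rwa [map_smul, (h.acts i).e_smul h.toIsSplit]
  have hs : Function.Surjective (LinearMap.toSpanSingleton R (W.P i) p) := by
    refine W.surjective_of_comp _ ?_
    convert IsSimpleModule.toSpanSingleton_surjective R hπ using 1
    ext r; simp
  refine ⟨p, hp, hs, fun a ha => ?_⟩
  -- Let s split the map R → `P i`, a ↦ a p. The element z = e_i s(p) e_i is congruent to e_i modulo
  -- the radical, and a p = 0 implies a z = 0. Then a e_i = a e_i (e_i - z) ^ n for all n, which is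
  -- eventually zero.
  obtain ⟨s, hs'⟩ := Module.projective_lifting_property _
    (LinearMap.id : W.P i →ₗ[R] W.P i) hs
  set z := e i * s p * e i with hz
  have hzp : s p • p = p := by simpa using LinearMap.congr_fun hs' p
  have hq : q (e i - z) = 0 := by
    have h1 : s p • W.π i p = W.π i p := by rw [← map_smul, hzp]
    rw [h.acts i] at h1
    have h2 : q (s p) i = 1 := by
      have h3 := ((h.acts i).ker_toSpanSingleton hπ (algebraMap k R (q (s p) i) - 1)).1 (by
        rw [sub_smul, h1, one_smul, sub_self])
      rw [map_sub, AlgHom.commutes, map_one] at h3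
      simpa [sub_eq_zero] using h3
    rw [hz, map_sub, map_mul, map_mul, h.q_e]
    ext b
    by_cases hb : b = i
    · subst hb; simp [h2]
    · simp [hb]
  have haz : a * z = 0 := by
    have h1 : s p = e i * s p := by
      conv_lhs => rw [← hp, map_smul, smul_eq_mul]
    rw [hz, ← h1, ← mul_assoc, ← smul_eq_mul a (s p), ← map_smul, ha, map_zero, zero_mul]
  obtain ⟨n, hn⟩ := isNilpotent_of_mem_jacobson ((h.ker _).1 hq)
  have hne : e i * (e i - z) = e i - z := by
    simp [hz, mul_sub, ← mul_assoc, h.e_mul_self]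
  have key : a * e i = a * e i * (e i - z) := by
    rw [mul_assoc, hne, mul_sub, haz, sub_zero]
  have key2 : ∀ n, a * e i = a * e i * (e i - z) ^ n := by
    intro n
    induction n with
    | zero => simp
    | succ n ih => rw [pow_succ, ← mul_assoc, ← ih]; exact key
  rw [key2 n, hn, mul_zero]

/-- When `P j` and `P i` are identified with R e_j and R e_i, the homomorphism is right
multiplication by e_j x e_i. -/
theorem IsLabelled.exists_hom_ne_zero (h : IsLabelled W q e) {i j : I} {x : R}
    (hx : e j * x * e i ≠ 0) :
    ∃ f : W.P j →ₗ[R] W.P i, f ≠ 0 ∧ (q x i = 0 → ∀ y, W.π i (f y) = 0) := by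
  obtain ⟨p, hp, hs, ha⟩ := h.exists_generator j
  obtain ⟨p', hp', hs', ha'⟩ := h.exists_generator i
  let ε := (LinearMap.toSpanSingleton R (W.P j) p).quotKerEquivOfSurjective hs
  let f : W.P j →ₗ[R] W.P i := (LinearMap.ker (LinearMap.toSpanSingleton R (W.P j) p)).liftQ
    (LinearMap.toSpanSingleton R (W.P i) (e j • x • p')) (by
      intro a h0
      have := ha a (by simpa using h0)
      rw [LinearMap.mem_ker, LinearMap.toSpanSingleton_apply, ← mul_smul, this, zero_smul])
    ∘ₗ ε.symm.toLinearMap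
  have h1 : f p = e j • x • p' := by
    have : ε.symm p = Submodule.Quotient.mk 1 := by
      rw [LinearEquiv.symm_apply_eq]
      simp [ε]
    simp [f, this]
  refine ⟨f, fun h0 => hx ?_, fun hq y => ?_⟩
  swap
  · obtain ⟨a, rfl⟩ := hs y
    rw [LinearMap.toSpanSingleton_apply, map_smul, h1, map_smul, map_smul, map_smul, h.acts i x,
      hq, map_zero, zero_smul, smul_zero, smul_zero]
  rw [h0, LinearMap.zero_apply, ← mul_smul] at h1
  exact ha' _ h1.symm

omit [Fintype I] [DecidableEq I] in
-- A section of `P i → Δ(i)` is surjective, since the trace sum is contained in the superfluous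
-- kernel of `π`. The projection is therefore injective.
theorem WeightSystem.traceSum_eq_bot_of_projective {le : I → I → Prop} {i : I} (hi : le i i)
    (hp : Module.Projective R (W.standard le i)) : W.traceSum le i = ⊥ := by
  obtain ⟨s, hs⟩ := Module.projective_lifting_property (W.traceSum le i).mkQ
    LinearMap.id (Submodule.mkQ_surjective _)
  have hs' : ∀ y, (W.traceSum le i).mkQ (s y) = y := fun y => LinearMap.congr_fun hs y
  have ht : LinearMap.range s = ⊤ := by
    refine W.π_essential i _ (eq_top_iff.2 fun x _ => ?_)
    refine Submodule.mem_sup.2 ⟨s ((W.traceSum le i).mkQ x), ⟨_, rfl⟩,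
      x - s ((W.traceSum le i).mkQ x), W.traceSum_le_ker hi ?_, by abel⟩
    rw [← Submodule.Quotient.mk_eq_zero, ← Submodule.mkQ_apply, map_sub, hs', sub_self]
  rw [eq_bot_iff]
  intro t ht'
  obtain ⟨y, rfl⟩ := (ht ▸ Submodule.mem_top : t ∈ LinearMap.range s)
  have : (W.traceSum le i).mkQ (s y) = 0 := by simpa using ht'
  rw [hs'] at this
  simp [this]

/-- If the standard modules are projective, then `e j R e i = 0` unless `j ◁ i` or `j = i`. -/
theorem IsLabelled.directed_of_projective (h : IsLabelled W q e) {le : I → I → Prop} {i j : I}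
    (hi : le i i) (hp : Module.Projective R (W.standard le i)) {x : R}
    (hx : e j * x * e i ≠ 0) : le j i := by
  by_contra hj
  obtain ⟨f, hf, -⟩ := h.exists_hom_ne_zero hx
  apply hf
  have : LinearMap.range f ≤ W.traceSum le i :=
    le_iSup_of_le j (le_iSup_of_le hj (le_iSup_of_le f le_rfl))
  rw [W.traceSum_eq_bot_of_projective hi hp, le_bot_iff] at this
  exact LinearMap.range_eq_bot.1 this

/-- If the standard module is simple, the radical of `R e i` is generated by the `e j R e i`
with `j ⋬ i`. -/
theorem IsLabelled.mul_e_mem_span (h : IsLabelled W q e) {le : I → I → Prop} {i : I}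
    (hi : le i i) (hs : IsSimpleModule R (W.standard le i)) {x : R} (hx : q x = 0) :
    x * e i ∈ Submodule.span R {z | ∃ j, ¬ le j i ∧ ∃ s : R, z = e j * s * e i} := by
  obtain ⟨p, hp, hgen, ha⟩ := h.exists_generator i
  -- A simple quotient makes the trace sum maximal, and it is contained in the proper submodule ker
  -- π.
  have hker : W.traceSum le i = LinearMap.ker (W.π i) := by
    have hc : IsCoatom (W.traceSum le i) := isSimpleModule_iff_isCoatom.1 hs
    rcases hc.le_iff.1 (W.traceSum_le_ker hi) with h1 | h1
    · exact absurd h1 (W.isCoatom_ker i).1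
    · exact h1.symm
  set N := Submodule.span R {z | ∃ j, ¬ le j i ∧ ∃ s : R, z = e j * s * e i}
  -- A homomorphism `P j → P i` sends the generator of `P j` to e_j s p for some s.
  have hle : W.traceSum le i ≤ N.map (LinearMap.toSpanSingleton R (W.P i) p) := by
    refine iSup_le fun j => iSup_le fun hj => iSup_le fun f => ?_
    rintro _ ⟨y, rfl⟩
    obtain ⟨p', hp', hgen', -⟩ := h.exists_generator j
    obtain ⟨b, rfl⟩ := hgen' y
    obtain ⟨s, hs⟩ := hgen (f p')
    refine ⟨b * (e j * s * e i), N.smul_mem b (Submodule.subset_span ⟨j, hj, s, rfl⟩), ?_⟩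
    simp only [LinearMap.toSpanSingleton_apply] at hs ⊢
    rw [map_smul, mul_smul, mul_smul, mul_smul, hp, hs, ← map_smul, hp']
  have hxp : x • p ∈ W.traceSum le i := by
    rw [hker, LinearMap.mem_ker, map_smul, h.acts i, hx]
    simp
  obtain ⟨n, hn, hnp⟩ := hle hxp
  have hxn : x * e i = n * e i := by
    rw [← sub_eq_zero, ← sub_mul]
    refine ha _ ?_
    rw [sub_smul, ← hnp, LinearMap.toSpanSingleton_apply, sub_self]
  have hmul : N ≤ N.comap (LinearMap.toSpanSingleton R R (e i)) := by
    refine Submodule.span_le.2 ?_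
    rintro _ ⟨j, hj, s, rfl⟩
    refine Submodule.subset_span ⟨j, hj, s, ?_⟩
    rw [LinearMap.toSpanSingleton_apply, smul_eq_mul, mul_assoc, h.e_mul_self]
  rw [hxn]
  exact hmul hn

/-- A split quasi-hereditary algebra with simple standard modules is directed. -/
theorem IsLabelled.directed_of_simple (h : IsLabelled W q e) {le : I → I → Prop}
    (hq : IsQuasiHereditary W le) (hs : ∀ i, IsSimpleModule R (W.standard le i)) {i j : I}
    (hij : i ≠ j) {x : R} (hx : e j * x * e i ≠ 0) : le i j := by
  obtain ⟨c, level, hc, hle⟩ := hq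
  have hrefl : ∀ i, le i i := fun i => (hle i i).2 (Or.inl rfl)
  set K := LinearMap.ker q.toLinearMap
  -- no homomorphisms from lower to higher levels
  have mul_eq_zero_of_lt : ∀ {i j : I} (x : R), level i < level j → e j * x * e i = 0 := by
    intro i j x hlt
    set t := level i
    set ε : R := ∑ a with level a ≤ t, e a
    have hε : ∀ a, level a ≤ t → e a * ε = e a := by
      intro a ha
      rw [Finset.mul_sum, Finset.sum_eq_single a]
      · exact h.e_mul_self a
      · intro b _ hb
        rw [h.e_mul_e, if_neg (Ne.symm hb)]
      · simp [ha]
    have hε' : ∀ a, level a ≤ t → ε * e a = e a := by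
      intro a ha
      rw [Finset.sum_mul, Finset.sum_eq_single a]
      · exact h.e_mul_self a
      · intro b _ hb
        rw [h.e_mul_e, if_neg hb]
      · simp [ha]
    have hεj : e j * ε = 0 := by
      rw [Finset.mul_sum]
      refine Finset.sum_eq_zero fun a ha => ?_
      rw [h.e_mul_e, if_neg]
      rintro rfl
      simp only [Finset.mem_filter] at ha
      omega
    let U : Submodule k R := LinearMap.range (LinearMap.mulLeftRight k (1 - ε, ε))
    have memU : ∀ x, (1 - ε) * x * ε ∈ U := fun x => ⟨x, rfl⟩
    -- By `mul_e_mem_span`, rad R e_a is generated by elements e_b s e_a with b ≠ a and level b ≤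
    -- level a ≤ t. Here e_b = e_b ε, so each product factors as an element of (1 - ε) R ε times an
    -- element of the radical, and Nakayama's lemma applies.
    have hU : U = ⊥ := by
      refine h.eq_bot_of_le_mul ?_
      rintro _ ⟨x, rfl⟩
      change (1 - ε) * x * ε ∈ U * K
      rw [Finset.mul_sum]
      refine sum_mem fun a ha => ?_
      have hat : level a ≤ t := by simpa using ha
      have hr : q (x * e a - q x a • e a) = 0 := by
        rw [map_sub, map_mul, map_smul, h.q_e]
        ext b
        by_cases hb : b = a
        · subst hb; simp
        · simp [hb]
      have h1 : (1 - ε) * x * e a = (1 - ε) * ((x * e a - q x a • e a) * e a) := by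
        have h0 : (1 - ε) * e a = 0 := by rw [sub_mul, one_mul, hε' a hat, sub_self]
        rw [sub_mul (x * e a), mul_sub, smul_mul_assoc, h.e_mul_self, mul_smul_comm, h0, smul_zero,
          sub_zero, mul_assoc x, h.e_mul_self, mul_assoc]
      rw [h1]
      have h2 := h.mul_e_mem_span (hrefl a) (hs a) hr
      have h3 : ∀ z ∈ Submodule.span R {z | ∃ j, ¬ le j a ∧ ∃ s : R, z = e j * s * e a},
          ∀ r, (1 - ε) * (r * z) ∈ U * K := by
        intro z hz
        induction hz using Submodule.span_induction with
        | mem z hz =>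
          obtain ⟨b, hb, s, rfl⟩ := hz
          intro r
          rw [hle] at hb
          push Not at hb
          have hbt : level b ≤ t := by omega
          have h4 : (1 - ε) * (r * (e b * s * e a)) =
              ((1 - ε) * (r * e b) * ε) * (e b * s * e a) := by
            simp only [mul_assoc]
            rw [← mul_assoc (e b) ε, hε b hbt, ← mul_assoc (e b) (e b), h.e_mul_self]
          rw [h4]
          exact Submodule.mul_mem_mul (memU _) (IsSplit.corner_nil h.toIsSplit hb.1 s)
        | zero => simp
        | add y z _ _ hy hz => intro r; rw [mul_add, mul_add]; exact add_mem (hy r) (hz r)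
        | smul r' z _ hz => intro r; rw [smul_eq_mul, ← mul_assoc r]; exact hz _
      simpa using h3 _ h2 1
    have h4 : e j * x * e i = (1 - ε) * (e j * x * e i) * ε := by
      have hεj' : ε * e j = 0 := by
        rw [Finset.sum_mul]
        refine Finset.sum_eq_zero fun a ha => ?_
        rw [h.e_mul_e, if_neg]
        rintro rfl
        simp only [Finset.mem_filter] at ha
        omega
      rw [mul_assoc _ (e j * x * e i), mul_assoc _ (e i), hε i le_rfl, sub_mul, mul_assoc (e j),
        ← mul_assoc ε, hεj', one_mul, zero_mul, sub_zero]
    have := memU (e j * x * e i)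
    rw [hU, ← h4] at this
    simpa using this
  rw [hle]
  -- There remains the case of distinct weights of the same level l. Then e_j x e_i is a radical
  -- element enclosed by elements of `J (l + 1)`, hence belongs to `J l`. It is zero because e_j `J
  -- l` = 0.
  refine Or.inr (lt_of_le_of_ne (not_lt.1 fun hlt => hx (mul_eq_zero_of_lt x hlt)) fun heq => hx ?_)
  have hn := (hc j).1
  have hid := c.mul_self hn.le
  have := c.twoSided (level j)
  have := c.twoSided (level j + 1)
  have mem : ∀ a, e a ∈ c.J (level a + 1) := by
    intro a
    obtain ⟨y, hy, m, hm⟩ := (hc a).exists_smul_ne_zero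
    have := c.twoSided (level a + 1)
    refine h.mem_of_apply_ne_zero hy (i := a) fun h0 => hm ?_
    rw [h.acts a, h0]
    simp
  have notMem : ∀ z ∈ c.J (level j), ∀ a, q z a ≠ 0 → level a < level j := by
    intro z hz a ha
    by_contra hlt
    have := W.simple a
    have := IsSimpleModule.nontrivial R (W.L a)
    obtain ⟨m, hm⟩ := exists_ne (0 : W.L a)
    apply ha
    rw [← (h.acts a).ker_toSpanSingleton hm]
    exact (hc a).smul_eq_zero (c.mono (not_lt.1 hlt) (hc a).1.le hz) m
  let V : Submodule k R := (Submodule.restrictScalars k (c.J (level j))).map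
    (LinearMap.mulLeft k (e j))
  -- Write an element of `J l` as a sum of products y z in `J l`. Modulo the radical z is a
  -- combination of e_a of level below that of j, and e_j y e_a = 0 for those. Hence e_j `J l` is
  -- contained in e_j `J l` rad R.
  have hV : V = ⊥ := by
    refine h.eq_bot_of_le_mul ?_
    rintro _ ⟨y, hy, rfl⟩
    have hy : y ∈ c.J (level j) := hy
    rw [← hid] at hy
    refine Submodule.mul_induction_on hy (fun y hy z hz => ?_) fun y z hy hz => ?_
    · obtain ⟨r, hr, hzr⟩ := h.exists_eq_add z
      have h1 : e j * (y * z) = (e j * y) * r := by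
        conv_lhs => rw [hzr]
        rw [← mul_assoc, mul_add, Finset.mul_sum, Finset.sum_eq_zero, zero_add]
        intro a _
        by_cases ha : q z a = 0
        · simp [ha]
        · rw [mul_smul_comm, mul_eq_zero_of_lt y (notMem z hz a ha), smul_zero]
      rw [LinearMap.mulLeft_apply, h1]
      exact Submodule.mul_mem_mul ⟨y, hy, rfl⟩ hr
    · rw [map_add]; exact add_mem hy hz
  have hmem : e j * x * e i ∈ c.J (level j) := by
    have h1 : e j * x * e i = e j * (e j * x * e i) * e i := by
      simp only [mul_assoc, h.e_mul_self]
      rw [← mul_assoc (e j) (e j), h.e_mul_self]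
    rw [h1]
    refine c.mul_jacobson_mul_mem hn (mem j) ((h.ker _).1 (IsSplit.corner_nil h.toIsSplit
      (Ne.symm hij) x)) ?_
    rw [heq]
    exact mem i
  have : e j * (e j * x * e i) ∈ V := ⟨_, hmem, rfl⟩
  rw [hV, Submodule.mem_bot, mul_assoc, ← mul_assoc, h.e_mul_self, ← mul_assoc] at this
  exact this

end Directed
end ReedyAlg

namespace ReedyAlg

variable {k : Type u} [Field k]

/-! ### Maximal semisimple subalgebras of elementary algebras -/

section Elementary

theorem IsElementary.exists_algHom {R : Type v} [Ring R] [Algebra k R] (h : IsElementary k R) :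
    ∃ (m : ℕ) (q : R →ₐ[k] (Fin m → k)), Function.Surjective q ∧
      ∀ x, q x = 0 ↔ x ∈ Ring.jacobson R := by
  obtain ⟨m, ⟨f⟩⟩ := h
  refine ⟨m, f.toAlgHom.comp (Ideal.Quotient.mkₐ k (Ring.jacobson R)),
    f.surjective.comp (Ideal.Quotient.mkₐ_surjective k _), fun x => ?_⟩
  rw [← Ideal.Quotient.eq_zero_iff_mem, AlgHom.comp_apply]
  exact f.map_eq_zero_iff

theorem IsSplit.isElementary {R : Type v} [Ring R] [Algebra k R] {m : ℕ}
    {q : R →ₐ[k] (Fin m → k)} {e : Fin m → R} (h : IsSplit q e) : IsElementary k R := by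
  refine ⟨m, ⟨(Ideal.quotientEquivAlgOfEq k ?_).trans
    (Ideal.quotientKerAlgEquivOfSurjective (surjective_of_single h.q_e))⟩⟩
  ext x
  exact (h.ker x).symm

theorem eq_zero_of_isNilpotent_ker {R S : Type*} [Ring R] [Ring S] [IsSemisimpleRing R]
    (f : R →+* S) (hf : ∀ x, f x = 0 → IsNilpotent x) : Function.Injective f := by
  rw [injective_iff_map_eq_zero]
  intro x hx
  have : x ∈ Ring.jacobson R := mem_jacobson_of_isNilpotent fun a => hf _ (by
    rw [map_mul, hx, mul_zero])
  rwa [IsSemisimpleRing.jacobson_eq_bot] at this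

/-- A subalgebra of `k ^ ι` contains the indicator functions of the blocks on which all its
elements are constant. -/
theorem exists_indicator {ι : Type*} [Fintype ι] [DecidableEq ι] (Y : Subalgebra k (ι → k))
    (a : ι) : ∃ f ∈ Y, (∀ c, (∀ y ∈ Y, y c = y a) → f c = 1) ∧
      ∀ c, (∃ y ∈ Y, y c ≠ y a) → f c = 0 := by
  classical
  -- For each c outside the block of a there is an element of Y equal to 1 at a and to 0 at c. Their
  -- product over all c is the indicator of the block.
  have h1 : ∀ c, ∃ f ∈ Y, f a = 1 ∧ ((∃ y ∈ Y, y c ≠ y a) → f c = 0) := by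
    intro c
    by_cases hc : ∃ y ∈ Y, y c ≠ y a
    · obtain ⟨y, hy, hne⟩ := hc
      refine ⟨(y a - y c)⁻¹ • (y - algebraMap k _ (y c)),
        Y.smul_mem (Y.sub_mem hy (Y.algebraMap_mem _)) _, ?_, fun _ => ?_⟩
      · have : y a - y c ≠ 0 := sub_ne_zero.2 (Ne.symm hne)
        simp [this]
      · simp
    · exact ⟨1, Y.one_mem, rfl, fun h => absurd h hc⟩
  choose f hf ha hc using h1
  refine ⟨∏ c, f c, Y.prod_mem fun c _ => hf c, fun c hcc => ?_, fun c hcc => ?_⟩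
  · rw [hcc _ (Y.prod_mem fun c _ => hf c), Finset.prod_apply]
    exact Finset.prod_eq_one fun c _ => ha c
  · rw [Finset.prod_apply]
    exact Finset.prod_eq_zero (Finset.mem_univ c) (hc c hcc)

variable {A : Type v} [Ring A] [Algebra k A] [FiniteDimensional k A]

/-- The subalgebra `S + k x`, if `x` is an idempotent that spans an ideal of it. -/
def adjoinIdempotent (S : Subalgebra k A) (x : A) (hx : x * x = x)
    (hl : ∀ s ∈ S, ∃ c : k, s * x = c • x) (hr : ∀ s ∈ S, ∃ c : k, x * s = c • x) :
    Subalgebra k A where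
  carrier := {t | ∃ s ∈ S, ∃ c : k, t = s + c • x}
  mul_mem' := by
    rintro _ _ ⟨s, hs, c, rfl⟩ ⟨s', hs', c', rfl⟩
    obtain ⟨a, ha⟩ := hl s hs
    obtain ⟨b, hb⟩ := hr s' hs'
    refine ⟨s * s', S.mul_mem hs hs', c' * a + c * b + c * c', ?_⟩
    rw [add_mul, mul_add, mul_add, mul_smul_comm, ha, smul_mul_assoc, hb, smul_mul_assoc,
      mul_smul_comm, hx]
    module
  add_mem' := by
    rintro _ _ ⟨s, hs, c, rfl⟩ ⟨s', hs', c', rfl⟩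
    exact ⟨s + s', S.add_mem hs hs', c + c', by module⟩
  algebraMap_mem' r := ⟨algebraMap k A r, S.algebraMap_mem r, 0, by simp⟩

/-- A maximal semisimple subalgebra `S` of an elementary algebra `B` is spanned by complete
orthogonal idempotents that lift the primitive idempotents of `B / rad B`. -/
theorem IsMaximalSemisimple.exists_isSplit {S B : Subalgebra k A} (hS : IsMaximalSemisimple S B)
    {ι : Type*} [Fintype ι] [DecidableEq ι] {q : B →ₐ[k] (ι → k)} (hq : Function.Surjective q)
    (hker : ∀ x, q x = 0 ↔ x ∈ Ring.jacobson B) :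
    ∃ e : ι → B, IsSplit q e ∧ (∀ i, (e i : A) ∈ S) ∧
      ∀ s : B, (s : A) ∈ S → s = ∑ i, q s i • e i := by
  have := IsArtinianRing.of_finite k B
  have nil : ∀ x, q x = 0 → IsNilpotent x := fun x hx =>
    isNilpotent_of_mem_jacobson ((hker x).1 hx)
  obtain ⟨⟨hSB, hss⟩, hmax⟩ := hS
  let qS : S →ₐ[k] (ι → k) := q.comp (Subalgebra.inclusion hSB)
  have hinj : Function.Injective qS := by
    refine eq_zero_of_isNilpotent_ker (qS : S →+* (ι → k)) fun x hx => ?_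
    obtain ⟨n, hn⟩ := nil _ hx
    exact ⟨n, Subtype.ext (by simpa using congrArg (Subtype.val) hn)⟩
  -- If S did not separate two coordinates a and b, let g be the idempotent of S that belongs to the
  -- block of a. The basis vector at a lifts to an idempotent x of B orthogonal to 1 - g. As S acts
  -- on g by scalars, S + k x is an algebra; the coordinate b shows that q is injective on it, so it
  -- is semisimple. By maximality x lies in S, although x separates a from b.
  have hsep : ∀ a b, (∀ s : S, qS s a = qS s b) → a = b := by
    intro a b hab
    by_contra hne
    obtain ⟨f', hf', hf1, hf0⟩ := exists_indicator qS.range a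
    obtain ⟨f, rfl⟩ := hf'
    have hmul : ∀ s : S, qS s * qS f = qS s a • qS f := by
      intro s
      ext c
      by_cases hc : ∃ y ∈ qS.range, y c ≠ y a
      · have h1 : qS f c = 0 := hf0 c hc
        simp [h1]
      · push Not at hc
        have h1 : qS s c = qS s a := hc _ ⟨s, rfl⟩
        simp [h1]
    have hfs : ∀ s : S, s * f = qS s a • f := fun s => hinj (by rw [map_mul, map_smul, hmul])
    have hsf : ∀ s : S, f * s = qS s a • f := fun s =>
      hinj (by rw [map_mul, map_smul, mul_comm, hmul])
    have hfa : qS f a = 1 := hf1 a fun _ _ => rfl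
    have hff : f * f = f := by rw [hfs, hfa, one_smul]
    set g : B := Subalgebra.inclusion hSB f with hg
    have hgg : g * g = g := by rw [hg, ← map_mul, hff]
    have hqg : q g a = 1 := hfa
    have hqs : (Pi.single a 1 : ι → k) * q g = Pi.single a 1 := by
      ext c
      by_cases hc : c = a
      · subst hc; simp [hqg]
      · simp [hc]
    obtain ⟨x, hx, hqx, hx1, hx2⟩ := exists_isIdempotentElem_mul_eq_zero_of_ker_isNilpotent
      (q : B →+* (ι → k)) (fun y hy => nil y hy) (Pi.single a 1) (hq _)
      (by rw [IsIdempotentElem, ← Pi.single_mul, one_mul]) (1 - g)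
      (by rw [IsIdempotentElem, mul_sub, sub_mul, sub_mul, hgg]; simp)
      (by rw [map_sub, map_one, mul_sub, mul_one]; exact sub_eq_zero.2 hqs.symm)
      (by rw [map_sub, map_one, sub_mul, one_mul, mul_comm]; exact sub_eq_zero.2 hqs.symm)
    have hxg : x * g = x := by rw [mul_sub, mul_one, sub_eq_zero] at hx1; exact hx1.symm
    have hgx : g * x = x := by rw [sub_mul, one_mul, sub_eq_zero] at hx2; exact hx2.symm
    have hl : ∀ s : S, (s : A) * x = qS s a • (x : A) := by
      intro s
      have h1 : (s : A) * (f : A) = qS s a • (f : A) := congrArg Subtype.val (hfs s)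
      have h2 : (f : A) * (x : A) = x := congrArg Subtype.val hgx
      rw [← h2, ← mul_assoc, h1, smul_mul_assoc]
    have hr : ∀ s : S, (x : A) * s = qS s a • (x : A) := by
      intro s
      have h1 : (f : A) * (s : A) = qS s a • (f : A) := congrArg Subtype.val (hsf s)
      have h2 : (x : A) * (f : A) = x := congrArg Subtype.val hxg
      rw [← h2, mul_assoc, h1, mul_smul_comm]
    let T := adjoinIdempotent S (x : A) (congrArg Subtype.val hx)
      (fun s hs => ⟨_, hl ⟨s, hs⟩⟩) (fun s hs => ⟨_, hr ⟨s, hs⟩⟩)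
    have hTB : T ≤ B := by
      rintro _ ⟨s, hs, c, rfl⟩
      exact B.add_mem (hSB hs) (B.smul_mem x.2 c)
    have hqx' : q x = Pi.single a 1 := hqx
    have hT : IsSemisimpleRing T := by
      have := IsArtinianRing.of_finite k T
      refine isSemisimpleRing_of_injective
        ((q.comp (Subalgebra.inclusion hTB) : T →ₐ[k] (ι → k)) : T →+* (ι → k)) ?_
      rw [injective_iff_map_eq_zero]
      rintro ⟨_, s, hs, c, rfl⟩ h0
      have h0 : q ⟨s + c • (x : A), _⟩ = 0 := h0
      have h1 : (⟨s + c • (x : A), B.add_mem (hSB hs) (B.smul_mem x.2 c)⟩ : B) =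
        Subalgebra.inclusion hSB ⟨s, hs⟩ + c • x := rfl
      rw [h1, map_add, map_smul, hqx'] at h0
      have h2 := congrFun h0 a
      have h3 := congrFun h0 b
      have h4 : qS ⟨s, hs⟩ a = qS ⟨s, hs⟩ b := hab _
      have h5 : q (Subalgebra.inclusion hSB ⟨s, hs⟩) = qS ⟨s, hs⟩ := rfl
      rw [h5] at h0 h2 h3
      simp only [Pi.add_apply, Pi.smul_apply, Pi.single_eq_same, Pi.zero_apply, smul_eq_mul,
        mul_one, Pi.single_eq_of_ne (Ne.symm hne), mul_zero, add_zero] at h2 h3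
      rw [h4, h3, zero_add] at h2
      subst h2
      rw [zero_smul, add_zero] at h0
      have h6 := hinj (h0.trans (map_zero qS).symm)
      have h7 : s = 0 := congrArg Subtype.val h6
      exact Subtype.ext (by simp [h7])
    have hST : S ≤ T := fun s hs => ⟨s, hs, 0, by simp⟩
    have hxS : (x : A) ∈ S := hmax ⟨hTB, hT⟩ hST ⟨0, S.zero_mem, 1, by simp⟩
    have h1 := hab ⟨x, hxS⟩
    have h2 : qS ⟨x, hxS⟩ = Pi.single a 1 := hqx
    rw [h2, Pi.single_eq_same, Pi.single_eq_of_ne (Ne.symm hne)] at h1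
    exact one_ne_zero h1
  have hex : ∀ a, ∃ s : S, qS s = Pi.single a 1 := by
    intro a
    obtain ⟨f', ⟨f, rfl⟩, hf1, hf0⟩ := exists_indicator qS.range a
    refine ⟨f, ?_⟩
    ext c
    by_cases hc : c = a
    · subst hc; simpa using hf1 c fun _ _ => rfl
    · rw [Pi.single_eq_of_ne hc]
      refine hf0 c ?_
      by_contra! hcon
      exact hc (hsep c a fun s => hcon _ ⟨s, rfl⟩)
  choose s hs using hex
  have hcomp : CompleteOrthogonalIdempotents s := by
    refine ⟨⟨fun i => hinj ?_, fun i j hij => hinj ?_⟩, hinj ?_⟩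
    · rw [map_mul, hs, ← Pi.single_mul, one_mul]
    · simp only [map_mul, hs, map_zero]
      ext c
      by_cases hc : c = i
      · subst hc; simp [hij]
      · simp [hc]
    · rw [map_sum, map_one]
      simp only [hs]
      exact Finset.univ_sum_single (1 : ι → k)
  have hsplit : IsSplit q fun i => Subalgebra.inclusion hSB (s i) :=
    ⟨hcomp.map (Subalgebra.inclusion hSB : S →+* B), hs, hker⟩
  refine ⟨_, hsplit, fun i => (s i).2, fun x hx => ?_⟩
  have h1 : (⟨x, hx⟩ : S) = ∑ i, q x i • s i := by
    refine hinj ?_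
    have h2 := hsplit.q_sub x
    rw [map_sub, sub_eq_zero] at h2
    refine Eq.trans h2 ?_
    rw [map_sum, map_sum]
    simp only [map_smul]
    rfl
  refine Subtype.ext ?_
  have h3 := congrArg (Subalgebra.inclusion hSB) h1
  rw [map_sum] at h3
  simp only [map_smul] at h3
  exact congrArg Subtype.val h3

/-- The converse: the span of lifted idempotents is a maximal semisimple subalgebra. -/
theorem IsSplit.isMaximalSemisimple {S B : Subalgebra k A} {ι : Type*} [Fintype ι]
    [DecidableEq ι] {q : B →ₐ[k] (ι → k)} {e : ι → B} (h : IsSplit q e) (hSB : S ≤ B)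
    (he : ∀ i, (e i : A) ∈ S) (hspan : ∀ s : B, (s : A) ∈ S → s = ∑ i, q s i • e i) :
    IsMaximalSemisimple S B := by
  have := IsArtinianRing.of_finite k B
  have := IsArtinianRing.of_finite k S
  refine ⟨⟨hSB, ?_⟩, ?_⟩
  · refine isSemisimpleRing_of_injective
      ((q.comp (Subalgebra.inclusion hSB) : S →ₐ[k] (ι → k)) : S →+* (ι → k)) ?_
    rw [injective_iff_map_eq_zero]
    intro s hs
    have hs : q (Subalgebra.inclusion hSB s) = 0 := hs
    have := hspan (Subalgebra.inclusion hSB s) s.2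
    rw [hs] at this
    refine Subtype.ext ?_
    simpa using congrArg Subtype.val this
  · rintro T ⟨hTB, hT⟩ hST t ht
    have hinj : Function.Injective ((q.comp (Subalgebra.inclusion hTB) : T →ₐ[k] (ι → k)) :
        T →+* (ι → k)) := by
      refine eq_zero_of_isNilpotent_ker _ fun x hx => ?_
      obtain ⟨n, hn⟩ := isNilpotent_of_mem_jacobson ((h.ker _).1 hx)
      exact ⟨n, Subtype.ext (by simpa using congrArg (Subtype.val) hn)⟩
    -- Both t and z belong to T and have the same image under q. Since T is semisimple, q is
    -- injective on it, so t = z.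
    set z : B := ∑ i, q ⟨t, hTB ht⟩ i • e i with hz
    have hzS : (z : A) ∈ S := by
      rw [hz]
      simp only [AddSubmonoidClass.coe_finsetSum, Subalgebra.coe_smul]
      exact S.sum_mem fun i _ => S.smul_mem (he i) _
    have h1 := h.q_sub ⟨t, hTB ht⟩
    rw [map_sub, sub_eq_zero, ← hz] at h1
    have h2 : (⟨t, ht⟩ : T) = ⟨z, hST hzS⟩ := hinj h1
    have h3 : t = z := congrArg Subtype.val h2
    rw [h3]
    exact hzS

end Elementary
end ReedyAlg

namespace ReedyAlg

variable {k : Type u} [Field k]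

/-! ### Dimensions and homomorphisms from complete orthogonal idempotents -/

section Peirce

variable {R : Type*} [Ring R] [Algebra k R] {ι : Type*} [Fintype ι]

theorem finrank_eq_sum_mulLeft [FiniteDimensional k R] {f : ι → R}
    (hf : CompleteOrthogonalIdempotents f) :
    Module.finrank k R = ∑ i, Module.finrank k (LinearMap.range (LinearMap.mulLeft k (f i))) := by
  classical
  rw [← Module.finrank_pi_fintype]
  refine LinearEquiv.finrank_eq (LinearEquiv.ofBijective
    (LinearMap.pi fun i => (LinearMap.mulLeft k (f i)).rangeRestrict) ⟨?_, ?_⟩)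
  · rw [injective_iff_map_eq_zero]
    intro x hx
    rw [← one_mul x, ← hf.complete, Finset.sum_mul]
    exact Finset.sum_eq_zero fun i _ => congrArg Subtype.val (congrFun hx i)
  · intro y
    refine ⟨∑ i, (y i : R), ?_⟩
    ext i
    change f i * ∑ j, (y j : R) = y i
    rw [Finset.mul_sum, Finset.sum_eq_single i]
    · obtain ⟨z, hz⟩ := (y i).2
      rw [← hz, LinearMap.mulLeft_apply, ← mul_assoc, hf.idem i]
    · intro j _ hj
      obtain ⟨z, hz⟩ := (y j).2
      rw [← hz, LinearMap.mulLeft_apply, ← mul_assoc, hf.ortho (Ne.symm hj), zero_mul]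
    · simp

theorem finrank_range_mulRight_op (a : R) :
    Module.finrank k (LinearMap.range (LinearMap.mulRight k (MulOpposite.op a))) =
      Module.finrank k (LinearMap.range (LinearMap.mulLeft k a)) := by
  rw [← LinearEquiv.finrank_map_eq (MulOpposite.opLinearEquiv k : R ≃ₗ[k] Rᵐᵒᵖ)
    (LinearMap.range (LinearMap.mulLeft k a))]
  suffices hs : LinearMap.range (LinearMap.mulRight k (MulOpposite.op a)) =
      (LinearMap.range (LinearMap.mulLeft k a)).map
        (MulOpposite.opLinearEquiv k : R ≃ₗ[k] Rᵐᵒᵖ).toLinearMap by rw [hs]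
  ext x
  constructor
  · rintro ⟨y, rfl⟩
    exact ⟨a * y.unop, ⟨y.unop, rfl⟩, rfl⟩
  · rintro ⟨_, ⟨y, rfl⟩, rfl⟩
    exact ⟨MulOpposite.op y, rfl⟩

theorem finrank_range_mulLeft_op (a : R) :
    Module.finrank k (LinearMap.range (LinearMap.mulLeft k (MulOpposite.op a))) =
      Module.finrank k (LinearMap.range (LinearMap.mulRight k a)) := by
  rw [← LinearEquiv.finrank_map_eq (MulOpposite.opLinearEquiv k : R ≃ₗ[k] Rᵐᵒᵖ)
    (LinearMap.range (LinearMap.mulRight k a))]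
  suffices hs : LinearMap.range (LinearMap.mulLeft k (MulOpposite.op a)) =
      (LinearMap.range (LinearMap.mulRight k a)).map
        (MulOpposite.opLinearEquiv k : R ≃ₗ[k] Rᵐᵒᵖ).toLinearMap by rw [hs]
  ext x
  constructor
  · rintro ⟨y, rfl⟩
    exact ⟨y.unop * a, ⟨y.unop, rfl⟩, rfl⟩
  · rintro ⟨_, ⟨y, rfl⟩, rfl⟩
    exact ⟨MulOpposite.op y, rfl⟩

theorem CompleteOrthogonalIdempotents.op' {f : ι → R} (hf : CompleteOrthogonalIdempotents f) :
    CompleteOrthogonalIdempotents (MulOpposite.op ∘ f) := by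
  refine ⟨⟨fun i => ?_, fun i j hij => ?_⟩, ?_⟩
  · exact congrArg MulOpposite.op (hf.idem i)
  · exact congrArg MulOpposite.op (hf.ortho hij.symm)
  · simpa using congrArg MulOpposite.op hf.complete

theorem finrank_eq_sum_mulRight [FiniteDimensional k R] {f : ι → R}
    (hf : CompleteOrthogonalIdempotents f) :
    Module.finrank k R =
      ∑ i, Module.finrank k (LinearMap.range (LinearMap.mulRight k (f i))) := by
  rw [(MulOpposite.opLinearEquiv k : R ≃ₗ[k] Rᵐᵒᵖ).finrank_eq,
    finrank_eq_sum_mulLeft (CompleteOrthogonalIdempotents.op' hf)]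
  exact Finset.sum_congr rfl fun i _ => finrank_range_mulLeft_op _

/-- The homomorphism `k ^ ι → R` given by complete orthogonal idempotents. -/
def idempotentHom [DecidableEq ι] {f : ι → R} (hf : CompleteOrthogonalIdempotents f) :
    (ι → k) →ₐ[k] R :=
  AlgHom.ofLinearMap (∑ i, (LinearMap.proj i : (ι → k) →ₗ[k] k).smulRight (f i))
    (by simpa using hf.complete)
    (by
      intro x y
      simp only [LinearMap.sum_apply, LinearMap.smulRight_apply, LinearMap.proj_apply,
        Pi.mul_apply, Finset.sum_mul_sum, smul_mul_smul_comm, hf.mul_eq, smul_ite, smul_zero,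
        Finset.sum_ite_eq, Finset.mem_univ, if_true])

theorem idempotentHom_apply [DecidableEq ι] {f : ι → R} (hf : CompleteOrthogonalIdempotents f)
    (x : ι → k) : idempotentHom hf x = ∑ i, x i • f i := by
  simp [idempotentHom]

theorem idempotentHom_single [DecidableEq ι] {f : ι → R}
    (hf : CompleteOrthogonalIdempotents f) (i : ι) :
    idempotentHom (k := k) hf (Pi.single i 1) = f i := by
  simp [idempotentHom_apply, Pi.single_apply]

theorem idempotentHom_injective [DecidableEq ι] {f : ι → R}
    (hf : CompleteOrthogonalIdempotents f) (hne : ∀ i, f i ≠ 0) :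
    Function.Injective (idempotentHom (k := k) hf) := by
  rw [injective_iff_map_eq_zero]
  intro x hx
  ext i
  have h1 := congrArg (f i * ·) hx
  simp only [idempotentHom_apply, Finset.mul_sum, mul_smul_comm, hf.mul_eq, smul_ite, smul_zero,
    Finset.sum_ite_eq, Finset.mem_univ, if_true, mul_zero] at h1
  exact (smul_eq_zero.1 h1).resolve_right (hne i)

end Peirce

/-- A triangular decomposition of `R`: the subalgebra `C` raises and the subalgebra `B` lowers the
degree, and `R` is the direct sum of the `C g l ⊗ f l B`. -/
structure IsTriangular {R B C : Type*} [Ring R] [Ring B] [Ring C] [Algebra k R] [Algebra k B]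
    [Algebra k C] (β : B →ₐ[k] R) (γ : C →ₐ[k] R) {ι : Type*} [Fintype ι]
    (e : ι → R) (f : ι → B) (g : ι → C) (deg : ι → ℕ) : Prop where
  complete : CompleteOrthogonalIdempotents e
  map_f : ∀ i, β (f i) = e i
  map_g : ∀ i, γ (g i) = e i
  inj_β : Function.Injective β
  inj_γ : Function.Injective γ
  ne_zero : ∀ i, e i ≠ 0
  diag_B : ∀ i b, ∃ a : k, f i * b * f i = a • f i
  dir_B : ∀ i j b, i ≠ j → f j * b * f i ≠ 0 → deg j < deg i
  diag_C : ∀ i c, ∃ a : k, g i * c * g i = a • g i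
  dir_C : ∀ i j c, i ≠ j → g j * c * g i ≠ 0 → deg i < deg j
  span : ∀ r, r ∈ Submodule.span k {x | ∃ c b, x = γ c * β b}
  dim : Module.finrank k R = ∑ l, Module.finrank k (LinearMap.range (LinearMap.mulRight k (g l))) *
    Module.finrank k (LinearMap.range (LinearMap.mulLeft k (f l)))

/-! ### Triangular decompositions and their dual bases -/

section Triangular

variable {R B C : Type*} [Ring R] [Ring B] [Ring C] [Algebra k R] [Algebra k B]
    [Algebra k C] {β : B →ₐ[k] R} {γ : C →ₐ[k] R} {ι : Type} [Fintype ι]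
    {e : ι → R} {f : ι → B} {g : ι → C} {deg : ι → ℕ}

/-- Reversing the multiplication exchanges raising and lowering, so B and C trade places while the
degree function stays. Statements about right modules and about C are obtained in this way from
those about left modules and B. -/
theorem IsTriangular.op (h : IsTriangular β γ e f g deg) :
    IsTriangular (AlgHom.op γ) (AlgHom.op β) (MulOpposite.op ∘ e) (MulOpposite.op ∘ g)
      (MulOpposite.op ∘ f) deg where
  complete := CompleteOrthogonalIdempotents.op' h.complete
  map_f i := congrArg MulOpposite.op (h.map_g i)
  map_g i := congrArg MulOpposite.op (h.map_f i)
  inj_β x y hxy := MulOpposite.unop_injective (h.inj_γ (MulOpposite.op_injective hxy))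
  inj_γ x y hxy := MulOpposite.unop_injective (h.inj_β (MulOpposite.op_injective hxy))
  ne_zero i := by simpa using h.ne_zero i
  diag_B i b := by
    obtain ⟨a, ha⟩ := h.diag_C i b.unop
    exact ⟨a, MulOpposite.unop_injective (by simpa [mul_assoc] using ha)⟩
  dir_B i j b hij hb := h.dir_C j i b.unop hij.symm fun h0 => hb
    (MulOpposite.unop_injective (by simpa [mul_assoc] using h0))
  diag_C i b := by
    obtain ⟨a, ha⟩ := h.diag_B i b.unop
    exact ⟨a, MulOpposite.unop_injective (by simpa [mul_assoc] using ha)⟩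
  dir_C i j b hij hb := h.dir_B j i b.unop hij.symm fun h0 => hb
    (MulOpposite.unop_injective (by simpa [mul_assoc] using h0))
  span r := by
    have : ∀ s ∈ Submodule.span k {x | ∃ c b, x = γ c * β b}, MulOpposite.op s ∈
        Submodule.span k {x | ∃ c b, x = (AlgHom.op β) c * (AlgHom.op γ) b} := by
      intro s hs
      induction hs using Submodule.span_induction with
      | mem s hs =>
        obtain ⟨c, b, rfl⟩ := hs
        exact Submodule.subset_span ⟨MulOpposite.op b, MulOpposite.op c, rfl⟩
      | zero => exact zero_mem _
      | add x y _ _ hx hy => exact add_mem hx hy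
      | smul a x _ hx => exact Submodule.smul_mem _ a hx
    exact this _ (h.span r.unop)
  dim := by
    rw [← (MulOpposite.opLinearEquiv k : R ≃ₗ[k] Rᵐᵒᵖ).finrank_eq, h.dim]
    refine Finset.sum_congr rfl fun l _ => ?_
    rw [Function.comp_apply, Function.comp_apply, finrank_range_mulRight_op,
      finrank_range_mulLeft_op, mul_comm]

theorem IsTriangular.complete_f (h : IsTriangular β γ e f g deg) :
    CompleteOrthogonalIdempotents f := by
  refine ⟨⟨fun i => h.inj_β ?_, fun i j hij => h.inj_β ?_⟩, h.inj_β ?_⟩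
  · rw [map_mul, h.map_f, h.complete.idem i]
  · rw [map_mul, h.map_f, h.map_f, h.complete.ortho hij, map_zero]
  · simp [h.map_f, h.complete.complete]

theorem IsTriangular.complete_g (h : IsTriangular β γ e f g deg) :
    CompleteOrthogonalIdempotents g := by
  refine ⟨⟨fun i => h.inj_γ ?_, fun i j hij => h.inj_γ ?_⟩, h.inj_γ ?_⟩
  · rw [map_mul, h.map_g, h.complete.idem i]
  · rw [map_mul, h.map_g, h.map_g, h.complete.ortho hij, map_zero]
  · simp [h.map_g, h.complete.complete]

theorem IsTriangular.f_ne_zero (h : IsTriangular β γ e f g deg) (i : ι) : f i ≠ 0 := fun h0 =>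
  h.ne_zero i (by rw [← h.map_f, h0, map_zero])

theorem IsTriangular.g_ne_zero (h : IsTriangular β γ e f g deg) (i : ι) : g i ≠ 0 := fun h0 =>
  h.ne_zero i (by rw [← h.map_g, h0, map_zero])

omit [Fintype ι] in
theorem finrank_range_mulLeft_single [DecidableEq ι] (l : ι) : Module.finrank k
    (LinearMap.range (LinearMap.mulLeft k (Pi.single l 1 : ι → k))) = 1 := by
  have : LinearMap.range (LinearMap.mulLeft k (Pi.single l 1 : ι → k)) =
      Submodule.span k {(Pi.single l 1 : ι → k)} := by
    ext x
    rw [Submodule.mem_span_singleton]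
    constructor
    · rintro ⟨y, rfl⟩
      refine ⟨y l, ?_⟩
      ext a
      by_cases ha : a = l
      · subst ha; simp
      · simp [ha]
    · rintro ⟨a, rfl⟩
      exact ⟨a • 1, by simp⟩
  rw [this, finrank_span_singleton (by simp)]

omit [Fintype ι] in
theorem finrank_range_mulRight_single [DecidableEq ι] (l : ι) : Module.finrank k
    (LinearMap.range (LinearMap.mulRight k (Pi.single l 1 : ι → k))) = 1 := by
  rw [← finrank_range_mulLeft_single (k := k) l]
  have : LinearMap.mulRight k (Pi.single l 1 : ι → k) = LinearMap.mulLeft k (Pi.single l 1) :=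
    LinearMap.ext fun x => mul_comm _ _
  rw [this]

omit [Fintype ι] in
theorem single_mul_mul_single [DecidableEq ι] (i j : ι) (x : ι → k) :
    (Pi.single j 1 : ι → k) * x * Pi.single i 1 = if i = j then x i • Pi.single i 1 else 0 := by
  ext a
  split_ifs with hij
  · subst hij
    by_cases ha : a = i
    · subst ha; simp
    · simp [ha]
  · by_cases ha : a = i
    · subst ha; simp [hij]
    · simp [ha]

/-- The triangular decomposition of the lowering subalgebra. -/
theorem IsTriangular.left [DecidableEq ι] [FiniteDimensional k B]
    (h : IsTriangular β γ e f g deg) :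
    IsTriangular (AlgHom.id k B) (idempotentHom (k := k) h.complete_f) f f
      (fun i => Pi.single i 1) deg where
  complete := h.complete_f
  map_f i := rfl
  map_g i := idempotentHom_single _ i
  inj_β _ _ h := h
  inj_γ := idempotentHom_injective _ h.f_ne_zero
  ne_zero := h.f_ne_zero
  diag_B := h.diag_B
  dir_B := h.dir_B
  diag_C i c := ⟨c i, by rw [single_mul_mul_single, if_pos rfl]⟩
  dir_C i j c hij hc := absurd (by rw [single_mul_mul_single, if_neg hij]) hc
  span r := Submodule.subset_span ⟨1, r, by simp⟩
  dim := by
    simp_rw [finrank_range_mulRight_single, one_mul]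
    exact finrank_eq_sum_mulLeft h.complete_f

/-- The triangular decomposition of the raising subalgebra. -/
theorem IsTriangular.right [DecidableEq ι] [FiniteDimensional k C]
    (h : IsTriangular β γ e f g deg) :
    IsTriangular (idempotentHom (k := k) h.complete_g) (AlgHom.id k C) g
      (fun i => Pi.single i 1) g deg where
  complete := h.complete_g
  map_g i := rfl
  map_f i := idempotentHom_single _ i
  inj_γ _ _ h := h
  inj_β := idempotentHom_injective _ h.g_ne_zero
  ne_zero := h.g_ne_zero
  diag_C := h.diag_C
  dir_C := h.dir_C
  diag_B i c := ⟨c i, by rw [single_mul_mul_single, if_pos rfl]⟩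
  dir_B i j c hij hc := absurd (by rw [single_mul_mul_single, if_neg hij]) hc
  span r := Submodule.subset_span ⟨r, 1, by simp⟩
  dim := by
    simp_rw [finrank_range_mulLeft_single, mul_one]
    exact finrank_eq_sum_mulRight h.complete_g

/-- The elements `c x` and the functionals `y x` form a dual basis of the projective right
`B`-module `R`; the element `c x` generates a copy of `f (p x) B`. -/
structure IsDualBasis (β : B →ₐ[k] R) (γ : C →ₐ[k] R) (f : ι → B) (g : ι → C) {X : Type}
    [Fintype X] [DecidableEq X] (p : X → ι) (c : X → C) (y : X → R →ₗ[k] B) : Prop where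
  c_mul : ∀ x, c x * g (p x) = c x
  mul_y : ∀ x r, f (p x) * y x r = y x r
  sum : ∀ r, r = ∑ x, γ (c x) * β (y x r)
  y_mul : ∀ x r b, y x (r * β b) = y x r * b
  y_c : ∀ x x' b, f (p x') * b = b → y x (γ (c x') * β b) = if x = x' then b else 0
  span : ∀ z i, z * g i = z → ∃ a : X → k, (∀ x, p x ≠ i → a x = 0) ∧ z = ∑ x, a x • c x

/-- The elements c x run through bases of the spaces C g_l. The resulting map from the sum of the
f_l B to R is onto by `span` and then injective by `dim`; the y x are the coordinates of its
inverse. -/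
theorem IsTriangular.exists_isDualBasis [DecidableEq ι] [FiniteDimensional k R]
    [FiniteDimensional k B] [FiniteDimensional k C] (h : IsTriangular β γ e f g deg) :
    ∃ (X : Type) (_ : Fintype X) (_ : DecidableEq X) (p : X → ι) (c : X → C)
      (y : X → R →ₗ[k] B), IsDualBasis β γ f g p c y := by
  let V : ι → Submodule k C := fun i => LinearMap.range (LinearMap.mulRight k (g i))
  let U : ι → Submodule k B := fun i => LinearMap.range (LinearMap.mulLeft k (f i))
  let bas : ∀ i, Module.Basis (Fin (Module.finrank k (V i))) k (V i) := fun i =>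
    Module.finBasis k (V i)
  have hV : ∀ i (c : V i), (c : C) * g i = c := by
    rintro i ⟨_, c, rfl⟩
    simp [mul_assoc, (h.complete_g.idem i).eq]
  have hU : ∀ i (b : U i), f i * (b : B) = b := by
    rintro i ⟨_, b, rfl⟩
    simp [← mul_assoc, (h.complete_f.idem i).eq]
  let X : Type := Σ i, Fin (Module.finrank k (V i))
  let c : X → C := fun x => (bas x.1 x.2 : C)
  have hc : ∀ x, c x * g x.1 = c x := fun x => hV _ _
  have hspan : ∀ z i, z * g i = z →
      ∃ a : X → k, (∀ x, x.1 ≠ i → a x = 0) ∧ z = ∑ x, a x • c x := by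
    intro z i hz
    let z' : V i := ⟨z, z, hz⟩
    refine ⟨fun x => if hx : x.1 = i then (bas x.1).repr ⟨z, z, by subst hx; exact hz⟩ x.2 else 0,
      fun x hx => dif_neg hx, ?_⟩
    rw [Fintype.sum_sigma, Finset.sum_eq_single i]
    · have h1 := congrArg Subtype.val ((bas i).sum_repr z')
      rw [AddSubmonoidClass.coe_finsetSum] at h1
      simp only [dif_pos]
      exact h1.symm
    · intro j _ hj
      refine Finset.sum_eq_zero fun t _ => ?_
      simp only [dif_neg hj, zero_smul]
    · simp
  let Θ : (∀ x : X, U x.1) →ₗ[k] R := ∑ x : X, LinearMap.mulLeft k (γ (c x)) ∘ₗ β.toLinearMap ∘ₗ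
    (U x.1).subtype ∘ₗ LinearMap.proj x
  have hΘ : ∀ v, Θ v = ∑ x, γ (c x) * β (v x) := fun v => by simp [Θ]
  have hsurj : Function.Surjective Θ := by
    rw [← LinearMap.range_eq_top, eq_top_iff]
    intro r _
    refine Submodule.span_le.2 ?_ (h.span r)
    rintro _ ⟨z, b, rfl⟩
    have h1 : γ z * β b = ∑ i, γ (z * g i) * β (f i * b) := by
      calc γ z * β b = γ z * (∑ i, e i) * β b := by rw [h.complete.complete, mul_one]
        _ = _ := by
          rw [Finset.mul_sum, Finset.sum_mul]
          refine Finset.sum_congr rfl fun i _ => ?_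
          rw [map_mul, map_mul, h.map_g, h.map_f, mul_assoc, mul_assoc, ← mul_assoc (e i) (e i),
            (h.complete.idem i).eq]
    rw [h1]
    refine sum_mem fun i _ => ?_
    obtain ⟨a, ha, hz⟩ := hspan (z * g i) i (by rw [mul_assoc, (h.complete_g.idem i).eq])
    refine ⟨fun x => if hx : x.1 = i then a x • ⟨f i * b, by subst hx; exact ⟨b, rfl⟩⟩ else 0, ?_⟩
    rw [hΘ, hz, map_sum, Finset.sum_mul]
    refine Finset.sum_congr rfl fun x _ => ?_
    by_cases hx : x.1 = i
    · simp [hx]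
    · simp [hx, ha x hx]
  have hdim : Module.finrank k (∀ x : X, U x.1) = Module.finrank k R := by
    rw [Module.finrank_pi_fintype, h.dim, Fintype.sum_sigma]
    refine Finset.sum_congr rfl fun i _ => ?_
    change ∑ _x : Fin (Module.finrank k (V i)), Module.finrank k (U i) = _
    rw [Finset.sum_const, Finset.card_univ, Fintype.card_fin, smul_eq_mul]
  have hinj : Function.Injective Θ := (LinearMap.injective_iff_surjective_of_finrank_eq_finrank
    hdim).2 hsurj
  let E := LinearEquiv.ofBijective Θ ⟨hinj, hsurj⟩
  have hE : ∀ r, r = ∑ x, γ (c x) * β (E.symm r x) := fun r => by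
    rw [← hΘ]; exact (E.apply_symm_apply r).symm
  have huniq : ∀ r (v : ∀ x : X, U x.1), r = ∑ x, γ (c x) * β (v x) → E.symm r = v := by
    intro r v hr
    rw [LinearEquiv.symm_apply_eq, hr, ← hΘ]; rfl
  let y : X → R →ₗ[k] B := fun x => (U x.1).subtype ∘ₗ
    (LinearMap.proj x : (∀ x : X, U x.1) →ₗ[k] U x.1) ∘ₗ E.symm.toLinearMap
  refine ⟨X, inferInstance, inferInstance, Sigma.fst, c, y, hc,
    fun x r => hU _ _, hE, fun x r b => ?_, fun x x' b hb => ?_, hspan⟩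
  · have h1 := huniq (r * β b) (fun x => ⟨(E.symm r x : B) * b, (E.symm r x : B) * b, by
      rw [LinearMap.mulLeft_apply, ← mul_assoc, hU]⟩) (by
      conv_lhs => rw [hE r, Finset.sum_mul]
      simp [mul_assoc])
    change ((E.symm (r * β b) x : U x.1) : B) = (E.symm r x : B) * b
    rw [h1]
  · have h1 := huniq (γ (c x') * β b) (Pi.single x' ⟨b, b, hb⟩) (by
      rw [Finset.sum_eq_single x']
      · simp
      · intro z _ hz
        simp [hz]
      · simp)
    change ((E.symm (γ (c x') * β b) x : U x.1) : B) = _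
    rw [h1]
    by_cases hx : x = x'
    · subst hx; simp
    · simp [hx]

end Triangular
end ReedyAlg

namespace ReedyAlg

variable {k : Type u} [Field k]

/-! ### The ideals generated by idempotents of small degree -/

section IdealLT

variable {R : Type*} [Ring R] {ι : Type*} {e : ι → R} {deg : ι → ℕ}

/-- The two-sided ideal generated by the idempotents of degree less than `l`. -/
def idealLT (e : ι → R) (deg : ι → ℕ) (l : ℕ) : Ideal R :=
  Ideal.span {z | ∃ i s, deg i < l ∧ z = e i * s}

theorem mul_mem_idealLT {l : ℕ} {i : ι} (hi : deg i < l) (s : R) : e i * s ∈ idealLT e deg l :=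
  Ideal.subset_span ⟨i, s, hi, rfl⟩

theorem mem_idealLT {l : ℕ} {i : ι} (hi : deg i < l) : e i ∈ idealLT e deg l := by
  simpa using mul_mem_idealLT (e := e) hi 1

instance idealLT_isTwoSided (l : ℕ) : (idealLT e deg l).IsTwoSided := by
  constructor
  intro a b ha
  induction ha using Submodule.span_induction with
  | mem z hz =>
    obtain ⟨i, s, hi, rfl⟩ := hz
    rw [mul_assoc]
    exact mul_mem_idealLT hi _
  | zero => simp
  | add x y _ _ hx hy => rw [add_mul]; exact add_mem hx hy
  | smul r x _ hx => rw [smul_eq_mul, mul_assoc]; exact Ideal.mul_mem_left _ r hx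

theorem idealLT_mono {l l' : ℕ} (hl : l ≤ l') : idealLT e deg l ≤ idealLT e deg l' :=
  Ideal.span_mono fun _ ⟨i, s, hi, hz⟩ => ⟨i, s, hi.trans_le hl, hz⟩

theorem idealLT_zero : idealLT e deg 0 = ⊥ := by
  rw [idealLT, Ideal.span_eq_bot]
  rintro _ ⟨i, s, hi, -⟩
  exact absurd hi (Nat.not_lt_zero _)

theorem idealLT_eq_top [Fintype ι] (he : CompleteOrthogonalIdempotents e) {l : ℕ}
    (hl : ∀ i, deg i < l) : idealLT e deg l = ⊤ := by
  rw [Ideal.eq_top_iff_one, ← he.complete]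
  exact sum_mem fun i _ => mem_idealLT (hl i)

theorem idealLT_mul_self (he : OrthogonalIdempotents e) (l : ℕ) :
    idealLT e deg l * idealLT e deg l = idealLT e deg l := by
  refine le_antisymm Ideal.mul_le_left (Ideal.span_le.2 ?_)
  rintro _ ⟨i, s, hi, rfl⟩
  rw [← (he.idem i).eq, mul_assoc]
  exact Ideal.mul_mem_mul (mem_idealLT hi) (mul_mem_idealLT hi s)

theorem op_mem_idealLT {l : ℕ} {r : R} (hr : r ∈ idealLT e deg l) :
    MulOpposite.op r ∈ idealLT (MulOpposite.op ∘ e) deg l := by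
  induction hr using Submodule.span_induction with
  | mem z hz =>
    obtain ⟨i, s, hi, rfl⟩ := hz
    rw [MulOpposite.op_mul]
    exact Ideal.mul_mem_left _ _ (mem_idealLT (e := MulOpposite.op ∘ e) hi)
  | zero => simp
  | add x y _ _ hx hy => rw [MulOpposite.op_add]; exact add_mem hx hy
  | smul r x _ hx => rw [smul_eq_mul, MulOpposite.op_mul]; exact Ideal.mul_mem_right _ _ hx

theorem unop_mem_idealLT {l : ℕ} {r : Rᵐᵒᵖ} (hr : r ∈ idealLT (MulOpposite.op ∘ e) deg l) :
    r.unop ∈ idealLT e deg l := by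
  induction hr using Submodule.span_induction with
  | mem z hz =>
    obtain ⟨i, s, hi, rfl⟩ := hz
    rw [MulOpposite.unop_mul]
    exact Ideal.mul_mem_left _ _ (mem_idealLT hi)
  | zero => simp
  | add x y _ _ hx hy => rw [MulOpposite.unop_add]; exact add_mem hx hy
  | smul r x _ hx => rw [smul_eq_mul, MulOpposite.unop_mul]; exact Ideal.mul_mem_right _ _ hx

end IdealLT

/-! ### Coordinates modulo lower degrees -/

section Triangular

variable {R B C : Type*} [Ring R] [Ring B] [Ring C] [Algebra k R] [Algebra k B]
    [Algebra k C] {β : B →ₐ[k] R} {γ : C →ₐ[k] R} {ι : Type} [Fintype ι]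
    {e : ι → R} {f : ι → B} {g : ι → C} {deg : ι → ℕ}

section DualBasis

variable {X : Type} [Fintype X] [DecidableEq X] {p : X → ι} {c : X → C} {y : X → R →ₗ[k] B}

/-- The value lies in f_{p x} B f_i, which could be nonzero for i ≠ p x only if the degree of p x
were less than that of i. -/
theorem IsDualBasis.y_mul_e (h : IsTriangular β γ e f g deg) (D : IsDualBasis β γ f g p c y)
    {x : X} {i : ι} (r : R) (hlt : deg i ≤ deg (p x)) (hne : i ≠ p x) : y x (r * e i) = 0 := by
  rw [← h.map_f, D.y_mul, ← D.mul_y]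
  by_contra h0
  exact absurd (h.dir_B i (p x) _ hne h0) (not_lt.2 hlt)

/-- An element r e_i γ(z) β(b) with deg i < l is a sum over j of terms in R e_j β(b), and only j
with deg j ≤ deg i contribute because C raises the degree. On these terms the coordinate vanishes by
`y_mul_e`. -/
theorem IsDualBasis.y_eq_zero (h : IsTriangular β γ e f g deg) (D : IsDualBasis β γ f g p c y)
    {l : ℕ} {r : R} (hr : r ∈ idealLT e deg l) (x : X) (hx : l ≤ deg (p x)) : y x r = 0 := by
  have key : ∀ (i : ι) (r : R), deg i < l → ∀ s, y x (r * e i * s) = 0 := by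
    intro i r hi s
    have hs := h.span s
    induction hs using Submodule.span_induction with
    | mem s hs =>
      obtain ⟨z, b, rfl⟩ := hs
      have h1 : r * e i * (γ z * β b) = ∑ j, (r * (e i * γ z * e j)) * β b := by
        rw [← Finset.sum_mul, ← Finset.mul_sum, ← Finset.mul_sum, h.complete.complete, mul_one]
        simp only [mul_assoc]
      rw [h1, map_sum]
      refine Finset.sum_eq_zero fun j _ => ?_
      rw [D.y_mul]
      by_cases h0 : g i * z * g j = 0
      · have h2 : e i * γ z * e j = 0 := by
          rw [← h.map_g, ← h.map_g, ← map_mul, ← map_mul, h0, map_zero]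
        rw [h2, mul_zero, map_zero, zero_mul]
      · have hj : deg j ≤ deg i := by
          by_cases hji : j = i
          · rw [hji]
          · exact (h.dir_C j i z hji h0).le
        rw [← mul_assoc, D.y_mul_e h, zero_mul]
        · omega
        · rintro rfl
          omega
    | zero => simp
    | add s t _ _ hs ht => rw [mul_add, map_add, hs, ht, add_zero]
    | smul a s _ hs => rw [mul_smul_comm, map_smul, hs, smul_zero]
  have key2 : ∀ s, y x (s * r) = 0 := by
    induction hr using Submodule.span_induction with
    | mem z hz =>
      obtain ⟨i, s, hi, rfl⟩ := hz
      intro r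
      rw [← mul_assoc]
      exact key i r hi s
    | zero => simp
    | add s t _ _ hs ht => intro r; rw [mul_add, map_add, hs, ht, add_zero]
    | smul a s _ hs => intro r; rw [smul_eq_mul, ← mul_assoc]; exact hs _
  simpa using key2 1

theorem IsDualBasis.term_mem (h : IsTriangular β γ e f g deg) (D : IsDualBasis β γ f g p c y)
    {l : ℕ} {x : X} (hx : deg (p x) < l) (b : B) : γ (c x) * β b ∈ idealLT e deg l := by
  rw [← D.c_mul, map_mul, h.map_g, mul_assoc]
  exact Ideal.mul_mem_left _ _ (mul_mem_idealLT hx _)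

omit [Fintype ι] in
theorem IsDualBasis.y_smul_f (D : IsDualBasis β γ f g p c y)
    {i : ι} {z : C} (a : X → k) (ha : ∀ x, p x ≠ i → a x = 0) (hz : z = ∑ x, a x • c x)
    {b : B} (hb : f i * b = b) (x : X) : y x (γ z * β b) = a x • b := by
  rw [hz, map_sum, Finset.sum_mul, map_sum, Finset.sum_eq_single x]
  · by_cases hx : p x = i
    · rw [map_smul, smul_mul_assoc, map_smul, D.y_c _ _ _ (by rw [hx, hb]), if_pos rfl]
    · simp [ha x hx]
  · intro x' _ hx'
    by_cases hx : p x' = i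
    · rw [map_smul, smul_mul_assoc, map_smul, D.y_c _ _ _ (by rw [hx, hb]), if_neg (Ne.symm hx'),
        smul_zero]
    · simp [ha x' hx]
  · simp

/-- Elements of `C g i ⊗ f i B` are independent modulo lower degrees. -/
theorem IsDualBasis.eq_zero_of_mem (h : IsTriangular β γ e f g deg)
    (D : IsDualBasis β γ f g p c y) {i : ι} {z : C} (hz : z * g i = z)
    (hmem : γ z ∈ idealLT e deg (deg i)) : z = 0 := by
  obtain ⟨a, ha, hza⟩ := D.span z i hz
  have h1 : γ z = γ z * β (f i) := by rw [h.map_f, ← h.map_g, ← map_mul, hz]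
  rw [hza]
  refine Finset.sum_eq_zero fun x _ => ?_
  by_cases hx : p x = i
  · have h2 := D.y_eq_zero h hmem x (by rw [hx])
    rw [h1, D.y_smul_f a ha hza ((h.complete_f.idem i).eq)] at h2
    rw [(smul_eq_zero.1 h2).resolve_right (h.f_ne_zero i), zero_smul]
  · rw [ha x hx, zero_smul]

end DualBasis

variable [DecidableEq ι] [FiniteDimensional k R] [FiniteDimensional k B] [FiniteDimensional k C]

/-- This makes coefficients of e_i modulo lower degrees unique. -/
theorem IsTriangular.smul_e_mem (h : IsTriangular β γ e f g deg) {i : ι} {a : k}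
    (ha : a • e i ∈ idealLT e deg (deg i)) : a = 0 := by
  obtain ⟨X, _, _, p, c, y, D⟩ := h.exists_isDualBasis
  have h1 := D.eq_zero_of_mem h (i := i) (z := a • g i)
    (by rw [smul_mul_assoc, (h.complete_g.idem i).eq]) (by rwa [map_smul, h.map_g])
  exact (smul_eq_zero.1 h1).resolve_right (h.g_ne_zero i)

/-- Expand r e_i in the dual basis. Terms with p x = i have coefficients in f_i B f_i = k f_i and
add up to γ w. Each other term is zero if deg (p x) ≥ deg i and lies in the ideal of lower degrees
otherwise. -/
theorem IsTriangular.exists_sub_mem (h : IsTriangular β γ e f g deg) (i : ι) (r : R) :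
    ∃ w : C, w * g i = w ∧ r * e i - γ w ∈ idealLT e deg (deg i) := by
  obtain ⟨X, _, _, p, c, y, D⟩ := h.exists_isDualBasis
  choose a ha using fun x => h.diag_B i (y x r)
  refine ⟨∑ x with p x = i, a x • c x, ?_, ?_⟩
  · rw [Finset.sum_mul]
    refine Finset.sum_congr rfl fun x hx => ?_
    have hx : p x = i := by simpa using hx
    rw [smul_mul_assoc, ← hx, D.c_mul]
  · have h1 : r * e i = ∑ x, γ (c x) * β (y x (r * e i)) := D.sum _
    have h2 : r * e i - γ (∑ x with p x = i, a x • c x) =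
        ∑ x with p x ≠ i, γ (c x) * β (y x (r * e i)) := by
      rw [sub_eq_iff_eq_add]
      conv_lhs => rw [h1]
      rw [← Finset.sum_filter_add_sum_filter_not _ (fun x => p x = i),
        add_comm, map_sum]
      congr 1
      refine Finset.sum_congr rfl fun x hx => ?_
      have hx : p x = i := by simpa using hx
      rw [← h.map_f, D.y_mul, ← D.mul_y, hx, ha, map_smul, map_smul, h.map_f, mul_smul_comm]
      conv_rhs => rw [← D.c_mul, map_mul, h.map_g, hx]
    rw [h2]
    refine sum_mem fun x hx => ?_
    have hx : p x ≠ i := by simpa using hx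
    by_cases hd : deg i ≤ deg (p x)
    · rw [D.y_mul_e h r hd (Ne.symm hx), map_zero, mul_zero]
      exact zero_mem _
    · exact D.term_mem h (not_le.1 hd) _

/-- Modulo lower degrees r e_j comes from C g_j, and g_i C g_j = 0 because C strictly raises the
degree. -/
theorem IsTriangular.e_mul_e_mem (h : IsTriangular β γ e f g deg) {i j : ι} (hij : i ≠ j)
    (hd : deg i ≤ deg j) (r : R) : e i * r * e j ∈ idealLT e deg (deg j) := by
  obtain ⟨w, hw, hmem⟩ := h.exists_sub_mem j r
  have h1 : e i * γ w = 0 := by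
    rw [← h.map_g, ← hw, ← map_mul, ← mul_assoc]
    by_contra h0
    have := h.dir_C j i w hij.symm fun h1 => h0 (by rw [h1, map_zero])
    omega
  have h2 := Ideal.mul_mem_left _ (e i) hmem
  rwa [mul_sub, h1, sub_zero, ← mul_assoc] at h2

theorem IsTriangular.exists_scalar (h : IsTriangular β γ e f g deg) (i : ι) (r : R) :
    ∃ a : k, e i * r * e i - a • e i ∈ idealLT e deg (deg i) := by
  obtain ⟨w, hw, hmem⟩ := h.exists_sub_mem i r
  obtain ⟨a, ha⟩ := h.diag_C i w
  refine ⟨a, ?_⟩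
  have h2 := Ideal.mul_mem_left _ (e i) hmem
  have h1 : e i * γ w = a • e i := by
    rw [← h.map_g, ← map_smul, ← ha, ← map_mul, mul_assoc, hw]
  rwa [mul_sub, h1, ← mul_assoc] at h2

/-- The coefficient of `e i` in `e i R e i` modulo lower degrees. -/
theorem IsTriangular.exists_coeff (h : IsTriangular β γ e f g deg) :
    ∃ μ : ι → R →ₗ[k] k, ∀ i r, e i * r * e i - μ i r • e i ∈ idealLT e deg (deg i) := by
  choose μ hμ using fun i => h.exists_scalar i
  have huniq : ∀ i r a, e i * r * e i - a • e i ∈ idealLT e deg (deg i) → μ i r = a := by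
    intro i r a ha
    have h1 := sub_mem ha (hμ i r)
    rw [sub_sub_sub_cancel_left, ← sub_smul] at h1
    exact sub_eq_zero.1 (h.smul_e_mem h1)
  refine ⟨fun i => ⟨⟨μ i, fun r s => huniq _ _ _ ?_⟩, fun a r => huniq _ _ _ ?_⟩, hμ⟩
  · have := add_mem (hμ i r) (hμ i s)
    convert this using 1
    rw [mul_add, add_mul, add_smul]
    abel
  · have := Submodule.smul_of_tower_mem (idealLT e deg (deg i)) a (hμ i r)
    rw [smul_sub] at this
    rwa [mul_smul_comm, smul_mul_assoc, RingHom.id_apply, smul_eq_mul, mul_smul]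

end Triangular
end ReedyAlg

namespace ReedyAlg

/-! ### Simple modules and the heredity chain of a triangular decomposition -/

variable {k : Type u} [Field k]

/-- `μ i r` is the coefficient of `e i` in `e i * r * e i` modulo lower degrees. -/
def IsCoeff {R : Type*} [Ring R] [Algebra k R] {ι : Type*} (e : ι → R) (deg : ι → ℕ)
    (μ : ι → R →ₗ[k] k) : Prop :=
  ∀ i r, e i * r * e i - μ i r • e i ∈ idealLT e deg (deg i)

/-- The left ideal of all `r` with `μ R r = 0`. -/
def radIdeal {R : Type*} [Ring R] [Algebra k R] (μ : R →ₗ[k] k) : Ideal R where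
  carrier := {r | ∀ a, μ (a * r) = 0}
  add_mem' hx hy a := by rw [mul_add, map_add, hx, hy, add_zero]
  zero_mem' a := by simp
  smul_mem' r x hx a := by rw [smul_eq_mul, ← mul_assoc]; exact hx _

/-- The module `L` has weight `i`: the degrees of the idempotents that act nontrivially on `L`
attain their minimum at `e i` only. -/
def IsTop {R : Type*} [Ring R] {ι : Type*} (e : ι → R) (deg : ι → ℕ) (i : ι) (L : Type*)
    [AddCommGroup L] [Module R L] : Prop :=
  (∃ x : L, e i • x ≠ 0) ∧ ∀ j (x : L), j ≠ i → e j • x ≠ 0 → deg i < deg j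

theorem IsTop.congr {R : Type*} [Ring R] {ι : Type*} {e : ι → R} {deg : ι → ℕ} {i : ι}
    {L L' : Type*} [AddCommGroup L] [Module R L] [AddCommGroup L'] [Module R L']
    (h : IsTop e deg i L) (ε : L ≃ₗ[R] L') : IsTop e deg i L' := by
  obtain ⟨⟨x, hx⟩, h2⟩ := h
  refine ⟨⟨ε x, ?_⟩, fun j y hj hy => h2 j (ε.symm y) hj ?_⟩
  · rwa [← map_smul, Ne, ε.map_eq_zero_iff]
  · rwa [← map_smul, Ne, ε.symm.map_eq_zero_iff]

theorem IsTop.index_eq {R : Type*} [Ring R] {ι : Type*} {e : ι → R} {deg : ι → ℕ} {i j : ι}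
    {L : Type*} [AddCommGroup L] [Module R L] (hi : IsTop e deg i L) (hj : IsTop e deg j L) :
    i = j := by
  by_contra hne
  obtain ⟨⟨x, hx⟩, h2⟩ := hi
  obtain ⟨⟨x', hx'⟩, h2'⟩ := hj
  exact lt_asymm (h2 j x' (Ne.symm hne) hx') (h2' i x hne hx)

theorem smul_eq_zero_of_mem_idealLT {R : Type*} [Ring R] {ι : Type*} {e : ι → R} {deg : ι → ℕ}
    {l : ℕ} {L : Type*} [AddCommGroup L] [Module R L]
    (h : ∀ j (x : L), deg j < l → e j • x = 0) {r : R} (hr : r ∈ idealLT e deg l) (x : L) :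
    r • x = 0 := by
  induction hr using Submodule.span_induction with
  | mem z hz =>
    obtain ⟨j, s, hj, rfl⟩ := hz
    rw [mul_smul, h j _ hj]
  | zero => simp
  | add s t _ _ hs ht => rw [add_smul, hs, ht, add_zero]
  | smul a s _ hs => rw [smul_eq_mul, mul_smul, hs, smul_zero]

theorem IsTop.smul_eq_zero {R : Type*} [Ring R] {ι : Type*} {e : ι → R} {deg : ι → ℕ} {i : ι}
    {L : Type*} [AddCommGroup L] [Module R L] (h : IsTop e deg i L) {r : R}
    (hr : r ∈ idealLT e deg (deg i)) (x : L) : r • x = 0 := by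
  refine smul_eq_zero_of_mem_idealLT (fun j x hj => ?_) hr x
  by_contra h0
  have := h.2 j x (by rintro rfl; omega) h0
  omega

section Triangular

variable {R : Type v} {B C : Type*} [Ring R] [Ring B] [Ring C] [Algebra k R] [Algebra k B]
    [Algebra k C] {β : B →ₐ[k] R} {γ : C →ₐ[k] R} {ι : Type} [Fintype ι]
    {e : ι → R} {f : ι → B} {g : ι → C} {deg : ι → ℕ} {μ : ι → R →ₗ[k] k}
    [DecidableEq ι] [FiniteDimensional k R] [FiniteDimensional k B] [FiniteDimensional k C]

theorem IsCoeff.eq (h : IsTriangular β γ e f g deg) (hμ : IsCoeff e deg μ) {i : ι} {r : R} {a : k}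
    (ha : e i * r * e i - a • e i ∈ idealLT e deg (deg i)) : μ i r = a := by
  have h1 := sub_mem ha (hμ i r)
  rw [sub_sub_sub_cancel_left, ← sub_smul] at h1
  exact sub_eq_zero.1 (h.smul_e_mem h1)

theorem IsCoeff.of_mem (h : IsTriangular β γ e f g deg) (hμ : IsCoeff e deg μ) {i : ι} {r : R}
    (hr : r ∈ idealLT e deg (deg i)) : μ i r = 0 := by
  refine hμ.eq h ?_
  rw [zero_smul, sub_zero]
  exact Ideal.mul_mem_right _ _ (Ideal.mul_mem_left _ _ hr)

theorem IsCoeff.e_mul (h : IsTriangular β γ e f g deg) (hμ : IsCoeff e deg μ) (i : ι) (r : R) :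
    μ i (e i * r) = μ i r := by
  refine hμ.eq h ?_
  rw [← mul_assoc, (h.complete.idem i).eq]
  exact hμ i r

theorem IsCoeff.mul_e (h : IsTriangular β γ e f g deg) (hμ : IsCoeff e deg μ) (i : ι) (r : R) :
    μ i (r * e i) = μ i r := by
  refine hμ.eq h ?_
  rw [← mul_assoc, mul_assoc _ (e i), (h.complete.idem i).eq]
  exact hμ i r

theorem IsCoeff.one (h : IsTriangular β γ e f g deg) (hμ : IsCoeff e deg μ) (i : ι) :
    μ i 1 = 1 := by
  refine hμ.eq h ?_
  rw [mul_one, (h.complete.idem i).eq, one_smul, sub_self]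
  exact zero_mem _

theorem IsCoeff.one_sub_mem (h : IsTriangular β γ e f g deg) (hμ : IsCoeff e deg μ) (i : ι) :
    1 - e i ∈ radIdeal (μ i) := fun a => by
  rw [mul_sub, mul_one, map_sub, hμ.mul_e h, sub_self]

theorem IsCoeff.idealLT_le (h : IsTriangular β γ e f g deg) (hμ : IsCoeff e deg μ) (i : ι) :
    idealLT e deg (deg i) ≤ radIdeal (μ i) := fun _ hr a =>
  hμ.of_mem h (Ideal.mul_mem_left _ a hr)

/-- If μ(a x) ≠ 0, then e_i a x e_i is a nonzero multiple of e_i up to lower degrees, which belong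
to the left ideal. A larger left ideal hence contains e_i, and it contains 1 - e_i in any case. -/
theorem IsCoeff.isCoatom (h : IsTriangular β γ e f g deg) (hμ : IsCoeff e deg μ) (i : ι) :
    IsCoatom (radIdeal (μ i)) := by
  refine ⟨fun htop => ?_, fun N hN => ?_⟩
  · have h1 : (1 : R) ∈ radIdeal (μ i) := htop ▸ Submodule.mem_top
    have h2 := h1 1
    rw [mul_one, hμ.one h] at h2
    exact one_ne_zero h2
  · obtain ⟨hle, hnot⟩ := SetLike.lt_iff_le_and_exists.1 hN
    obtain ⟨x, hxN, hx⟩ := hnot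
    have hx : ¬ ∀ a, μ i (a * x) = 0 := hx
    push Not at hx
    obtain ⟨a, ha⟩ := hx
    have hxe : x * e i ∈ N := by
      have h1 := N.sub_mem hxN (hle (Ideal.mul_mem_left _ x (hμ.one_sub_mem h i)))
      rwa [mul_sub, mul_one, sub_sub_cancel] at h1
    have h2 : e i * (a * x) * e i ∈ N := by
      rw [mul_assoc, mul_assoc a, ← mul_assoc]
      exact Ideal.mul_mem_left _ _ hxe
    have h3 : μ i (a * x) • e i ∈ N := by
      have h1 := N.sub_mem h2 (hle (hμ.idealLT_le h i (hμ i (a * x))))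
      rwa [sub_sub_cancel] at h1
    have h4 : e i ∈ N := by
      have h1 := Submodule.smul_of_tower_mem N (μ i (a * x))⁻¹ h3
      rwa [smul_smul, inv_mul_cancel₀ ha, one_smul] at h1
    rw [Ideal.eq_top_iff_one]
    simpa using N.add_mem (hle (hμ.one_sub_mem h i)) h4

/-- Idempotents of smaller degree lie in the two-sided ideal that acts as zero. For j ≠ i of equal
degree, e_i R e_j lies in that ideal, so μ i vanishes on R e_j R. -/
theorem IsCoeff.isTop (h : IsTriangular β γ e f g deg) (hμ : IsCoeff e deg μ) (i : ι) :
    IsTop e deg i (R ⧸ radIdeal (μ i)) := by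
  refine ⟨⟨Submodule.Quotient.mk 1, fun h0 => ?_⟩, fun j x hj hx => ?_⟩
  · rw [← Submodule.Quotient.mk_smul, Submodule.Quotient.mk_eq_zero] at h0
    have h1 := h0 1
    rw [one_mul, smul_eq_mul, mul_one, ← mul_one (e i), hμ.e_mul h, hμ.one h] at h1
    exact one_ne_zero h1
  · obtain ⟨x, rfl⟩ := Submodule.Quotient.mk_surjective _ x
    rw [← Submodule.Quotient.mk_smul, Ne, Submodule.Quotient.mk_eq_zero] at hx
    by_contra hd
    rcases lt_or_eq_of_le (not_lt.1 hd) with hd | hd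
    · exact hx (hμ.idealLT_le h i (Ideal.mul_mem_right _ _ (mem_idealLT hd)))
    · refine hx fun a => ?_
      rw [← hμ.e_mul h]
      refine hμ.of_mem h ?_
      rw [smul_eq_mul, ← mul_assoc, ← mul_assoc]
      refine Ideal.mul_mem_right _ _ ?_
      rw [← hd]
      exact h.e_mul_e_mem hj.symm hd.ge a

omit [FiniteDimensional k R] in
theorem smul_algebraMap_eq_zero {M : Type*} [AddCommGroup M] [Module R M] {a : k} {x : M}
    (hx : x ≠ 0) (h0 : algebraMap k R a • x = 0) : a = 0 := by
  by_contra hne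
  apply hx
  have := congrArg (algebraMap k R a⁻¹ • ·) h0
  simpa [← mul_smul, ← map_mul, hne] using this

omit [Fintype ι] [DecidableEq ι] [FiniteDimensional k R] in
/-- A simple module annihilated by the idempotents of degree less than `deg i`, but not by `e i`,
is isomorphic to `R / radIdeal (μ i)`. -/
theorem IsCoeff.nonempty_equiv (hμ : IsCoeff e deg μ)
    (he : ∀ i, e i * e i = e i) {i : ι} (L : Type v) [AddCommGroup L] [Module R L]
    [IsSimpleModule R L] {x : L} (hx : e i • x ≠ 0)
    (hlt : ∀ j (y : L), deg j < deg i → e j • y = 0) :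
    Nonempty (L ≃ₗ[R] R ⧸ radIdeal (μ i)) := by
  set v := e i • x with hv
  have hev : e i • v = v := by rw [hv, ← mul_smul, he]
  -- The corner e_i R e_i acts on v through μ i, because lower degrees annihilate L. This identifies
  -- the annihilator of v.
  have key : ∀ r, e i • r • v = algebraMap k R (μ i r) • v := by
    intro r
    have h1 := smul_eq_zero_of_mem_idealLT hlt (hμ i r) v
    rw [sub_smul, sub_eq_zero, mul_smul, mul_smul, hev, Algebra.smul_def, mul_smul, hev] at h1
    exact h1
  refine ⟨((LinearMap.toSpanSingleton R L v).quotKerEquivOfSurjective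
    (IsSimpleModule.toSpanSingleton_surjective R hx)).symm ≪≫ₗ Submodule.quotEquivOfEq _ _ ?_⟩
  ext r
  rw [LinearMap.mem_ker, LinearMap.toSpanSingleton_apply]
  constructor
  · intro hr a
    refine smul_algebraMap_eq_zero (R := R) hx ?_
    rw [← key, mul_smul, hr, smul_zero, smul_zero]
  · intro hr
    by_contra h0
    obtain ⟨a, ha⟩ := IsSimpleModule.toSpanSingleton_surjective R h0 v
    rw [LinearMap.toSpanSingleton_apply, ← mul_smul] at ha
    have h1 := key (a * r)
    rw [ha, hr a, map_zero, zero_smul, hev] at h1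
    exact hx h1

/-- For completeness, choose an idempotent of least degree that does not annihilate the given simple
module. Irredundancy holds because `IsTop` recovers the weight from the module. -/
theorem IsCoeff.exists_weightSystem (h : IsTriangular β γ e f g deg) (hμ : IsCoeff e deg μ) :
    ∃ W : WeightSystem R ι, (∀ i, W.L i = ModuleCat.of R (R ⧸ radIdeal (μ i))) ∧
      ∀ i, IsTop e deg i (W.L i) := by
  have := IsArtinianRing.of_finite k R
  obtain ⟨W, hW⟩ := ReedyAlg.exists_weightSystem
    (fun i => ModuleCat.of R (R ⧸ radIdeal (μ i)))
    (fun i => isSimpleModule_iff_isCoatom.2 (hμ.isCoatom h i))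
    (fun i j ⟨ε⟩ => ((hμ.isTop h i).congr ε).index_eq (hμ.isTop h j))
    (fun M hM => by
      have := IsSimpleModule.nontrivial R M
      obtain ⟨x, hx⟩ := exists_ne (0 : M)
      have hex : ∃ l, ∃ i, deg i = l ∧ ∃ x : M, e i • x ≠ 0 := by
        by_contra! hcon
        apply hx
        rw [← one_smul R x, ← h.complete.complete, Finset.sum_smul]
        exact Finset.sum_eq_zero fun i _ => hcon _ i rfl x
      classical
      obtain ⟨i, hi, x, hx⟩ := Nat.find_spec hex
      refine ⟨i, hμ.nonempty_equiv (fun i => (h.complete.idem i).eq) M hx fun j y hj => ?_⟩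
      by_contra h0
      exact Nat.find_min hex (hi ▸ hj) ⟨j, rfl, y, h0⟩)
  refine ⟨W, fun i => congrFun hW i, fun i => ?_⟩
  rw [hW]
  exact hμ.isTop h i

/-- The partial order given by reversed degrees. -/
def degLE (deg : ι → ℕ) (i j : ι) : Prop := i = j ∨ deg j < deg i

/-- `R` is a projective left `C`-module, with basis elements `b x` that generate copies of the
`C g (p x)`. -/
theorem IsTriangular.exists_leftDualBasis (h : IsTriangular β γ e f g deg) :
    ∃ (X : Type) (_ : Fintype X) (_ : DecidableEq X) (p : X → ι) (b : X → B)
      (z : X → R →ₗ[k] C), (∀ x, f (p x) * b x = b x) ∧ (∀ x r, z x r * g (p x) = z x r) ∧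
      (∀ r, r = ∑ x, γ (z x r) * β (b x)) ∧
      (∀ x x' c, c * g (p x') = c → z x (γ c * β (b x')) = if x = x' then c else 0) ∧
      ∀ l, ∀ r ∈ idealLT e deg l, ∀ x, l ≤ deg (p x) → z x r = 0 := by
  obtain ⟨X, _, _, p, c, y, D⟩ := h.op.exists_isDualBasis
  refine ⟨X, inferInstance, inferInstance, p, fun x => (c x).unop, fun x =>
    (MulOpposite.opLinearEquiv k).symm.toLinearMap ∘ₗ y x ∘ₗ
      (MulOpposite.opLinearEquiv k).toLinearMap, fun x => ?_, fun x r => ?_, fun r => ?_,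
      fun x x' c' hc => ?_, fun l r hr x hx => ?_⟩
  · exact congrArg MulOpposite.unop (D.c_mul x)
  · exact congrArg MulOpposite.unop (D.mul_y x (MulOpposite.op r))
  · have := congrArg MulOpposite.unop (D.sum (MulOpposite.op r))
    rw [Finset.unop_sum] at this
    exact this
  · have := congrArg MulOpposite.unop
      (D.y_c x x' (MulOpposite.op c') (congrArg MulOpposite.op hc))
    refine Eq.trans this ?_
    split_ifs <;> rfl
  · exact congrArg MulOpposite.unop (D.y_eq_zero h.op (op_mem_idealLT hr) x hx)

/-- The heredity chain of a triangular decomposition. -/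
theorem IsTriangular.isHeredityIdeal (h : IsTriangular β γ e f g deg) (l : ℕ) :
    IsHeredityIdeal (R ⧸ idealLT e deg l)
      ((idealLT e deg (l + 1)).map (Ideal.Quotient.mk (idealLT e deg l))) := by
  set J := idealLT e deg l
  set J' := idealLT e deg (l + 1)
  set π := Ideal.Quotient.mk J
  have hsurj : Function.Surjective π := Ideal.Quotient.mk_surjective
  have hmem : ∀ {x}, x ∈ J'.map π → ∃ a ∈ J', π a = x := fun hx =>
    (Ideal.mem_map_iff_of_surjective _ hsurj).1 hx
  have hzero : ∀ {x}, π x = 0 ↔ x ∈ J := Ideal.Quotient.eq_zero_iff_mem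
  have htwo : (J'.map π).IsTwoSided := by
    constructor
    intro a b ha
    obtain ⟨a', ha', rfl⟩ := hmem ha
    obtain ⟨b, rfl⟩ := hsurj b
    rw [← map_mul]
    exact Ideal.mem_map_of_mem _ (Ideal.mul_mem_right _ _ ha')
  refine ⟨htwo, le_antisymm Ideal.mul_le_left ?_, ?_, ?_⟩
  · intro x hx
    obtain ⟨a, ha, rfl⟩ := hmem hx
    have ha' : a ∈ J' * J' := by rwa [idealLT_mul_self h.complete.toOrthogonalIdempotents]
    refine Submodule.mul_induction_on ha' (fun a ha b hb => ?_) fun a b ha hb => ?_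
    · rw [map_mul]
      exact Ideal.mul_mem_mul (Ideal.mem_map_of_mem _ ha) (Ideal.mem_map_of_mem _ hb)
    · rw [map_add]; exact add_mem ha hb
  · have hQ : IsArtinianRing (R ⧸ J) := by
      have := IsArtinianRing.of_finite k R
      exact hsurj.isArtinianRing
    -- In R / J an idempotent of degree less than l is zero. For two idempotents of degree l the
    -- corner is zero if they differ and k e_i if they agree; an invertible multiple of e_i lies in
    -- the radical only if e_i is zero.
    have key : ∀ i j, deg i < l + 1 → deg j < l + 1 → ∀ ρ ∈ Ring.jacobson (R ⧸ J),
        π (e i) * ρ * π (e j) = 0 := by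
      intro i j hi hj ρ hρ
      obtain ⟨r, rfl⟩ := hsurj ρ
      rw [← map_mul, ← map_mul]
      by_cases hi' : deg i < l
      · exact hzero.2 (Ideal.mul_mem_right _ _ (mul_mem_idealLT hi' _))
      by_cases hj' : deg j < l
      · exact hzero.2 (Ideal.mul_mem_left _ _ (mem_idealLT hj'))
      have hi2 : deg i = l := by omega
      have hj2 : deg j = l := by omega
      by_cases hij : i = j
      · subst hij
        obtain ⟨a, ha⟩ := h.exists_scalar i r
        rw [hi2] at ha
        have h1 : π (e i * r * e i) = a • π (e i) := by
          have h2 := hzero.2 ha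
          rw [map_sub, sub_eq_zero] at h2
          exact h2
        have h2 : π (e i * r * e i) ∈ Ring.jacobson (R ⧸ J) := by
          rw [map_mul, map_mul]
          exact Ideal.mul_mem_right _ _ (Ideal.mul_mem_left _ _ hρ)
        rw [h1] at h2 ⊢
        by_cases ha0 : a = 0
        · rw [ha0, zero_smul]
        · have h3 : π (e i) ∈ Ring.jacobson (R ⧸ J) := by
            have h4 := Submodule.smul_of_tower_mem (Ring.jacobson (R ⧸ J)) a⁻¹ h2
            rwa [smul_smul, inv_mul_cancel₀ ha0, one_smul] at h4
          obtain ⟨n, hn⟩ := isNilpotent_of_mem_jacobson h3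
          have h5 : IsIdempotentElem (π (e i)) := (h.complete.idem i).map π
          have h6 : π (e i) = 0 := by
            rw [← h5.pow_succ_eq n, pow_succ, hn, zero_mul]
          rw [h6, smul_zero]
      · refine hzero.2 ?_
        have := h.e_mul_e_mem hij (hi2.trans hj2.symm).le r
        rwa [hj2] at this
    have key2 : ∀ i, deg i < l + 1 → ∀ ρ ∈ Ring.jacobson (R ⧸ J), ∀ y ∈ J',
        π (e i) * ρ * π y = 0 := by
      intro i hi ρ hρ y hy
      induction hy using Submodule.span_induction generalizing ρ with
      | mem z hz =>
        obtain ⟨j, s, hj, rfl⟩ := hz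
        rw [map_mul, ← mul_assoc, key i j hi hj ρ hρ, zero_mul]
      | zero => simp
      | add y z _ _ hy hz => rw [map_add, mul_add, hy ρ hρ, hz ρ hρ, add_zero]
      | smul r z _ hz =>
        rw [smul_eq_mul, map_mul, ← mul_assoc, mul_assoc _ ρ]
        exact hz _ (Ideal.mul_mem_right _ _ hρ)
    have key3 : ∀ x ∈ J', ∀ ρ ∈ Ring.jacobson (R ⧸ J), ∀ y ∈ J', π x * ρ * π y = 0 := by
      intro x hx ρ hρ y hy
      induction hx using Submodule.span_induction with
      | mem z hz =>
        obtain ⟨j, s, hj, rfl⟩ := hz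
        rw [map_mul, mul_assoc _ (π s)]
        exact key2 j hj _ (Ideal.mul_mem_left _ _ hρ) y hy
      | zero => simp
      | add y z _ _ hy hz => rw [map_add, add_mul, add_mul, hy, hz, add_zero]
      | smul r z _ hz => rw [smul_eq_mul, map_mul, mul_assoc, mul_assoc, ← mul_assoc (π z), hz,
          mul_zero]
    rw [eq_bot_iff]
    refine Ideal.mul_le.2 fun z hz y hy => ?_
    obtain ⟨y, hyJ, rfl⟩ := hmem hy
    refine Submodule.mul_induction_on hz (fun x hx ρ hρ => ?_) fun a b ha hb => ?_
    · obtain ⟨x', hx', rfl⟩ := hmem hx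
      rw [key3 x' hx' ρ hρ y hyJ]
      exact zero_mem _
    · rw [add_mul]; exact add_mem ha hb
  -- The ideal J' / J is isomorphic to the direct sum of the projective modules (R / J) e_{p x} over
  -- the basis elements of degree exactly l. Basis terms of lower degree vanish modulo J, and
  -- coordinates of higher degree vanish on J'.
  · obtain ⟨X, _, _, p, b, z, hb, hz, hsum, hzc, hz0⟩ := h.exists_leftDualBasis
    let X' := {x : X // deg (p x) = l}
    let T : (X' → R ⧸ J) →ₗ[R ⧸ J] (X' → R ⧸ J) := LinearMap.pi fun x =>
      LinearMap.toSpanSingleton (R ⧸ J) (R ⧸ J) (π (e (p x))) ∘ₗ LinearMap.proj x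
    have hT : ∀ v x, T v x = v x * π (e (p x)) := fun v x => rfl
    let M : Submodule (R ⧸ J) (X' → R ⧸ J) := LinearMap.range T
    have hTT : ∀ v, T (T v) = T v := fun v => by
      ext x
      rw [hT, hT, mul_assoc, ← map_mul, (h.complete.idem _).eq]
    have hM : ∀ v ∈ M, T v = v := by
      rintro _ ⟨v, rfl⟩
      exact hTT v
    have hproj : Module.Projective (R ⧸ J) M :=
      Module.Projective.of_split M.subtype T.rangeRestrict (by
        ext v : 1
        exact Subtype.ext (hM v v.2))
    let S : (X' → R ⧸ J) →ₗ[R ⧸ J] R ⧸ J := ∑ x : X',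
      LinearMap.toSpanSingleton (R ⧸ J) (R ⧸ J) (π (β (b x))) ∘ₗ LinearMap.proj x
    have hS : ∀ v, S v = ∑ x : X', v x * π (β (b x)) := fun v => by simp [S]
    have hSM : ∀ v : M, (S ∘ₗ M.subtype) v ∈ J'.map π := by
      intro v
      rw [LinearMap.comp_apply, hS]
      refine sum_mem fun x _ => ?_
      rw [Submodule.subtype_apply, ← hM v v.2, hT]
      refine Ideal.mul_mem_right _ _ (Ideal.mul_mem_left _ _ (Ideal.mem_map_of_mem _ ?_))
      exact mem_idealLT (by rw [x.2]; omega)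
    refine Module.Projective.of_equiv (LinearEquiv.ofBijective
      ((S ∘ₗ M.subtype).codRestrict _ hSM) ⟨?_, ?_⟩)
    · rw [injective_iff_map_eq_zero]
      rintro ⟨v, hv⟩ hv0
      have hv0 : S v = 0 := congrArg Subtype.val hv0
      choose r hr using fun x => hsurj (v x)
      -- Lifts may be taken in C g_{p x}, where the coordinate functionals return w itself. These
      -- functionals vanish on J.
      choose w hw hwr using fun x : X' => h.exists_sub_mem (p x) (r x)
      have hvw : ∀ x, v x = π (γ (w x)) := by
        intro x
        have h1 := hwr x
        rw [x.2] at h1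
        have h2 := hzero.2 h1
        rw [map_sub, sub_eq_zero, map_mul, hr] at h2
        rw [← h2]
        exact (congrFun (hM v hv) x).symm
      have hmemJ : ∑ x : X', γ (w x) * β (b x) ∈ J := by
        rw [← hzero, map_sum, ← hv0, hS]
        exact Finset.sum_congr rfl fun x _ => by rw [map_mul, hvw]
      refine Subtype.ext (funext fun x => ?_)
      have h1 := hz0 l _ hmemJ x.1 x.2.ge
      rw [map_sum, Finset.sum_eq_single x] at h1
      · rw [hzc _ _ _ (hw x), if_pos rfl] at h1
        change v x = 0
        rw [hvw, h1, map_zero, map_zero]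
      · intro x' _ hx'
        rw [hzc _ _ _ (hw x'), if_neg fun h2 => hx' (Subtype.ext h2.symm)]
      · simp
    · rintro ⟨y, hy⟩
      obtain ⟨a, ha, rfl⟩ := hmem hy
      have hzM : (fun x : X' => π (γ (z x a))) ∈ M := by
        refine ⟨fun x : X' => π (γ (z x a)), ?_⟩
        ext x
        rw [hT, ← map_mul, ← h.map_g, ← map_mul, hz]
      refine ⟨⟨_, hzM⟩, Subtype.ext ?_⟩
      change S (fun x : X' => π (γ (z x a))) = π a
      rw [hS]
      conv_rhs => rw [hsum a, map_sum]
      rw [← Finset.sum_subtype (Finset.univ.filter fun x => deg (p x) = l) (by simp)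
        (fun x => π (γ (z x a)) * π (β (b x))), Finset.sum_filter]
      refine Finset.sum_congr rfl fun x _ => ?_
      split_ifs with hx
      · rw [map_mul]
      · symm
        rw [hzero]
        by_cases hlt : deg (p x) < l
        · rw [← hz, map_mul, h.map_g, mul_assoc]
          exact Ideal.mul_mem_left _ _ (mul_mem_idealLT hlt _)
        · rw [hz0 _ _ ha x (by omega), map_zero, zero_mul]
          exact zero_mem _

end Triangular
end ReedyAlg

namespace ReedyAlg

variable {k : Type u} [Field k]

/-! ### Standard modules of a triangular decomposition -/

section Triangular

variable {R : Type v} {B C : Type*} [Ring R] [Ring B] [Ring C] [Algebra k R] [Algebra k B]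
    [Algebra k C] {β : B →ₐ[k] R} {γ : C →ₐ[k] R} {ι : Type} [Fintype ι]
    {e : ι → R} {f : ι → B} {g : ι → C} {deg : ι → ℕ}
    [DecidableEq ι] [FiniteDimensional k R] [FiniteDimensional k B] [FiniteDimensional k C]

/-- The heredity chain of a triangular decomposition. -/
def IsTriangular.heredityChain (h : IsTriangular β γ e f g deg) : HeredityChain R where
  -- The ideal at step l uses degrees strictly less than l, hence the extra step.
  n := Finset.univ.sup deg + 1
  J := idealLT e deg
  twoSided _ := inferInstance
  zero := idealLT_zero
  last := idealLT_eq_top h.complete fun i => Nat.lt_succ_of_le (Finset.le_sup (Finset.mem_univ i))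
  le_succ l _ := idealLT_mono (Nat.le_succ l)
  heredity l _ := h.isHeredityIdeal l

theorem IsTriangular.isQuasiHereditary (h : IsTriangular β γ e f g deg) {W : WeightSystem R ι}
    (hW : ∀ i, IsTop e deg i (W.L i)) : IsQuasiHereditary W (degLE deg) := by
  refine ⟨h.heredityChain, deg, fun i => ⟨?_, ?_⟩, fun i j => Iff.rfl⟩
  · exact Nat.lt_succ_of_le (Finset.le_sup (Finset.mem_univ i))
  · obtain ⟨x, hx⟩ := (hW i).1
    refine ⟨LinearMap.toSpanSingleton R (W.L i) x ∘ₗ Submodule.subtype _, fun h0 => hx ?_,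
      fun r hr => (hW i).smul_eq_zero hr x⟩
    exact LinearMap.congr_fun h0 ⟨e i, mem_idealLT (Nat.lt_succ_self _)⟩

/-- The left ideal whose quotient is the standard module of weight `i`. -/
def stdIdeal (e : ι → R) (deg : ι → ℕ) (i : ι) : Ideal R :=
  idealLT e deg (deg i) ⊔ Ideal.span {1 - e i}

omit [Fintype ι] [DecidableEq ι] in
theorem one_sub_mem_stdIdeal (i : ι) : 1 - e i ∈ stdIdeal e deg i :=
  (le_sup_right : Ideal.span {1 - e i} ≤ stdIdeal e deg i) (Ideal.subset_span rfl)

omit [Fintype ι] [DecidableEq ι] in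
theorem sub_mul_mem_stdIdeal (i : ι) (r : R) : r - r * e i ∈ stdIdeal e deg i := by
  have := Ideal.mul_mem_left _ r (one_sub_mem_stdIdeal (e := e) (deg := deg) i)
  rwa [mul_sub, mul_one] at this

omit [Fintype ι] [DecidableEq ι] in
theorem idealLT_le_stdIdeal (i : ι) : idealLT e deg (deg i) ≤ stdIdeal e deg i := le_sup_left

omit [Fintype ι] [DecidableEq ι] in
theorem stdIdeal_le {i : ι} {N : Ideal R} (h1 : idealLT e deg (deg i) ≤ N) (h2 : 1 - e i ∈ N) :
    stdIdeal e deg i ≤ N :=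
  sup_le h1 (Ideal.span_le.2 (Set.singleton_subset_iff.2 h2))

theorem IsTriangular.e_smul_quotient (h : IsTriangular β γ e f g deg) {i j : ι}
    {x : R ⧸ stdIdeal e deg i} (hx : e j • x ≠ 0) : j = i ∨ deg i < deg j := by
  obtain ⟨r, rfl⟩ := Submodule.Quotient.mk_surjective _ x
  by_contra! hcon
  apply hx
  rw [← Submodule.Quotient.mk_smul, Submodule.Quotient.mk_eq_zero, smul_eq_mul]
  have h1 := add_mem (sub_mul_mem_stdIdeal (e := e) (deg := deg) i (e j * r))
    (idealLT_le_stdIdeal i (h.e_mul_e_mem hcon.1 hcon.2 r))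
  rwa [sub_add_cancel] at h1

/-- The e_i-component of the quotient is one-dimensional, spanned by the class of 1, which generates
the module. -/
theorem IsTriangular.eq_top_of_smul_ne_zero (h : IsTriangular β γ e f g deg) {i : ι}
    {N : Submodule R (R ⧸ stdIdeal e deg i)} {x : R ⧸ stdIdeal e deg i} (hxN : x ∈ N)
    (hx : e i • x ≠ 0) : N = ⊤ := by
  obtain ⟨r, rfl⟩ := Submodule.Quotient.mk_surjective _ x
  obtain ⟨a, ha⟩ := h.exists_scalar i r
  have h1 : e i • (Submodule.Quotient.mk r : R ⧸ stdIdeal e deg i) =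
      a • Submodule.Quotient.mk 1 := by
    rw [← Submodule.Quotient.mk_smul, ← Submodule.Quotient.mk_smul, Submodule.Quotient.eq,
      smul_eq_mul]
    have h2 := sub_mul_mem_stdIdeal (e := e) (deg := deg) i (e i * r)
    have h3 := idealLT_le_stdIdeal i ha
    have h4 := Submodule.smul_of_tower_mem _ a (one_sub_mem_stdIdeal (e := e) (deg := deg) i)
    have h5 := sub_mem (add_mem h2 h3) h4
    convert h5 using 1
    rw [smul_sub]
    abel
  have ha0 : a ≠ 0 := by
    rintro rfl
    rw [zero_smul] at h1
    exact hx h1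
  have h2 : (Submodule.Quotient.mk 1 : R ⧸ stdIdeal e deg i) ∈ N := by
    have h3 := Submodule.smul_of_tower_mem N a⁻¹ (N.smul_mem (e i) hxN)
    rwa [h1, smul_smul, inv_mul_cancel₀ ha0, one_smul] at h3
  rw [eq_top_iff]
  intro y _
  obtain ⟨s, rfl⟩ := Submodule.Quotient.mk_surjective _ y
  have := N.smul_mem s h2
  rwa [← Submodule.Quotient.mk_smul, smul_eq_mul, mul_one] at this

omit [Fintype ι] [DecidableEq ι] [FiniteDimensional k R] in
/-- A vector of weight `i` defines a homomorphism from the standard module. -/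
theorem exists_hom_of_stdIdeal {M : Type*} [AddCommGroup M] [Module R M] {i : ι} (v : M)
    (hJ : ∀ r ∈ idealLT e deg (deg i), r • v = 0) (he : e i • v = v) :
    ∃ φ : (R ⧸ stdIdeal e deg i) →ₗ[R] M, ∀ r, φ (Submodule.Quotient.mk r) = r • v := by
  refine ⟨(stdIdeal e deg i).liftQ (LinearMap.toSpanSingleton R M v) (stdIdeal_le hJ ?_),
    fun r => rfl⟩
  rw [LinearMap.mem_ker, LinearMap.toSpanSingleton_apply, sub_smul, one_smul, he, sub_self]

/-- There are surjections in both directions. Their composite is a surjective endomorphism of a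
Noetherian module, hence injective. -/
theorem IsTriangular.standard_equiv (h : IsTriangular β γ e f g deg) {W : WeightSystem R ι}
    (hW : ∀ i, IsTop e deg i (W.L i)) (i : ι) :
    Nonempty ((R ⧸ stdIdeal e deg i) ≃ₗ[R] W.standard (degLE deg) i) := by
  have := IsNoetherianRing.of_finite k R
  have := W.simple i
  have := W.projective i
  have := W.finite_P i
  obtain ⟨x, hx⟩ := (hW i).1
  obtain ⟨φ, hφ⟩ := exists_hom_of_stdIdeal (e := e) (deg := deg) (i := i) (e i • x)
    (fun r hr => (hW i).smul_eq_zero hr _) (by rw [← mul_smul, (h.complete.idem i).eq])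
  have hφs : Function.Surjective φ := by
    intro y
    obtain ⟨r, rfl⟩ := IsSimpleModule.toSpanSingleton_surjective R hx y
    exact ⟨_, hφ r⟩
  obtain ⟨G, hG⟩ := Module.projective_lifting_property φ (W.π i) hφs
  obtain ⟨w', rfl⟩ := W.π_surjective i x
  have hGs : LinearMap.range G = ⊤ := by
    refine h.eq_top_of_smul_ne_zero (x := G w') ⟨w', rfl⟩ fun h0 => hx ?_
    have h1 : φ (G w') = W.π i w' := LinearMap.congr_fun hG w'
    rw [← h1, ← map_smul, h0, map_zero]
  -- If `P j` has a nonzero image in the quotient, then e_j, which acts nontrivially on `L j`, acts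
  -- nontrivially there. Only j = i and degrees larger than deg i allow this.
  have htr : W.traceSum (degLE deg) i ≤ LinearMap.ker G := by
    refine iSup_le fun j => iSup_le fun hj => iSup_le fun F => ?_
    rw [LinearMap.range_le_ker_iff]
    by_contra h0
    obtain ⟨y, hy⟩ := (hW j).1
    obtain ⟨z, hz⟩ := W.exists_smul_apply_ne_zero (G ∘ₗ F) h0 hy
    exact hj (h.e_smul_quotient hz)
  let G' : W.standard (degLE deg) i →ₗ[R] (R ⧸ stdIdeal e deg i) :=
    (W.traceSum (degLE deg) i).liftQ G htr
  have hG' : Function.Surjective G' := by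
    intro y
    obtain ⟨z, rfl⟩ := LinearMap.range_eq_top.1 hGs y
    exact ⟨Submodule.Quotient.mk z, rfl⟩
  set w := e i • w'
  -- The ideal J of lower degrees is idempotent, so J `P i` is generated by images of `P j` with J
  -- `L j` ≠ 0. These j have smaller degree than i and occur in the trace sum.
  have hJw : ∀ r ∈ idealLT e deg (deg i), r • w ∈ W.traceSum (degLE deg) i := by
    intro r hr
    have h1 := W.smul_top_le_iSup (M := W.P i)
      (idealLT_mul_self h.complete.toOrthogonalIdempotents (deg := deg) (deg i))
      (Submodule.smul_mem_smul hr (Submodule.mem_top : w ∈ ⊤))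
    refine (iSup_mono fun j => iSup_le fun hj => ?_ :
      _ ≤ W.traceSum (degLE deg) i) h1
    obtain ⟨s, hs, y, hy⟩ := hj
    refine le_iSup_of_le ?_ le_rfl
    have hlt : deg j < deg i := by
      by_contra hlt
      exact hy ((hW j).smul_eq_zero (idealLT_mono (not_lt.1 hlt) hs) y)
    rintro (rfl | h2) <;> omega
  obtain ⟨ψ, hψ⟩ := exists_hom_of_stdIdeal (e := e) (deg := deg) (i := i)
    ((W.traceSum (degLE deg) i).mkQ w)
    (fun r hr => by
      rw [← map_smul]
      exact (Submodule.Quotient.mk_eq_zero _).2 (hJw r hr))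
    (by rw [← map_smul, ← mul_smul, (h.complete.idem i).eq])
  have hψs : Function.Surjective ψ := by
    intro y
    obtain ⟨z, rfl⟩ := Submodule.mkQ_surjective _ y
    have hs : Function.Surjective (LinearMap.toSpanSingleton R (W.P i) w) := by
      refine W.surjective_of_comp _ ?_
      have hx' : W.π i w ≠ 0 := by rwa [map_smul]
      convert IsSimpleModule.toSpanSingleton_surjective R hx' using 1
      ext r; simp
    obtain ⟨r, rfl⟩ := hs z
    exact ⟨_, hψ r⟩
  have hinj := IsNoetherian.injective_of_surjective_endomorphism (G' ∘ₗ ψ) (hG'.comp hψs)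
  exact ⟨LinearEquiv.ofBijective ψ ⟨Function.Injective.of_comp hinj, hψs⟩⟩

/-- If the raising subalgebra is semisimple, the standard modules are simple. -/
theorem IsTriangular.standard_simple (h : IsTriangular β γ e f g deg) {W : WeightSystem R ι}
    (hW : ∀ i, IsTop e deg i (W.L i)) (hC : ∀ i j c, i ≠ j → g j * c * g i = 0) (i : ι) :
    Nonempty (W.standard (degLE deg) i ≃ₗ[R] W.L i) := by
  obtain ⟨ε⟩ := h.standard_equiv hW i
  have := W.simple i
  obtain ⟨x, hx⟩ := (hW i).1
  obtain ⟨φ, hφ⟩ := exists_hom_of_stdIdeal (e := e) (deg := deg) (i := i) (e i • x)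
    (fun r hr => (hW i).smul_eq_zero hr _) (by rw [← mul_smul, (h.complete.idem i).eq])
  have hφs : Function.Surjective φ := by
    intro y
    obtain ⟨r, rfl⟩ := IsSimpleModule.toSpanSingleton_surjective R hx y
    exact ⟨_, hφ r⟩
  refine ⟨ε.symm ≪≫ₗ LinearEquiv.ofBijective φ ⟨?_, hφs⟩⟩
  rw [injective_iff_map_eq_zero]
  intro y hy
  rw [← one_smul R y, ← h.complete.complete, Finset.sum_smul]
  refine Finset.sum_eq_zero fun j _ => ?_
  -- In the e_i-component a nonzero element of the kernel would generate everything. The other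
  -- components vanish, because the quotient is the image of C g_i and g_j C g_i = 0.
  by_cases hj : j = i
  · subst hj
    by_contra h0
    have h1 := h.eq_top_of_smul_ne_zero (N := LinearMap.ker φ) hy h0
    rw [LinearMap.ker_eq_top] at h1
    have h2 := hφ 1
    rw [h1, one_smul] at h2
    exact hx h2.symm
  · obtain ⟨r, rfl⟩ := Submodule.Quotient.mk_surjective _ y
    obtain ⟨w, hw, hr⟩ := h.exists_sub_mem i r
    rw [← Submodule.Quotient.mk_smul, Submodule.Quotient.mk_eq_zero, smul_eq_mul]
    have h1 : e j * γ w = 0 := by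
      rw [← h.map_g, ← hw, ← map_mul, ← mul_assoc, hC i j w (Ne.symm hj), map_zero]
    have h2 := Ideal.mul_mem_left _ (e j) (idealLT_le_stdIdeal i hr)
    rw [mul_sub, h1, sub_zero, ← mul_assoc] at h2
    have h3 := add_mem (sub_mul_mem_stdIdeal (e := e) (deg := deg) i (e j * r)) h2
    rwa [sub_add_cancel] at h3

/-- If the lowering subalgebra is semisimple, the standard modules are projective. -/
theorem IsTriangular.standard_projective (h : IsTriangular β γ e f g deg) {W : WeightSystem R ι}
    (hW : ∀ i, IsTop e deg i (W.L i)) (hB : ∀ i j b, i ≠ j → f j * b * f i = 0) (i : ι) :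
    Module.Projective R (W.standard (degLE deg) i) := by
  obtain ⟨ε⟩ := h.standard_equiv hW i
  -- Here B e_i = k e_i, and e_j C e_i = 0 whenever deg j < deg i, so e_j R e_i = 0. Thus right
  -- multiplication by e_i factors through the quotient and splits the projection from R.
  have key : ∀ r ∈ idealLT e deg (deg i), r • e i = 0 := by
    have hβ : ∀ b, β b * e i ∈ Submodule.span k {e i} := by
      intro b
      obtain ⟨a, ha⟩ := h.diag_B i b
      rw [Submodule.mem_span_singleton]
      refine ⟨a, ?_⟩
      calc a • e i = β (∑ j, f j * b * f i) := by
            rw [Finset.sum_eq_single i, ha, map_smul, h.map_f]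
            · intro j _ hj
              exact hB i j b (Ne.symm hj)
            · simp
        _ = β b * e i := by
            rw [← Finset.sum_mul, ← Finset.sum_mul, h.complete_f.complete, one_mul, map_mul,
              h.map_f]
    intro r hr
    refine Submodule.span_induction (p := fun r _ => r • e i = 0) ?_ (by simp)
      (fun x y _ _ hx hy => by rw [add_smul, hx, hy, add_zero])
      (fun a x _ hx => by rw [smul_assoc, hx, smul_zero]) hr
    rintro _ ⟨j, s, hj, rfl⟩
    have hs := h.span s
    induction hs using Submodule.span_induction with
    | mem s hs =>
      obtain ⟨c, b, rfl⟩ := hs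
      obtain ⟨a, ha⟩ := Submodule.mem_span_singleton.1 (hβ b)
      have h1 : e j * γ c * e i = 0 := by
        rw [← h.map_g, ← h.map_g, ← map_mul, ← map_mul]
        by_contra h0
        have := h.dir_C i j c (by rintro rfl; omega) fun h1 => h0 (by rw [h1, map_zero])
        omega
      rw [smul_eq_mul, mul_assoc, mul_assoc, ← ha, mul_smul_comm, mul_smul_comm, ← mul_assoc, h1,
        smul_zero]
    | zero => simp
    | add s t _ _ hs ht => rw [mul_add, add_smul, hs, ht, add_zero]
    | smul a s _ hs => rw [mul_smul_comm, smul_assoc, hs, smul_zero]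
  obtain ⟨φ, hφ⟩ := exists_hom_of_stdIdeal (e := e) (deg := deg) (i := i) (e i) key
    (h.complete.idem i).eq
  have : Module.Projective R (R ⧸ stdIdeal e deg i) := by
    refine Module.Projective.of_split φ (stdIdeal e deg i).mkQ ?_
    refine Submodule.linearMap_qext _ (LinearMap.ext fun r => ?_)
    change (stdIdeal e deg i).mkQ (φ (Submodule.Quotient.mk r)) = Submodule.Quotient.mk r
    rw [hφ, Submodule.mkQ_apply, eq_comm, Submodule.Quotient.eq]
    exact sub_mul_mem_stdIdeal i r
  exact Module.Projective.of_equiv ε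

end Triangular
end ReedyAlg

namespace ReedyAlg

variable {k : Type u} [Field k]

/-! ### Elements and homomorphisms of induced modules -/

section Induced

variable {R T : Type v} [Ring R] [Ring T] (φ : R →+* T)
  {M N : Type v} [AddCommGroup M] [Module R M] [AddCommGroup N] [Module R N]

/-- The element `t ⊗ m` of `T ⊗_R M`. -/
def Induced.tmul (t : T) (m : M) : Induced φ M := Submodule.Quotient.mk (t ⊗ₜ[ℤ] m)

theorem Induced.tmul_add (t : T) (m m' : M) :
    Induced.tmul φ t (m + m') = Induced.tmul φ t m + Induced.tmul φ t m' := by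
  rw [Induced.tmul, TensorProduct.tmul_add]; rfl

theorem Induced.add_tmul (t t' : T) (m : M) :
    Induced.tmul φ (t + t') m = Induced.tmul φ t m + Induced.tmul φ t' m := by
  rw [Induced.tmul, TensorProduct.add_tmul]; rfl

theorem Induced.tmul_zero (t : T) : Induced.tmul φ t (0 : M) = 0 := by
  rw [Induced.tmul, TensorProduct.tmul_zero]; rfl

theorem Induced.zero_tmul (m : M) : Induced.tmul φ 0 m = 0 := by
  rw [Induced.tmul, TensorProduct.zero_tmul]; rfl

theorem Induced.smul_tmul (s t : T) (m : M) :
    s • Induced.tmul φ t m = Induced.tmul φ (s * t) m := rfl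

theorem Induced.mul_tmul (t : T) (r : R) (m : M) :
    Induced.tmul φ (t * φ r) m = Induced.tmul φ t (r • m) :=
  (Submodule.Quotient.eq _).2 (Submodule.subset_span ⟨t, r, m, rfl⟩)

theorem Induced.map_tmul (f : M →ₗ[R] N) (t : T) (m : M) :
    Induced.map φ f (Induced.tmul φ t m) = Induced.tmul φ t (f m) := rfl

theorem Induced.sum_tmul {ι : Type*} (s : Finset ι) (t : ι → T) (m : M) :
    Induced.tmul φ (∑ i ∈ s, t i) m = ∑ i ∈ s, Induced.tmul φ (t i) m :=
  map_sum (⟨⟨fun t => Induced.tmul φ t m, Induced.zero_tmul φ m⟩,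
    fun t t' => Induced.add_tmul φ t t' m⟩ : T →+ Induced φ M) t s

theorem Induced.induction {p : Induced φ M → Prop} (tmul : ∀ t m, p (Induced.tmul φ t m))
    (add : ∀ x y, p x → p y → p (x + y)) (x : Induced φ M) : p x := by
  obtain ⟨x, rfl⟩ := Submodule.Quotient.mk_surjective _ x
  induction x using TensorProduct.induction_on with
  | zero => rw [← TensorProduct.tmul_zero M (0 : T)]; exact tmul 0 0
  | tmul t m => exact tmul t m
  | add x y hx hy => exact add _ _ hx hy

theorem Induced.exists_addHom {P : Type*} [AddCommGroup P] (F : T →+ M →+ P)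
    (hF : ∀ t r m, F (t * φ r) m = F t (r • m)) :
    ∃ G : Induced φ M →+ P, ∀ t m, G (Induced.tmul φ t m) = F t m := by
  let F' : T ⊗[ℤ] M →+ P := TensorProduct.liftAddHom F (fun n t m => by
    rw [map_zsmul, map_zsmul, AddMonoidHom.coe_smul, Pi.smul_apply])
  -- The relations are closed under scalars from T while F' is only additive, so the vanishing is
  -- proved for all multiples at once.
  have hF' : ∀ z ∈ inducedRel φ M, ∀ s : T, F' (s • z) = 0 := by
    intro z hz
    induction hz using Submodule.span_induction with
    | mem z hz =>
      obtain ⟨t, r, m, rfl⟩ := hz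
      intro s
      rw [smul_sub, TensorProduct.smul_tmul', TensorProduct.smul_tmul', map_sub]
      change F (s * (t * φ r)) m - F (s * t) (r • m) = 0
      rw [← mul_assoc, hF, sub_self]
    | zero => simp
    | add x y _ _ hx hy => intro s; rw [smul_add, map_add, hx, hy, add_zero]
    | smul a x _ hx => intro s; rw [smul_smul]; exact hx _
  exact ⟨QuotientAddGroup.lift (inducedRel φ M).toAddSubgroup F'
    (fun z hz => by simpa using hF' z hz 1), fun t m => rfl⟩

theorem Induced.exists_lift {P : Type*} [AddCommGroup P] [Module T P] (F : M →+ P)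
    (hF : ∀ r m, F (r • m) = φ r • F m) :
    ∃ G : Induced φ M →ₗ[T] P, ∀ t m, G (Induced.tmul φ t m) = t • F m := by
  obtain ⟨G, hG⟩ := Induced.exists_addHom φ (M := M)
    (F := ⟨⟨fun t => ⟨⟨fun m => t • F m, by simp⟩, by simp⟩, by ext; simp⟩,
      fun t t' => by ext; simp [add_smul]⟩)
    (fun t r m => by simp [hF, mul_smul])
  refine ⟨⟨⟨G, map_add G⟩, fun t x => ?_⟩, hG⟩
  induction x using Induced.induction with
  | tmul s m =>
    change G (t • _) = t • G _
    rw [Induced.smul_tmul, hG, hG]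
    exact mul_smul t s (F m)
  | add x y hx hy =>
    change G (t • _) = t • G _
    rw [smul_add, map_add, map_add, smul_add]
    exact congrArg₂ _ hx hy

end Induced

/-! ### The lowering subalgebra is an exact Borel subalgebra -/

section Triangular

variable {R B : Type v} {C : Type*} [Ring R] [Ring B] [Ring C] [Algebra k R] [Algebra k B]
    [Algebra k C] {β : B →ₐ[k] R} {γ : C →ₐ[k] R} {ι : Type} [Fintype ι]
    {e : ι → R} {f : ι → B} {g : ι → C} {deg : ι → ℕ}
    [DecidableEq ι] [FiniteDimensional k R] [FiniteDimensional k B] [FiniteDimensional k C]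

/-- The dual basis identifies R ⊗_B N with the direct sum of the f_{p x} N. Exactness can be checked
in each summand, the functional y x extracting the component. -/
theorem IsTriangular.exact (h : IsTriangular β γ e f g deg) {M N K : Type v}
    [AddCommGroup M] [Module B M] [AddCommGroup N] [Module B N] [AddCommGroup K] [Module B K]
    (F : M →ₗ[B] N) (G : N →ₗ[B] K) (hFG : Function.Exact F G) :
    Function.Exact (Induced.map (β : B →+* R) F) (Induced.map (β : B →+* R) G) := by
  obtain ⟨X, _, _, p, c, y, D⟩ := h.exists_isDualBasis
  have hsum : ∀ z : Induced (β : B →+* R) N, ∃ n : X → N, (∀ x, f (p x) • n x = n x) ∧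
      z = ∑ x, Induced.tmul (β : B →+* R) (γ (c x)) (n x) := by
    intro z
    induction z using Induced.induction with
    | tmul t m =>
      refine ⟨fun x => y x t • m, fun x => by rw [← mul_smul, D.mul_y], ?_⟩
      conv_lhs => rw [D.sum t, Induced.sum_tmul]
      exact Finset.sum_congr rfl fun x _ => Induced.mul_tmul (β : B →+* R) _ _ _
    | add x y hx hy =>
      obtain ⟨n, hn, rfl⟩ := hx
      obtain ⟨n', hn', rfl⟩ := hy
      refine ⟨n + n', fun x => by rw [Pi.add_apply, smul_add, hn, hn'], ?_⟩
      simp only [Pi.add_apply, Induced.tmul_add, Finset.sum_add_distrib]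
  have hyc : ∀ x x', y x (γ (c x')) = if x = x' then f (p x') else 0 := by
    intro x x'
    rw [← D.y_c x x' (f (p x')) (h.complete_f.idem _).eq, h.map_f, ← h.map_g, ← map_mul, D.c_mul]
  intro z
  constructor
  · intro hz
    obtain ⟨n, hn, rfl⟩ := hsum z
    have hGn : ∀ x, G (n x) = 0 := by
      intro x
      obtain ⟨H, hH⟩ := Induced.exists_addHom (β : B →+* R) (M := K)
        (F := ⟨⟨fun t => ⟨⟨fun m => y x t • m, by simp⟩, by simp⟩, by ext; simp⟩,
          fun t t' => by ext; simp [add_smul]⟩)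
        (fun t r m => by
          change y x (t * β r) • m = y x t • r • m
          rw [D.y_mul, mul_smul])
      have h1 := congrArg H hz
      rw [map_sum, map_sum, map_zero, Finset.sum_eq_single x] at h1
      · rw [Induced.map_tmul, hH] at h1
        change y x (γ (c x)) • G (n x) = 0 at h1
        rwa [hyc, if_pos rfl, ← map_smul, hn] at h1
      · intro x' _ hx'
        rw [Induced.map_tmul, hH]
        change y x (γ (c x')) • G (n x') = 0
        rw [hyc, if_neg (Ne.symm hx'), zero_smul]
      · simp
    choose m hm using fun x => (hFG (n x)).1 (hGn x)
    refine ⟨∑ x, Induced.tmul (β : B →+* R) (γ (c x)) (m x), ?_⟩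
    rw [map_sum]
    exact Finset.sum_congr rfl fun x _ => by rw [Induced.map_tmul, hm]
  · rintro ⟨w, rfl⟩
    induction w using Induced.induction with
    | tmul t m => rw [Induced.map_tmul, Induced.map_tmul, hFG.apply_apply_eq_zero,
        Induced.tmul_zero]
    | add x y hx hy => rw [map_add, map_add, hx, hy, add_zero]

/-- The mutually inverse maps exchange 1 ⊗ v with the class of 1, where v = f_i v generates L. If b
v = 0, the corner f_i b f_i is zero and the other f_j b f_i have lower degree, so β(b) lies in the
left ideal. Conversely, if deg j < deg i, then e_j γ(c) e_a ≠ 0 only for deg a ≤ deg j, and f_a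
annihilates L. -/
theorem IsTriangular.induced_equiv (h : IsTriangular β γ e f g deg) {i : ι} (L : Type v)
    [AddCommGroup L] [Module B L] [IsSimpleModule B L] (hL : IsTop f deg i L) :
    Nonempty (Induced (β : B →+* R) L ≃ₗ[R] R ⧸ stdIdeal e deg i) := by
  obtain ⟨x, hx⟩ := hL.1
  set v := f i • x
  have hv : f i • v = v := by rw [← mul_smul, (h.complete_f.idem i).eq]
  have hgen : Function.Surjective (LinearMap.toSpanSingleton B L v) :=
    IsSimpleModule.toSpanSingleton_surjective B hx
  have hfv : ∀ j (y : L), deg j < deg i → f j • y = 0 := by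
    intro j y hj
    by_contra h0
    have := hL.2 j y (by rintro rfl; omega) h0
    omega
  let : Module B (R ⧸ stdIdeal e deg i) := Module.compHom _ (β : B →+* R)
  have hsmul : ∀ (b : B) (y : R ⧸ stdIdeal e deg i), b • y = β b • y := fun _ _ => rfl
  have hker : LinearMap.ker (LinearMap.toSpanSingleton B L v) ≤ LinearMap.ker
      (LinearMap.toSpanSingleton B (R ⧸ stdIdeal e deg i) (Submodule.Quotient.mk 1)) := by
    intro b hb
    rw [LinearMap.mem_ker, LinearMap.toSpanSingleton_apply] at hb ⊢
    rw [hsmul, ← Submodule.Quotient.mk_smul, Submodule.Quotient.mk_eq_zero, smul_eq_mul, mul_one]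
    have h1 : β b * e i ∈ stdIdeal e deg i := by
      have h2 : β b * e i = ∑ j, β (f j * b * f i) := by
        rw [← map_sum, ← Finset.sum_mul, ← Finset.sum_mul, h.complete_f.complete, one_mul,
          map_mul, h.map_f]
      rw [h2]
      refine sum_mem fun j _ => ?_
      by_cases hj : j = i
      · subst hj
        obtain ⟨a, ha⟩ := h.diag_B j b
        have h3 : (f j * b * f j) • v = 0 := by rw [mul_smul, mul_smul, hv, hb, smul_zero]
        rw [ha, Algebra.smul_def, mul_smul, hv] at h3
        rw [ha, smul_algebraMap_eq_zero hx h3, zero_smul, map_zero]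
        exact zero_mem _
      · by_cases h0 : f j * b * f i = 0
        · rw [h0, map_zero]; exact zero_mem _
        · refine idealLT_le_stdIdeal i ?_
          rw [mul_assoc, map_mul, h.map_f]
          exact mul_mem_idealLT (h.dir_B i j b (Ne.symm hj) h0) _
    have h2 := add_mem (sub_mul_mem_stdIdeal (e := e) (deg := deg) i (β b)) h1
    rwa [sub_add_cancel] at h2
  let ψ : L →ₗ[B] R ⧸ stdIdeal e deg i :=
    (LinearMap.ker (LinearMap.toSpanSingleton B L v)).liftQ _ hker ∘ₗ
      ((LinearMap.toSpanSingleton B L v).quotKerEquivOfSurjective hgen).symm.toLinearMap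
  have hψ : ψ v = Submodule.Quotient.mk 1 := by
    have : ((LinearMap.toSpanSingleton B L v).quotKerEquivOfSurjective hgen).symm v =
        Submodule.Quotient.mk 1 := by
      rw [LinearEquiv.symm_apply_eq]
      simp
    change (LinearMap.ker (LinearMap.toSpanSingleton B L v)).liftQ _ hker
      (((LinearMap.toSpanSingleton B L v).quotKerEquivOfSurjective hgen).symm v) = _
    rw [this]
    change (1 : B) • (Submodule.Quotient.mk 1 : R ⧸ stdIdeal e deg i) = _
    rw [one_smul]
  obtain ⟨Ψ, hΨ⟩ := Induced.exists_lift (β : B →+* R) ψ.toAddMonoidHom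
    (fun b y => ψ.map_smul b y)
  obtain ⟨Φ, hΦ⟩ := exists_hom_of_stdIdeal (e := e) (deg := deg) (i := i)
    (Induced.tmul (β : B →+* R) 1 v) (fun r hr => by
      refine Submodule.span_induction
        (p := fun r _ => r • Induced.tmul (β : B →+* R) 1 v = 0) ?_ (by simp)
        (fun x y _ _ hx hy => by rw [add_smul, hx, hy, add_zero])
        (fun a x _ hx => by rw [smul_eq_mul, mul_smul, hx, smul_zero]) hr
      rintro _ ⟨j, s, hj, rfl⟩
      have hs := h.span s
      induction hs using Submodule.span_induction with
      | mem s hs =>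
        obtain ⟨c, b, rfl⟩ := hs
        have h1 : e j * (γ c * β b) = ∑ a, e j * γ c * e a * β b := by
          rw [← Finset.sum_mul, ← Finset.mul_sum, h.complete.complete, mul_one, mul_assoc]
        rw [h1, Finset.sum_smul]
        refine Finset.sum_eq_zero fun a _ => ?_
        by_cases h0 : g j * c * g a = 0
        · have h2 : e j * γ c * e a = 0 := by
            rw [← h.map_g, ← h.map_g, ← map_mul, ← map_mul, h0, map_zero]
          rw [h2, zero_mul, zero_smul]
        · have ha : deg a < deg i := by
            by_cases haj : a = j
            · rwa [haj]
            · exact (h.dir_C a j c haj h0).trans hj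
          rw [Induced.smul_tmul, mul_one, mul_assoc, ← h.map_f a, ← map_mul]
          refine (Induced.mul_tmul (β : B →+* R) _ _ _).trans ?_
          rw [mul_smul, hfv a _ ha, Induced.tmul_zero]
      | zero => simp
      | add s t _ _ hs ht => rw [mul_add, add_smul, hs, ht, add_zero]
      | smul a s _ hs =>
        rw [mul_smul_comm, Algebra.smul_def, mul_smul, hs, smul_zero])
    (by
      rw [Induced.smul_tmul, mul_one, ← h.map_f, ← one_mul (β (f i))]
      refine (Induced.mul_tmul (β : B →+* R) _ _ _).trans ?_
      rw [hv])
  refine ⟨LinearEquiv.ofLinearMap Ψ Φ ?_ ?_⟩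
  · refine Submodule.linearMap_qext _ (LinearMap.ext fun r => ?_)
    change Ψ (Φ (Submodule.Quotient.mk r)) = Submodule.Quotient.mk r
    rw [hΦ, Induced.smul_tmul, hΨ]
    change (r * 1) • ψ v = _
    rw [hψ, ← Submodule.Quotient.mk_smul, mul_one, smul_eq_mul, mul_one]
  · refine LinearMap.ext fun z => ?_
    rw [LinearMap.comp_apply, LinearMap.id_apply]
    induction z using Induced.induction with
    | tmul t m =>
      obtain ⟨b, rfl⟩ := hgen m
      rw [hΨ, map_smul]
      change t • Φ (ψ (b • v)) = _
      rw [map_smul, hψ, hsmul, ← Submodule.Quotient.mk_smul, hΦ, Induced.smul_tmul,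
        Induced.smul_tmul, smul_eq_mul, mul_one, mul_one]
      exact Induced.mul_tmul (β : B →+* R) _ _ _
    | add x y hx hy => rw [map_add, map_add, hx, hy]

/-- The lowering subalgebra is an exact Borel subalgebra. -/
theorem IsTriangular.isExactBorel (h : IsTriangular β γ e f g deg) {W : WeightSystem R ι}
    (hW : ∀ i, IsTop e deg i (W.L i)) {WB : WeightSystem B ι}
    (hWB : ∀ i, IsTop f deg i (WB.L i)) : IsExactBorel (β : B →+* R) W WB (degLE deg) where
  ambient := h.isQuasiHereditary hW
  injective := h.inj_β
  exact M N K _ _ _ F G hFG := h.exact F G hFG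
  induced_simple i := by
    have := WB.simple i
    obtain ⟨ε⟩ := h.induced_equiv (WB.L i) (hWB i)
    obtain ⟨ε'⟩ := h.standard_equiv hW i
    exact ⟨ε ≪≫ₗ ε'⟩
  quasiHereditary := h.left.isQuasiHereditary hWB
  standard_simple := h.left.standard_simple hWB fun i j c hij => by
    rw [single_mul_mul_single, if_neg hij]

end Triangular
end ReedyAlg

namespace ReedyAlg

variable {k : Type u} [Field k]

/-! ### Duality of simple modules -/

section Duality

variable {R : Type v} [Ring R] [Algebra k R]

/-- The functional on the opposite algebra given by a functional on `R`. -/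
def opFunctional (μ : R →ₗ[k] k) : Rᵐᵒᵖ →ₗ[k] k :=
  μ ∘ₗ (MulOpposite.opLinearEquiv k).symm.toLinearMap

theorem opFunctional_apply (μ : R →ₗ[k] k) (x : Rᵐᵒᵖ) : opFunctional μ x = μ x.unop := rfl

theorem IsCoeff.op {ι : Type*} {e : ι → R} {deg : ι → ℕ} {μ : ι → R →ₗ[k] k}
    (hμ : IsCoeff e deg μ) :
    IsCoeff (MulOpposite.op ∘ e) deg fun i => opFunctional (μ i) := by
  intro i r
  have := op_mem_idealLT (hμ i r.unop)
  simpa [opFunctional_apply, mul_assoc] using this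

/-- The two radicals of the form (a, r) ↦ μ(a r) are the left ideals divided out on the two sides.
In finite dimension the induced pairing is perfect. -/
theorem isDualModule_radIdeal [FiniteDimensional k R] (μ : R →ₗ[k] k) :
    IsDualModule k R (R ⧸ radIdeal μ) (Rᵐᵒᵖ ⧸ radIdeal (opFunctional μ)) := by
  let F : Rᵐᵒᵖ →+ (R ⧸ radIdeal μ) →+ k :=
    { toFun := fun a => QuotientAddGroup.lift (radIdeal μ).toAddSubgroup
        (μ.toAddMonoidHom.comp (AddMonoidHom.mulLeft a.unop)) fun r hr => hr a.unop
      map_zero' := by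
        ext x
        obtain ⟨r, rfl⟩ := Submodule.Quotient.mk_surjective _ x
        change μ (0 * r) = 0
        rw [zero_mul, map_zero]
      map_add' := fun a b => by
        ext x
        obtain ⟨r, rfl⟩ := Submodule.Quotient.mk_surjective _ x
        change μ ((a.unop + b.unop) * r) = μ (a.unop * r) + μ (b.unop * r)
        rw [add_mul, map_add] }
  have hF : ∀ a r, F a (Submodule.Quotient.mk r) = μ (a.unop * r) := fun _ _ => rfl
  let p : (Rᵐᵒᵖ ⧸ radIdeal (opFunctional μ)) →+ (R ⧸ radIdeal μ) →+ k :=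
    QuotientAddGroup.lift (radIdeal (opFunctional μ)).toAddSubgroup F fun a ha => by
      ext x
      obtain ⟨r, rfl⟩ := Submodule.Quotient.mk_surjective _ x
      exact ha (MulOpposite.op r)
  have hp : ∀ a r, p (Submodule.Quotient.mk a) (Submodule.Quotient.mk r) = μ (a.unop * r) :=
    fun _ _ => rfl
  refine ⟨p, fun x a m => ?_, fun x r m => ?_, fun f hf => ?_⟩
  · obtain ⟨x, rfl⟩ := Submodule.Quotient.mk_surjective _ x
    obtain ⟨m, rfl⟩ := Submodule.Quotient.mk_surjective _ m
    rw [← Submodule.Quotient.mk_smul, hp, hp, smul_eq_mul, ← Algebra.smul_def, mul_smul_comm,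
      map_smul, smul_eq_mul]
  · obtain ⟨x, rfl⟩ := Submodule.Quotient.mk_surjective _ x
    obtain ⟨m, rfl⟩ := Submodule.Quotient.mk_surjective _ m
    rw [← Submodule.Quotient.mk_smul, ← Submodule.Quotient.mk_smul, hp, hp]
    simp [mul_assoc]
  · let Φ : R →ₗ[k] Module.Dual k R :=
      LinearMap.mk₂ k (fun a r => μ (a * r)) (fun a b r => by rw [add_mul, map_add])
        (fun c a r => by rw [smul_mul_assoc, map_smul]) (fun a r s => by rw [mul_add, map_add])
        (fun c a r => by rw [mul_smul_comm, map_smul])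
    let f' : Module.Dual k R :=
      { toFun := fun r => f (Submodule.Quotient.mk r)
        map_add' := fun r s => by rw [Submodule.Quotient.mk_add, map_add]
        map_smul' := fun c r => by
          rw [RingHom.id_apply, smul_eq_mul, ← hf, ← Submodule.Quotient.mk_smul, smul_eq_mul,
            Algebra.smul_def] }
    have hmem : f' ∈ LinearMap.range Φ := by
      rw [← Subspace.dualCoannihilator_dualAnnihilator_eq (W := LinearMap.range Φ),
        Submodule.mem_dualAnnihilator]
      intro r hr
      rw [Submodule.mem_dualCoannihilator] at hr
      have hr' : r ∈ radIdeal μ := fun a => hr (Φ a) ⟨a, rfl⟩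
      change f (Submodule.Quotient.mk r) = 0
      rw [(Submodule.Quotient.mk_eq_zero _).2 hr', map_zero]
    obtain ⟨a, ha⟩ := hmem
    refine ⟨Submodule.Quotient.mk (MulOpposite.op a), ?_, fun y hy => ?_⟩
    · ext m
      obtain ⟨m, rfl⟩ := Submodule.Quotient.mk_surjective _ m
      exact LinearMap.congr_fun ha m
    · obtain ⟨y, rfl⟩ := Submodule.Quotient.mk_surjective _ y
      refine (Submodule.Quotient.eq _).2 fun b => ?_
      rw [opFunctional_apply, MulOpposite.unop_mul, MulOpposite.unop_sub, sub_mul, map_sub,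
        sub_eq_zero]
      exact (DFunLike.congr_fun hy (Submodule.Quotient.mk b.unop)).trans
        (LinearMap.congr_fun ha b.unop).symm

end Duality

/-! ### Directed algebras are split -/

section Directed

variable {R : Type*} [Ring R] [Algebra k R] {ι : Type*} [Fintype ι] [DecidableEq ι] {f : ι → R}
  {deg : ι → ℕ}

/-- With zero diagonal corners each factor x changes the degree by at least one, so powers beyond
the largest degree vanish. -/
theorem isNilpotent_of_directed (hf : CompleteOrthogonalIdempotents f)
    (dir : ∀ i j b, i ≠ j → f j * b * f i ≠ 0 → deg j < deg i) {x : R}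
    (hx : ∀ i, f i * x * f i = 0) : IsNilpotent x := by
  have key : ∀ p i j, f j * x ^ p * f i ≠ 0 → deg j + p ≤ deg i := by
    intro p
    induction p with
    | zero =>
      intro i j h
      by_cases hij : i = j
      · simp [hij]
      · exact (dir i j _ hij h).le
    | succ p ih =>
      intro i j h
      have h1 : f j * x ^ (p + 1) * f i = ∑ l, f j * x * f l * (f l * x ^ p * f i) := by
        have h2 : ∀ l, f j * x * f l * (f l * x ^ p * f i) = f j * x * f l * (x ^ p * f i) := by
          intro l
          rw [mul_assoc (f l), ← mul_assoc _ (f l), mul_assoc (f j * x) (f l), (hf.idem l).eq]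
        rw [Finset.sum_congr rfl fun l _ => h2 l, ← Finset.sum_mul, ← Finset.mul_sum, hf.complete,
          mul_one, pow_succ']
        simp only [mul_assoc]
      rw [h1] at h
      obtain ⟨l, -, hl⟩ := Finset.exists_ne_zero_of_sum_ne_zero h
      have hl1 : l ≠ j := by
        rintro rfl
        exact hl (by rw [hx, zero_mul])
      have := dir l j x hl1 fun h0 => hl (by rw [h0, zero_mul])
      have := ih i l fun h0 => hl (by rw [h0, mul_zero])
      omega
  refine ⟨Finset.univ.sup deg + 1, ?_⟩
  have h1 : ∀ y : R, y = ∑ j, ∑ i, f j * y * f i := by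
    intro y
    simp only [← Finset.mul_sum, ← Finset.sum_mul, hf.complete, mul_one, one_mul]
  rw [h1 (x ^ _)]
  refine Finset.sum_eq_zero fun j _ => Finset.sum_eq_zero fun i _ => ?_
  by_contra h0
  have := key _ i j h0
  have := Finset.le_sup (f := deg) (Finset.mem_univ i)
  omega

/-- The diagonal coefficients are multiplicative: a path from i to i through some j ≠ i would have
to lower the degree twice. -/
theorem exists_isSplit_of_directed (hf : CompleteOrthogonalIdempotents f) (hne : ∀ i, f i ≠ 0)
    (diag : ∀ i b, ∃ a : k, f i * b * f i = a • f i)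
    (dir : ∀ i j b, i ≠ j → f j * b * f i ≠ 0 → deg j < deg i) :
    ∃ q : R →ₐ[k] (ι → k), IsSplit q f ∧ ∀ i b, f i * b * f i = q b i • f i := by
  choose a ha using diag
  have inj : ∀ i {c d : k}, c • f i = d • f i → c = d := fun i _ _ h =>
    smul_left_injective k (hne i) h
  have a_eq : ∀ i b c, f i * b * f i = c • f i → a i b = c := fun i b c h =>
    inj i ((ha i b).symm.trans h)
  have a_mul : ∀ i x y, a i (x * y) = a i x * a i y := by
    intro i x y
    refine a_eq i _ _ ?_
    have h1 : f i * (x * y) * f i = ∑ j, f i * x * f j * y * f i := by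
      rw [← Finset.sum_mul, ← Finset.sum_mul, ← Finset.mul_sum, hf.complete, mul_one,
        mul_assoc (f i) x]
    rw [h1, Finset.sum_eq_single i, ha, smul_mul_assoc, smul_mul_assoc, ha, smul_smul]
    · intro j _ hj
      by_contra h0
      have h2 := dir j i x hj fun h => h0 (by rw [h, zero_mul, zero_mul])
      have h3 := dir i j y (Ne.symm hj) fun h => h0 (by
        rw [← (hf.idem j).eq, ← mul_assoc, mul_assoc (f i * x * f j), mul_assoc _ _ (f i), h,
          mul_zero])
      omega
    · simp
  let q : R →ₐ[k] (ι → k) := AlgHom.ofLinearMap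
    { toFun := fun b i => a i b
      map_add' := fun x y => funext fun i => a_eq i _ _ (by
        rw [mul_add, add_mul, ha, ha, Pi.add_apply, add_smul])
      map_smul' := fun c x => funext fun i => a_eq i _ _ (by
        rw [mul_smul_comm, smul_mul_assoc, ha, smul_smul]; rfl) }
    (funext fun i => a_eq i _ _ (by rw [mul_one, (hf.idem i).eq, Pi.one_apply, one_smul]))
    (fun x y => funext fun i => a_mul i x y)
  refine ⟨q, IsSplit.of_nil hf (fun i => funext fun j => a_eq j _ _ ?_) (fun x hx => ?_), ha⟩
  · rw [hf.mul_eq, ite_mul, zero_mul, hf.mul_eq, Pi.single_apply, ite_smul, one_smul, zero_smul]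
    by_cases hij : j = i
    · simp [hij]
    · simp [hij]
  · refine isNilpotent_of_directed hf dir fun i => ?_
    have : a i x = 0 := congrFun hx i
    rw [ha, this, zero_smul]

end Directed

/-! ### Splittings of the two subalgebras and endomorphisms of simple modules -/

section Triangular

variable {R : Type v} {B C : Type*} [Ring R] [Ring B] [Ring C] [Algebra k R] [Algebra k B]
    [Algebra k C] {β : B →ₐ[k] R} {γ : C →ₐ[k] R} {ι : Type} [Fintype ι]
    {e : ι → R} {f : ι → B} {g : ι → C} {deg : ι → ℕ} [DecidableEq ι]

theorem IsTriangular.exists_isSplit_left (h : IsTriangular β γ e f g deg) :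
    ∃ q : B →ₐ[k] (ι → k), IsSplit q f ∧ ∀ i b, f i * b * f i = q b i • f i :=
  exists_isSplit_of_directed h.complete_f h.f_ne_zero h.diag_B h.dir_B

theorem IsTriangular.exists_isSplit_right (h : IsTriangular β γ e f g deg) :
    ∃ q : C →ₐ[k] (ι → k), IsSplit q g ∧ ∀ i b, g i * b * g i = q b i • g i := by
  -- C raises the degree, so it lowers the complementary degree.
  refine exists_isSplit_of_directed (deg := fun i => Finset.univ.sup deg - deg i) h.complete_g
    h.g_ne_zero h.diag_C fun i j c hij h0 => ?_
  have := h.dir_C i j c hij h0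
  have := Finset.le_sup (f := deg) (Finset.mem_univ j)
  omega

theorem IsCoeff.end_eq_smul {μ : ι → R →ₗ[k] k} (hμ : IsCoeff e deg μ)
    (he : ∀ i, e i * e i = e i) {i : ι} {L : Type*} [AddCommGroup L] [Module R L]
    [IsSimpleModule R L] (hL : IsTop e deg i L) (F : L →ₗ[R] L) :
    ∃ a : k, ∀ x, F x = algebraMap k R a • x := by
  obtain ⟨x, hx⟩ := hL.1
  have hsurj := IsSimpleModule.toSpanSingleton_surjective R hx
  have hev : e i • e i • x = e i • x := by rw [← mul_smul, he]
  obtain ⟨r, hr⟩ := hsurj (F (e i • x))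
  rw [LinearMap.toSpanSingleton_apply] at hr
  have hFv : F (e i • x) = algebraMap k R (μ i r) • e i • x := by
    have h1 : F (e i • x) = (e i * r * e i) • e i • x := by
      rw [mul_smul, hev, mul_smul, hr, ← map_smul, hev]
    have h2 := hL.smul_eq_zero (hμ i r) (e i • x)
    rw [sub_smul, sub_eq_zero] at h2
    rw [h1, h2, Algebra.smul_def, mul_smul, hev]
  refine ⟨μ i r, fun y => ?_⟩
  obtain ⟨s, rfl⟩ := hsurj y
  rw [LinearMap.toSpanSingleton_apply, map_smul, hFv, smul_smul s, smul_smul _ s (e i • x),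
    Algebra.commutes]

end Triangular

/-! ### One-dimensional modules and their restrictions -/

section Acts

variable {R : Type*} [Ring R] [Algebra k R] {ι : Type} [Fintype ι] [DecidableEq ι]
  {q : R →ₐ[k] (ι → k)} {e : ι → R} {M : Type*} [AddCommGroup M] [Module R M]

theorem ActsBy.exists_addEquiv [FiniteDimensional k R] [IsSimpleModule R M] {i : ι} (hM : ActsBy q i M) :
    ∃ F : k ≃+ M, ∀ a b, F (a * b) = algebraMap k R a • F b := by
  have := IsSimpleModule.nontrivial R M
  obtain ⟨v, hv⟩ := exists_ne (0 : M)
  have hsurj := IsSimpleModule.toSpanSingleton_surjective R hv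
  refine ⟨AddEquiv.ofBijective (⟨⟨fun a => algebraMap k R a • v, by simp⟩,
    fun a b => by simp [add_smul]⟩ : k →+ M) ⟨?_, fun y => ?_⟩, fun a b => ?_⟩
  · refine (injective_iff_map_eq_zero _).2 fun a ha => ?_
    have := (hM.ker_toSpanSingleton hv _).1 ha
    simpa using this
  · obtain ⟨r, rfl⟩ := hsurj y
    exact ⟨q r i, (hM r v).symm⟩
  · change algebraMap k R (a * b) • v = algebraMap k R a • algebraMap k R b • v
    rw [map_mul, mul_smul]

theorem ActsBy.of_isTop {deg : ι → ℕ} (h : IsSplit q e) {i j : ι} (hM : ActsBy q j M)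
    (hi : IsTop e deg i M) : i = j := by
  obtain ⟨x, hx⟩ := hi.1
  by_contra hij
  refine hx ?_
  rw [hM (e i) x, h.q_e, Pi.single_apply, if_neg (Ne.symm hij), map_zero, zero_smul]

theorem ActsBy.restrictionsIso {A : Type v} [Ring A] [Algebra k A] [FiniteDimensional k A] {B C : Subalgebra k A}
    {qB : B →ₐ[k] (ι → k)} {qC : C →ₐ[k] (ι → k)} {i : ι}
    (hq : ∀ (s : A) (hB : s ∈ B) (hC : s ∈ C), qB ⟨s, hB⟩ i = qC ⟨s, hC⟩ i)
    {M N : Type v} [AddCommGroup M] [Module B M] [IsSimpleModule B M] [AddCommGroup N]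
    [Module C N] [IsSimpleModule C N] (hM : ActsBy qB i M) (hN : ActsBy qC i N) :
    RestrictionsIso B C M N := by
  obtain ⟨F, hF⟩ := hM.exists_addEquiv
  obtain ⟨G, hG⟩ := hN.exists_addEquiv
  refine ⟨F.symm.trans G, fun s hB hC m => ?_⟩
  obtain ⟨a, rfl⟩ := F.surjective m
  rw [AddEquiv.trans_apply, AddEquiv.trans_apply, hM, hN, ← hF, ← hq s hB hC,
    F.symm_apply_apply, F.symm_apply_apply, hG]

end Acts

end ReedyAlg

namespace ReedyAlg

/-! ### From a triangular decomposition to conditions (ii) and (iii) -/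

variable {k : Type u} [Field k] {A : Type v} [Ring A] [Algebra k A] [FiniteDimensional k A]
  {B C : Subalgebra k A} {ι : Type} [Fintype ι] [DecidableEq ι] {e : ι → A} {f : ι → B}
  {g : ι → C} {deg : ι → ℕ}

/-- An off-diagonal component of an element of B ∩ C would both lower and raise the degree. -/
theorem IsTriangular.eq_sum_of_mem (h : IsTriangular B.val C.val e f g deg)
    {qB : B →ₐ[k] (ι → k)} (hB : ∀ i b, f i * b * f i = qB b i • f i)
    {s : A} (hsB : s ∈ B) (hsC : s ∈ C) : s = ∑ i, qB ⟨s, hsB⟩ i • e i := by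
  have h1 : s = ∑ j, ∑ i, e j * s * e i := by
    simp only [← Finset.mul_sum, ← Finset.sum_mul, h.complete.complete, mul_one, one_mul]
  conv_lhs => rw [h1]
  refine Finset.sum_congr rfl fun j _ => ?_
  rw [Finset.sum_eq_single j]
  · have := congrArg Subtype.val (hB j ⟨s, hsB⟩)
    have hf : ∀ i, (f i : A) = e i := h.map_f
    simpa [hf] using this
  · intro i _ hij
    by_contra h0
    have h2 := h.dir_B i j ⟨s, hsB⟩ hij fun h3 => h0 (by
      have := congrArg B.val h3
      rwa [map_mul, map_mul, h.map_f, h.map_f, map_zero] at this)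
    have h3 := h.dir_C i j ⟨s, hsC⟩ hij fun h3 => h0 (by
      have := congrArg C.val h3
      rwa [map_mul, map_mul, h.map_g, h.map_g, map_zero] at this)
    omega
  · simp

theorem IsTriangular.exists_isSplit (h : IsTriangular B.val C.val e f g deg) :
    ∃ (qB : B →ₐ[k] (ι → k)) (qC : C →ₐ[k] (ι → k)), IsSplit qB f ∧ IsSplit qC g ∧
      (∀ (s : A) (hB : s ∈ B) (_ : s ∈ C), s = ∑ i, qB ⟨s, hB⟩ i • e i) ∧
      ∀ (s : A) (hB : s ∈ B) (hC : s ∈ C), qB ⟨s, hB⟩ = qC ⟨s, hC⟩ := by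
  obtain ⟨qB, hqB, hB⟩ := h.exists_isSplit_left
  obtain ⟨qC, hqC, hC⟩ := h.exists_isSplit_right
  have hs := fun s hsB hsC => h.eq_sum_of_mem (s := s) hB hsB hsC
  refine ⟨qB, qC, hqB, hqC, hs, fun s hsB hsC => ?_⟩
  have h1 : (⟨s, hsC⟩ : C) = ∑ i, qB ⟨s, hsB⟩ i • g i := by
    refine Subtype.ext ((hs s hsB hsC).trans ?_)
    change _ = C.val (∑ i, qB ⟨s, hsB⟩ i • g i)
    simp only [map_sum, map_smul, h.map_g]
  rw [h1, map_sum]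
  ext j
  simp [hqC.q_e, Pi.single_apply]

theorem IsTriangular.isMaximalSemisimple (h : IsTriangular B.val C.val e f g deg) :
    IsMaximalSemisimple (B ⊓ C) B ∧ IsMaximalSemisimple (B ⊓ C) C := by
  obtain ⟨qB, qC, hqB, hqC, hs, hBC⟩ := h.exists_isSplit
  have hf : ∀ i, (f i : A) = e i := h.map_f
  have hg : ∀ i, (g i : A) = e i := h.map_g
  have hfC : ∀ i, (f i : A) ∈ C := fun i => by rw [hf, ← hg]; exact (g i).2
  have hgB : ∀ i, (g i : A) ∈ B := fun i => by rw [hg, ← hf]; exact (f i).2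
  refine ⟨hqB.isMaximalSemisimple inf_le_left (fun i => ⟨(f i).2, hfC i⟩) fun s hs' => ?_,
    hqC.isMaximalSemisimple inf_le_right (fun i => ⟨hgB i, (g i).2⟩) fun s hs' => ?_⟩
  · refine Subtype.ext ((hs s s.2 hs'.2).trans ?_)
    change _ = B.val (∑ i, qB s i • f i)
    simp only [map_sum, map_smul, h.map_f]
  · refine Subtype.ext ((hs s hs'.1 s.2).trans ?_)
    change _ = C.val (∑ i, qC s i • g i)
    simp only [map_sum, map_smul, h.map_g, hBC s hs'.1 s.2]

theorem IsTriangular.exists_weights (h : IsTriangular B.val C.val e f g deg) :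
    ∃ (WB : WeightSystem B ι) (WC : WeightSystem C ι) (le : ι → ι → Prop),
      (∀ i, RestrictionsIso B C (WB.L i) (WC.L i)) ∧ IsQuasiHereditary WB le ∧
      (∀ i, IsSimpleModule B (WB.standard le i)) ∧ IsQuasiHereditary WC le ∧
      ∀ i, Module.Projective C (WC.standard le i) := by
  obtain ⟨qB, qC, hqB, hqC, -, hBC⟩ := h.exists_isSplit
  obtain ⟨μ, hμ⟩ := h.left.exists_coeff
  obtain ⟨ν, hν⟩ := h.right.exists_coeff
  obtain ⟨WB, -, hWB⟩ := IsCoeff.exists_weightSystem h.left hμ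
  obtain ⟨WC, -, hWC⟩ := IsCoeff.exists_weightSystem h.right hν
  refine ⟨WB, WC, degLE deg, fun i => ?_, h.left.isQuasiHereditary hWB, fun i => ?_,
    h.right.isQuasiHereditary hWC, fun i => ?_⟩
  · have := WB.simple i
    have := WC.simple i
    obtain ⟨a, ha⟩ := hqB.exists_actsBy (WB.L i)
    obtain ⟨b, hb⟩ := hqC.exists_actsBy (WC.L i)
    obtain rfl := ha.of_isTop hqB (hWB i)
    obtain rfl := hb.of_isTop hqC (hWC i)
    exact ha.restrictionsIso (fun s hs hs' => by rw [hBC s hs hs']) hb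
  · obtain ⟨ε⟩ := h.left.standard_simple hWB (fun i j c hij => by
      rw [single_mul_mul_single, if_neg hij]) i
    have := WB.simple i
    exact IsSimpleModule.congr ε
  · exact h.right.standard_projective hWC (fun i j c hij => by
      rw [single_mul_mul_single, if_neg hij]) i

/-- The simple modules of the opposite algebras are built from the same functionals as those of A
and C. They are then dual weight by weight, and the opposite decomposition makes the opposite of C
the lowering subalgebra. -/
theorem IsTriangular.exists_borel (h : IsTriangular B.val C.val e f g deg) :
    ∃ (WA : WeightSystem A ι) (WB : WeightSystem B ι) (WC : WeightSystem C ι)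
      (le : ι → ι → Prop),
      (∀ i (f : WA.L i →ₗ[A] WA.L i), ∃ a : k, ∀ x, f x = algebraMap k A a • x) ∧
      IsQuasiHereditary WA le ∧ IsExactBorel (B.val : B →+* A) WA WB le ∧
      IsDeltaSubalgebra k C WA WC le := by
  obtain ⟨μ, hμ⟩ := h.exists_coeff
  obtain ⟨μB, hμB⟩ := h.left.exists_coeff
  obtain ⟨μC, hμC⟩ := h.right.exists_coeff
  obtain ⟨WA, hWA, hA⟩ := IsCoeff.exists_weightSystem h hμ
  obtain ⟨WB, -, hB⟩ := IsCoeff.exists_weightSystem h.left hμB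
  obtain ⟨WC, hWC, -⟩ := IsCoeff.exists_weightSystem h.right hμC
  obtain ⟨WA', hWA', hA'⟩ := IsCoeff.exists_weightSystem h.op (IsCoeff.op hμ)
  obtain ⟨WC', hWC', hC'⟩ := IsCoeff.exists_weightSystem h.right.op (IsCoeff.op hμC)
  refine ⟨WA, WB, WC, degLE deg, fun i F => ?_, h.isQuasiHereditary hA, h.isExactBorel hA hB,
    WA', WC', fun i => ?_, fun i => ?_, h.op.isExactBorel hA' hC'⟩
  · have := WA.simple i
    exact IsCoeff.end_eq_smul hμ (fun i => (h.complete.idem i).eq) (hA i) F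
  · rw [hWA, hWA']
    exact isDualModule_radIdeal (μ i)
  · rw [hWC, hWC']
    exact isDualModule_radIdeal (μC i)

end ReedyAlg

namespace ReedyAlg

/-! ### Dimensions of Peirce components -/

variable {k : Type u} [Field k]

theorem finrank_eq_sum_map {V : Type*} [AddCommGroup V] [Module k V] [FiniteDimensional k V]
    {ι : Type*} [Fintype ι] {p : ι → V →ₗ[k] V} (sum : ∀ x, ∑ i, p i x = x)
    (idem : ∀ i x, p i (p i x) = p i x) (ortho : ∀ i j x, i ≠ j → p i (p j x) = 0)
    (U : Submodule k V) (hU : ∀ i, ∀ x ∈ U, p i x ∈ U) :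
    Module.finrank k U = ∑ i, Module.finrank k (U.map (p i)) := by
  classical
  rw [← Module.finrank_pi_fintype]
  refine LinearEquiv.finrank_eq (LinearEquiv.ofBijective
    (LinearMap.pi fun i => (p i).submoduleMap U) ⟨?_, ?_⟩)
  · rw [injective_iff_map_eq_zero]
    intro x hx
    refine Subtype.ext ((sum x).symm.trans ?_)
    exact Finset.sum_eq_zero fun i _ => congrArg Subtype.val (congrFun hx i)
  · intro y
    have hy : ∀ i, (y i : V) ∈ U := fun i => by
      obtain ⟨z, hz, hz'⟩ := (y i).2
      rw [← hz']
      exact hU i z hz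
    refine ⟨⟨∑ i, (y i : V), sum_mem fun i _ => hy i⟩, ?_⟩
    ext i
    change p i (∑ j, (y j : V)) = y i
    rw [map_sum, Finset.sum_eq_single i]
    · obtain ⟨z, -, hz⟩ := (y i).2
      rw [← hz, idem]
    · intro j _ hj
      obtain ⟨z, -, hz⟩ := (y j).2
      rw [← hz, ortho i j z (Ne.symm hj)]
    · simp

section Peirce

variable {A : Type v} [Ring A] [Algebra k A] [FiniteDimensional k A] {ι : Type} [Fintype ι]
  {e : ι → A}

theorem finrank_eq_sum_map_mulLeft (he : CompleteOrthogonalIdempotents e) (U : Submodule k A)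
    (hU : ∀ i, ∀ x ∈ U, e i * x ∈ U) :
    Module.finrank k U = ∑ i, Module.finrank k (U.map (LinearMap.mulLeft k (e i))) := by
  refine finrank_eq_sum_map (fun x => ?_) (fun i x => ?_) (fun i j x hij => ?_) U hU
  · simp only [LinearMap.mulLeft_apply, ← Finset.sum_mul, he.complete, one_mul]
  · rw [LinearMap.mulLeft_apply, LinearMap.mulLeft_apply, ← mul_assoc, (he.idem i).eq]
  · rw [LinearMap.mulLeft_apply, LinearMap.mulLeft_apply, ← mul_assoc, he.ortho hij, zero_mul]

theorem finrank_eq_sum_map_mulRight (he : CompleteOrthogonalIdempotents e) (U : Submodule k A)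
    (hU : ∀ i, ∀ x ∈ U, x * e i ∈ U) :
    Module.finrank k U = ∑ i, Module.finrank k (U.map (LinearMap.mulRight k (e i))) := by
  refine finrank_eq_sum_map (fun x => ?_) (fun i x => ?_) (fun i j x hij => ?_) U hU
  · simp only [LinearMap.mulRight_apply, ← Finset.mul_sum, he.complete, mul_one]
  · rw [LinearMap.mulRight_apply, LinearMap.mulRight_apply, mul_assoc, (he.idem i).eq]
  · rw [LinearMap.mulRight_apply, LinearMap.mulRight_apply, mul_assoc, he.ortho (Ne.symm hij),
      mul_zero]

theorem mem_peirce {D : Subalgebra k A} {a b x : A} :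
    x ∈ peirce D a b ↔ ∃ d ∈ D, a * d * b = x := by
  rw [peirce, Submodule.mem_map]
  rfl

theorem finrank_range_mulRight_eq_sum (he : CompleteOrthogonalIdempotents e) {D : Subalgebra k A}
    (hD : ∀ i, e i ∈ D) (d : D) :
    Module.finrank k (LinearMap.range (LinearMap.mulRight k d)) =
      ∑ j, Module.finrank k (peirce D (e j) d) := by
  have h1 : (LinearMap.range (LinearMap.mulRight k d)).map D.val.toLinearMap =
      (Subalgebra.toSubmodule D).map (LinearMap.mulRight k (d : A)) := by
    ext x
    constructor
    · rintro ⟨_, ⟨c, rfl⟩, rfl⟩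
      exact ⟨c, c.2, rfl⟩
    · rintro ⟨c, hc, rfl⟩
      exact ⟨_, ⟨⟨c, hc⟩, rfl⟩, rfl⟩
  have h2 := (Submodule.equivMapOfInjective D.val.toLinearMap Subtype.val_injective
    (LinearMap.range (LinearMap.mulRight k d))).finrank_eq
  rw [h2, h1, finrank_eq_sum_map_mulLeft he]
  · refine Finset.sum_congr rfl fun j _ => ?_
    suffices hs : ((Subalgebra.toSubmodule D).map (LinearMap.mulRight k (d : A))).map
        (LinearMap.mulLeft k (e j)) = peirce D (e j) d by rw [hs]
    ext x
    simp only [Submodule.mem_map, mem_peirce, exists_exists_and_eq_and, mul_assoc,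
      LinearMap.mulRight_apply, LinearMap.mulLeft_apply, Subalgebra.mem_toSubmodule]
  · rintro i _ ⟨c, hc, rfl⟩
    exact ⟨e i * c, D.mul_mem (hD i) hc, mul_assoc _ _ _⟩

theorem finrank_range_mulLeft_eq_sum (he : CompleteOrthogonalIdempotents e) {D : Subalgebra k A}
    (hD : ∀ i, e i ∈ D) (d : D) :
    Module.finrank k (LinearMap.range (LinearMap.mulLeft k d)) =
      ∑ j, Module.finrank k (peirce D d (e j)) := by
  have h1 : (LinearMap.range (LinearMap.mulLeft k d)).map D.val.toLinearMap =
      (Subalgebra.toSubmodule D).map (LinearMap.mulLeft k (d : A)) := by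
    ext x
    constructor
    · rintro ⟨_, ⟨c, rfl⟩, rfl⟩
      exact ⟨c, c.2, rfl⟩
    · rintro ⟨c, hc, rfl⟩
      exact ⟨_, ⟨⟨c, hc⟩, rfl⟩, rfl⟩
  have h2 := (Submodule.equivMapOfInjective D.val.toLinearMap Subtype.val_injective
    (LinearMap.range (LinearMap.mulLeft k d))).finrank_eq
  rw [h2, h1, finrank_eq_sum_map_mulRight he]
  · refine Finset.sum_congr rfl fun j _ => ?_
    suffices hs : ((Subalgebra.toSubmodule D).map (LinearMap.mulLeft k (d : A))).map
        (LinearMap.mulRight k (e j)) = peirce D d (e j) by rw [hs]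
    ext x
    simp only [Submodule.mem_map, mem_peirce, exists_exists_and_eq_and,
      LinearMap.mulRight_apply, LinearMap.mulLeft_apply, Subalgebra.mem_toSubmodule]
  · rintro i _ ⟨c, hc, rfl⟩
    exact ⟨c * e i, D.mul_mem hc (hD i), (mul_assoc _ _ _).symm⟩

theorem finrank_eq_sum_peirce (he : CompleteOrthogonalIdempotents e) :
    Module.finrank k A = ∑ j, ∑ i, Module.finrank k (peirce (⊤ : Subalgebra k A) (e j) (e i)) := by
  rw [← finrank_top k A, finrank_eq_sum_map_mulLeft he ⊤ fun _ _ _ => trivial]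
  refine Finset.sum_congr rfl fun j _ => ?_
  rw [finrank_eq_sum_map_mulRight he]
  · refine Finset.sum_congr rfl fun i _ => ?_
    suffices hs : ((⊤ : Submodule k A).map (LinearMap.mulLeft k (e j))).map
        (LinearMap.mulRight k (e i)) = peirce (⊤ : Subalgebra k A) (e j) (e i) by rw [hs]
    ext x
    simp only [Submodule.mem_map, mem_peirce, exists_exists_eq_and,
      LinearMap.mulRight_apply, LinearMap.mulLeft_apply, Submodule.mem_top, Algebra.mem_top,
      true_and]
  · rintro i _ ⟨c, -, rfl⟩
    exact ⟨c * e i, trivial, (mul_assoc _ _ _).symm⟩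

end Peirce

/-! ### Reedy algebras and triangular decompositions -/

section Reedy

variable {A : Type v} [Ring A] [Algebra k A] [FiniteDimensional k A] {n : ℕ}
  {e : Fin (n + 1) → A} {B C : Subalgebra k A}

theorem finrank_reedyMul_source (j i : Fin (n + 1)) : Module.finrank k
    (DirectSum (Fin (n + 1)) fun l => peirce C (e j) (e l) ⊗[k] peirce B (e l) (e i)) =
      ∑ l, Module.finrank k (peirce C (e j) (e l)) * Module.finrank k (peirce B (e l) (e i)) := by
  rw [Module.finrank_directSum]
  simp only [Module.finrank_tensorProduct]

theorem reedyMul_of (j i l : Fin (n + 1)) (x : peirce C (e j) (e l)) (y : peirce B (e l) (e i)) :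
    reedyMul B C e j i (DirectSum.of (fun l => peirce C (e j) (e l) ⊗[k] peirce B (e l) (e i)) l
      (x ⊗ₜ y)) = x * y := by
  rw [reedyMul]
  exact (DirectSum.toModule_lof k l _).trans (Submodule.mulMap_tmul _ _ _ _)

theorem sum_finrank_source (he : CompleteOrthogonalIdempotents e) {f : Fin (n + 1) → B}
    {g : Fin (n + 1) → C} (hf : ∀ i, (f i : A) = e i) (hg : ∀ i, (g i : A) = e i) :
    ∑ j, ∑ i, ∑ l, Module.finrank k (peirce C (e j) (e l)) *
      Module.finrank k (peirce B (e l) (e i)) =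
    ∑ l, Module.finrank k (LinearMap.range (LinearMap.mulRight k (g l))) *
      Module.finrank k (LinearMap.range (LinearMap.mulLeft k (f l))) := by
  have hB : ∀ i, e i ∈ B := fun i => by rw [← hf]; exact (f i).2
  have hC : ∀ i, e i ∈ C := fun i => by rw [← hg]; exact (g i).2
  have h1 : ∀ j l, Module.finrank k (peirce C (e j) (g l)) =
      Module.finrank k (peirce C (e j) (e l)) := fun j l => by rw [hg]
  have h2 : ∀ l i, Module.finrank k (peirce B (f l) (e i)) =
      Module.finrank k (peirce B (e l) (e i)) := fun j l => by rw [hf]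
  simp only [finrank_range_mulRight_eq_sum he hC, finrank_range_mulLeft_eq_sum he hB,
    Finset.sum_mul_sum, h1, h2]
  refine (Finset.sum_congr rfl fun i _ => Finset.sum_comm).trans ?_
  rw [Finset.sum_comm]

theorem exists_smul_of_equiv {D : Subalgebra k A} {x : A} (hx : IsIdempotentElem x) (hxD : x ∈ D)
    (h : Nonempty (peirce D x x ≃ₗ[k] k)) :
    x ≠ 0 ∧ ∀ d ∈ D, ∃ a : k, x * d * x = a • x := by
  obtain ⟨ε⟩ := h
  have hx0 : x ≠ 0 := by
    rintro rfl
    obtain ⟨d, -, hd⟩ := mem_peirce.1 (ε.symm 1).2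
    have : ε.symm 1 = 0 := Subtype.ext (by rw [← hd]; simp)
    simp at this
  have hmem : x ∈ peirce D x x := mem_peirce.2 ⟨x, hxD, by rw [hx.eq, hx.eq]⟩
  refine ⟨hx0, fun d hd => ?_⟩
  have hε : ε ⟨x, hmem⟩ ≠ 0 := fun h0 => hx0 (congrArg Subtype.val
    ((map_eq_zero_iff ε ε.injective).1 h0))
  have hmem' : x * d * x ∈ peirce D x x := mem_peirce.2 ⟨d, hd, rfl⟩
  have h1 : (⟨_, hmem'⟩ : peirce D x x) = (ε ⟨_, hmem'⟩ * (ε ⟨x, hmem⟩)⁻¹) • ⟨x, hmem⟩ :=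
    ε.injective (by rw [map_smul, smul_eq_mul, inv_mul_cancel_right₀ hε])
  exact ⟨_, congrArg Subtype.val h1⟩

theorem peirce_equiv {D : Subalgebra k A} {x : A} (hx : IsIdempotentElem x) (hxD : x ∈ D)
    (hx0 : x ≠ 0) (h : ∀ d ∈ D, ∃ a : k, x * d * x = a • x) :
    Nonempty (peirce D x x ≃ₗ[k] k) := by
  have h1 : peirce D x x = Submodule.span k {x} := by
    ext y
    rw [mem_peirce, Submodule.mem_span_singleton]
    constructor
    · rintro ⟨d, hd, rfl⟩
      obtain ⟨a, ha⟩ := h d hd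
      exact ⟨a, ha.symm⟩
    · rintro ⟨a, rfl⟩
      exact ⟨a • x, D.smul_mem hxD a, by rw [mul_smul_comm, smul_mul_assoc, hx.eq, hx.eq]⟩
  rw [h1]
  exact ⟨(LinearEquiv.toSpanNonzeroSingleton k A x hx0).symm⟩

theorem IsReedy.exists_isTriangular (h : IsReedy B C) :
    ∃ (n : ℕ) (e : Fin (n + 1) → A) (f : Fin (n + 1) → B) (g : Fin (n + 1) → C)
      (deg : Fin (n + 1) → ℕ), IsTriangular B.val C.val e f g deg := by
  obtain ⟨n, e, deg, he, hmem, hC, hC', hB, hB', hmul⟩ := h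
  have hne : ∀ i, e i ≠ 0 := fun i => (exists_smul_of_equiv (he.idem i) (hmem i).2 (hC i)).1
  refine ⟨n, e, fun i => ⟨e i, (hmem i).1⟩, fun i => ⟨e i, (hmem i).2⟩, deg, he, fun _ => rfl,
    fun _ => rfl, Subtype.val_injective, Subtype.val_injective, hne, fun i b => ?_,
    fun i j b hij hb => hB' i j hij fun h0 => hb (Subtype.ext ?_), fun i c => ?_,
    fun i j c hij hc => hC' i j hij fun h0 => hc (Subtype.ext ?_), fun r => ?_, ?_⟩
  · obtain ⟨a, ha⟩ := (exists_smul_of_equiv (he.idem i) (hmem i).1 (hB i)).2 b b.2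
    exact ⟨a, Subtype.ext ha⟩
  · exact (Submodule.mem_bot k).1 (h0 ▸ mem_peirce.2 ⟨b, b.2, rfl⟩)
  · obtain ⟨a, ha⟩ := (exists_smul_of_equiv (he.idem i) (hmem i).2 (hC i)).2 c c.2
    exact ⟨a, Subtype.ext ha⟩
  · exact (Submodule.mem_bot k).1 (h0 ▸ mem_peirce.2 ⟨c, c.2, rfl⟩)
  · have h1 : r = ∑ j, ∑ i, e j * r * e i := by
      simp only [← Finset.mul_sum, ← Finset.sum_mul, he.complete, mul_one, one_mul]
    rw [h1]
    refine sum_mem fun j _ => sum_mem fun i _ => ?_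
    have h2 : e j * r * e i ∈ peirce (⊤ : Subalgebra k A) (e j) (e i) := mem_peirce.2 ⟨r, Algebra.mem_top, rfl⟩
    rw [← (hmul i j).2] at h2
    obtain ⟨z, hz⟩ := h2
    rw [← hz]
    clear hz
    induction z using DirectSum.induction_on with
    | zero => rw [map_zero]; exact zero_mem _
    | of l z =>
      induction z using TensorProduct.induction_on with
      | zero => rw [map_zero, map_zero]; exact zero_mem _
      | tmul x y =>
        rw [reedyMul_of]
        obtain ⟨c, hc, hc'⟩ := mem_peirce.1 x.2
        obtain ⟨b, hb, hb'⟩ := mem_peirce.1 y.2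
        refine Submodule.subset_span ⟨⟨x, ?_⟩, ⟨y, ?_⟩, rfl⟩
        · rw [← hc']
          exact C.mul_mem (C.mul_mem (hmem j).2 hc) (hmem l).2
        · rw [← hb']
          exact B.mul_mem (B.mul_mem (hmem l).1 hb) (hmem i).1
      | add x y hx hy => rw [map_add, map_add]; exact add_mem hx hy
    | add x y hx hy => rw [map_add]; exact add_mem hx hy
  · rw [finrank_eq_sum_peirce he, ← sum_finrank_source he (fun _ => rfl) (fun _ => rfl)]
    refine Finset.sum_congr rfl fun j _ => Finset.sum_congr rfl fun i _ => ?_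
    rw [← (hmul i j).2, LinearMap.finrank_range_of_inj (hmul i j).1, finrank_reedyMul_source]

/-- Multiplication is onto each Peirce corner, so no corner is larger than its source. By `dim` the
totals over all corners agree; hence every inequality is an equality and multiplication is injective
on each corner. -/
theorem IsTriangular.isReedy {f : Fin (n + 1) → B} {g : Fin (n + 1) → C} {deg : Fin (n + 1) → ℕ}
    (h : IsTriangular B.val C.val e f g deg) : IsReedy B C := by
  have hf : ∀ i, (f i : A) = e i := h.map_f
  have hg : ∀ i, (g i : A) = e i := h.map_g
  have hB : ∀ i, e i ∈ B := fun i => by rw [← hf]; exact (f i).2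
  have hC : ∀ i, e i ∈ C := fun i => by rw [← hg]; exact (g i).2
  have he := h.complete
  have hrange : ∀ j i, LinearMap.range (reedyMul B C e j i) = peirce ⊤ (e j) (e i) := by
    intro j i
    refine le_antisymm ?_ ?_
    · rintro _ ⟨z, rfl⟩
      induction z using DirectSum.induction_on with
      | zero => rw [map_zero]; exact zero_mem _
      | of l z =>
        induction z using TensorProduct.induction_on with
        | zero => rw [map_zero, map_zero]; exact zero_mem _
        | tmul x y =>
          rw [reedyMul_of]
          obtain ⟨c, hc, hc'⟩ := mem_peirce.1 x.2
          obtain ⟨b, hb, hb'⟩ := mem_peirce.1 y.2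
          refine mem_peirce.2 ⟨c * e l * e l * b, Algebra.mem_top, ?_⟩
          rw [← hc', ← hb']
          simp only [mul_assoc]
        | add x y hx hy => rw [map_add, map_add]; exact add_mem hx hy
      | add x y hx hy => rw [map_add]; exact add_mem hx hy
    · intro x hx
      obtain ⟨r, -, rfl⟩ := mem_peirce.1 hx
      have hr := h.span r
      clear hx
      induction hr using Submodule.span_induction with
      | mem r hr =>
        obtain ⟨c, b, rfl⟩ := hr
        have h1 : e j * (C.val c * B.val b) * e i =
            ∑ l, (e j * C.val c * e l) * (e l * B.val b * e i) := by
          have h2 : ∀ l, (e j * C.val c * e l) * (e l * B.val b * e i) =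
              e j * C.val c * e l * (B.val b * e i) := by
            intro l
            rw [mul_assoc (e l), ← mul_assoc _ (e l), mul_assoc (e j * C.val c) (e l),
              (he.idem l).eq]
          rw [Finset.sum_congr rfl fun l _ => h2 l, ← Finset.sum_mul, ← Finset.mul_sum,
            he.complete, mul_one]
          simp only [mul_assoc]
        rw [h1]
        refine sum_mem fun l _ => ⟨DirectSum.of (fun l => peirce C (e j) (e l) ⊗[k]
          peirce B (e l) (e i)) l (⟨_, mem_peirce.2 ⟨c, c.2, rfl⟩⟩ ⊗ₜ
            ⟨_, mem_peirce.2 ⟨b, b.2, rfl⟩⟩), ?_⟩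
        rw [reedyMul_of]
        rfl
      | zero => rw [mul_zero, zero_mul]; exact zero_mem _
      | add x y _ _ hx hy => rw [mul_add, add_mul]; exact add_mem hx hy
      | smul a x _ hx => rw [mul_smul_comm, smul_mul_assoc]; exact Submodule.smul_mem _ a hx
  have hle : ∀ j i, Module.finrank k (peirce (⊤ : Subalgebra k A) (e j) (e i)) ≤ ∑ l,
      Module.finrank k (peirce C (e j) (e l)) * Module.finrank k (peirce B (e l) (e i)) := by
    intro j i
    rw [← hrange, ← finrank_reedyMul_source]
    exact LinearMap.finrank_range_le _
  have heq : ∀ j i, Module.finrank k (peirce (⊤ : Subalgebra k A) (e j) (e i)) = ∑ l,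
      Module.finrank k (peirce C (e j) (e l)) * Module.finrank k (peirce B (e l) (e i)) := by
    have h1 := h.dim
    rw [finrank_eq_sum_peirce he, ← sum_finrank_source he hf hg] at h1
    intro j i
    have h2 := (Finset.sum_eq_sum_iff_of_le
      fun j _ => Finset.sum_le_sum fun i _ => hle j i).1 h1 j (Finset.mem_univ j)
    exact (Finset.sum_eq_sum_iff_of_le fun i _ => hle j i).1 h2 i (Finset.mem_univ i)
  refine ⟨n, e, deg, he, fun i => ⟨hB i, hC i⟩, fun i => ?_, fun i j hij h0 => ?_, fun i => ?_,
    fun i j hij h0 => ?_, fun i j => ⟨?_, hrange j i⟩⟩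
  · refine peirce_equiv (he.idem i) (hC i) (h.ne_zero i) fun d hd => ?_
    obtain ⟨a, ha⟩ := h.diag_C i ⟨d, hd⟩
    refine ⟨a, ?_⟩
    have := congrArg Subtype.val ha
    simpa [hg] using this
  · obtain ⟨x, hx, hx0⟩ := Submodule.exists_mem_ne_zero_of_ne_bot h0
    obtain ⟨d, hd, rfl⟩ := mem_peirce.1 hx
    refine h.dir_C i j ⟨d, hd⟩ hij fun h1 => hx0 ?_
    have := congrArg Subtype.val h1
    simpa [hg] using this
  · refine peirce_equiv (he.idem i) (hB i) (h.ne_zero i) fun d hd => ?_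
    obtain ⟨a, ha⟩ := h.diag_B i ⟨d, hd⟩
    refine ⟨a, ?_⟩
    have := congrArg Subtype.val ha
    simpa [hf] using this
  · obtain ⟨x, hx, hx0⟩ := Submodule.exists_mem_ne_zero_of_ne_bot h0
    obtain ⟨d, hd, rfl⟩ := mem_peirce.1 hx
    refine h.dir_B i j ⟨d, hd⟩ hij fun h1 => hx0 ?_
    have := congrArg Subtype.val h1
    simpa [hf] using this
  · have h1 := heq j i
    rw [← hrange, ← finrank_reedyMul_source] at h1
    let : AddCommGroup (DirectSum (Fin (n + 1))
        fun l => peirce C (e j) (e l) ⊗[k] peirce B (e l) (e i)) :=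
      Module.addCommMonoidToAddCommGroup k
    have h2 := LinearMap.finrank_range_add_finrank_ker (K := k) (V := DirectSum (Fin (n + 1))
      fun l => peirce C (e j) (e l) ⊗[k] peirce B (e l) (e i)) (reedyMul B C e j i)
    rw [h1] at h2
    exact LinearMap.ker_eq_bot.1 (Submodule.finrank_eq_zero.1 (by omega))

end Reedy
end ReedyAlg

namespace ReedyAlg

/-! ### The bimodule C ⊗_S B as a sum over idempotents -/

variable {k : Type u} [Field k] {A : Type v} [Ring A] [Algebra k A]
  {B C : Subalgebra k A} {ι : Type} [Fintype ι] {e : ι → A} {f : ι → B} {g : ι → C}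

/-- The vector space `⨁ l, C e_l ⊗ e_l B`. -/
abbrev CornerSum (f : ι → B) (g : ι → C) : Type _ :=
  (l : ι) → LinearMap.range (LinearMap.mulRight k (g l)) ⊗[k]
    LinearMap.range (LinearMap.mulLeft k (f l))

/-- The multiplication `⨁ l, C e_l ⊗ e_l B → A`. -/
noncomputable def cornerMul (f : ι → B) (g : ι → C) : CornerSum f g →ₗ[k] A :=
  ∑ l, (TensorProduct.lift (LinearMap.mk₂ k
      (fun (c : LinearMap.range (LinearMap.mulRight k (g l)))
        (b : LinearMap.range (LinearMap.mulLeft k (f l))) => (c : A) * (b : A))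
      (fun c c' b => by simp [add_mul]) (fun a c b => by simp)
      (fun c b b' => by simp [mul_add]) (fun a c b => by simp))) ∘ₗ LinearMap.proj l

theorem cornerMul_single [DecidableEq ι] (l : ι)
    (c : LinearMap.range (LinearMap.mulRight k (g l)))
    (b : LinearMap.range (LinearMap.mulLeft k (f l))) :
    cornerMul f g (Pi.single l (c ⊗ₜ b)) = (c : A) * (b : A) := by
  rw [cornerMul, LinearMap.sum_apply, Finset.sum_eq_single l]
  · simp
  · intro j _ hj
    simp [Pi.single_eq_of_ne hj]
  · simp

theorem cornerSum_induction [DecidableEq ι] {p : CornerSum f g → Prop} (zero : p 0)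
    (single : ∀ l (c : C) (b : B), p (Pi.single l (⟨c * g l, c, rfl⟩ ⊗ₜ ⟨f l * b, b, rfl⟩)))
    (add : ∀ x y, p x → p y → p (x + y)) (x : CornerSum f g) : p x := by
  rw [← Finset.univ_sum_single x]
  refine Finset.sum_induction _ p add zero fun l _ => ?_
  induction x l using TensorProduct.induction_on with
  | zero => rw [Pi.single_zero]; exact zero
  | tmul c b =>
    obtain ⟨_, c, rfl⟩ := c
    obtain ⟨_, b, rfl⟩ := b
    exact single l c b
  | add x y hx hy => rw [Pi.single_add]; exact add _ _ hx hy

theorem finrank_cornerSum [FiniteDimensional k A] : Module.finrank k (CornerSum f g) =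
    ∑ l, Module.finrank k (LinearMap.range (LinearMap.mulRight k (g l))) *
      Module.finrank k (LinearMap.range (LinearMap.mulLeft k (f l))) := by
  rw [Module.finrank_pi_fintype]
  simp only [Module.finrank_tensorProduct]

theorem cornerMul_surjective_iff (he : CompleteOrthogonalIdempotents e)
    (hf : ∀ i, (f i : A) = e i) (hg : ∀ i, (g i : A) = e i) :
    Function.Surjective (cornerMul f g) ↔
      ∀ r, r ∈ Submodule.span k {x | ∃ c b, x = C.val c * B.val b} := by
  classical
  constructor
  · intro h r
    obtain ⟨x, rfl⟩ := h r
    induction x using cornerSum_induction with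
    | zero => rw [map_zero]; exact zero_mem _
    | single l c b =>
      rw [cornerMul_single]
      exact Submodule.subset_span ⟨c * g l, f l * b, rfl⟩
    | add x y hx hy => rw [map_add]; exact add_mem hx hy
  · intro h r
    rw [← LinearMap.mem_range]
    refine Submodule.span_le.2 ?_ (h r)
    rintro _ ⟨c, b, rfl⟩
    refine ⟨∑ l, Pi.single l (⟨c * g l, c, rfl⟩ ⊗ₜ ⟨f l * b, b, rfl⟩), ?_⟩
    rw [map_sum]
    have h1 : ∀ l, (c : A) * e l * (e l * b) = c * e l * b := by
      intro l
      rw [← mul_assoc, mul_assoc (c : A), (he.idem l).eq]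
    simp only [cornerMul_single, MulMemClass.coe_mul, hf, hg, h1]
    rw [← Finset.sum_mul, ← Finset.mul_sum, he.complete, mul_one]
    rfl

section MulSource

/-- The element `c ⊗ b` of `C ⊗_S B`. -/
def mulTmul (c : C) (b : B) : MulSource B C :=
  letI := interModule B C
  Induced.tmul (interToRight B C) c b

theorem mulTmul_add (c : C) (b b' : B) : mulTmul c (b + b') = mulTmul c b + mulTmul c b' :=
  let := interModule B C
  Induced.tmul_add _ _ _ _

theorem add_mulTmul (c c' : C) (b : B) : mulTmul (c + c') b = mulTmul c b + mulTmul c' b :=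
  let := interModule B C
  Induced.add_tmul _ _ _ _

theorem sum_mulTmul (c : ι → C) (b : B) : mulTmul (∑ l, c l) b = ∑ l, mulTmul (c l) b :=
  let := interModule B C
  Induced.sum_tmul _ _ _ _

theorem mulTmul_mul (c : C) (b : B) {s : A} (hB : s ∈ B) (hC : s ∈ C) :
    mulTmul c (⟨s, hB⟩ * b) = mulTmul (c * ⟨s, hC⟩) b :=
  let := interModule B C
  (Induced.mul_tmul (interToRight B C) c (⟨s, hB, hC⟩ : ↥(B ⊓ C)) b).symm

theorem mulInduced_mulTmul (c : C) (b : B) : mulInduced B C (mulTmul c b) = (c : A) * b := rfl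

theorem mulTmul_induction {p : MulSource B C → Prop} (tmul : ∀ c b, p (mulTmul c b))
    (add : ∀ x y, p x → p y → p (x + y)) (x : MulSource B C) : p x :=
  let := interModule B C
  Induced.induction (interToRight B C) tmul add x

theorem exists_addHom_mulSource {P : Type*} [AddCommGroup P] (F : C →+ B →+ P)
    (hF : ∀ c b s (hB : s ∈ B) (hC : s ∈ C), F (c * ⟨s, hC⟩) b = F c (⟨s, hB⟩ * b)) :
    ∃ G : MulSource B C →+ P, ∀ c b, G (mulTmul c b) = F c b :=
  let := interModule B C
  Induced.exists_addHom (interToRight B C) F fun c s b => hF c b s s.2.1 s.2.2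

theorem exists_hom_of_cornerSum [DecidableEq ι] : ∃ θ : CornerSum f g →+ MulSource B C,
    ∀ l c b, θ (Pi.single l (c ⊗ₜ b)) = mulTmul (c : C) (b : B) := by
  let F : C →+ B →+ MulSource B C := AddMonoidHom.mk' (fun c => AddMonoidHom.mk'
    (fun b => mulTmul c b) (mulTmul_add c)) fun c c' => AddMonoidHom.ext (add_mulTmul c c')
  let θ₀ : (l : ι) → (LinearMap.range (LinearMap.mulRight k (g l)) ⊗[k]
      LinearMap.range (LinearMap.mulLeft k (f l))) →+ MulSource B C := fun l =>
    TensorProduct.liftAddHom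
      ((AddMonoidHom.compHom' (LinearMap.range (LinearMap.mulLeft k (f l))).subtype.toAddMonoidHom).comp
        (F.comp (LinearMap.range (LinearMap.mulRight k (g l))).subtype.toAddMonoidHom))
      (fun a c b => by
        change mulTmul (a • (c : C)) (b : B) = mulTmul (c : C) (a • (b : B))
        have hB : a • (b : B) = ⟨algebraMap k A a, B.algebraMap_mem a⟩ * (b : B) :=
          Algebra.smul_def a (b : B)
        have hC : a • (c : C) = (c : C) * ⟨algebraMap k A a, C.algebraMap_mem a⟩ :=
          (Algebra.smul_def a (c : C)).trans (Algebra.commutes a (c : C))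
        rw [hB, hC, mulTmul_mul])
  have hθ₀ : ∀ l c b, θ₀ l (c ⊗ₜ b) = mulTmul (c : C) (b : B) := fun _ _ _ => rfl
  refine ⟨∑ l, (θ₀ l).comp (Pi.evalAddMonoidHom _ l), fun l c b => ?_⟩
  rw [AddMonoidHom.finsetSum_apply, Finset.sum_eq_single l]
  · simp [hθ₀]
  · intro j _ hj
    simp [Pi.single_eq_of_ne hj]
  · simp

/-- The map is balanced over S because an element of S multiplies e_l by the same scalar from either
side. -/
theorem exists_hom_to_cornerSum (he : CompleteOrthogonalIdempotents e)
    (hf : ∀ i, (f i : A) = e i) (hg : ∀ i, (g i : A) = e i)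
    (hs : ∀ s ∈ B ⊓ C, ∃ a : ι → k, s = ∑ i, a i • e i) :
    ∃ G : MulSource B C →+ CornerSum f g, ∀ c b, G (mulTmul c b) = fun l =>
      (LinearMap.mulRight k (g l)).rangeRestrict c ⊗ₜ
        (LinearMap.mulLeft k (f l)).rangeRestrict b := by
  classical
  let F : C →+ B →+ CornerSum f g := AddMonoidHom.mk' (fun c => AddMonoidHom.mk'
      (fun b l => (LinearMap.mulRight k (g l)).rangeRestrict c ⊗ₜ
        (LinearMap.mulLeft k (f l)).rangeRestrict b)
      fun b b' => funext fun l => by rw [map_add, TensorProduct.tmul_add, Pi.add_apply])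
    fun c c' => AddMonoidHom.ext fun b => funext fun l =>
      (congrArg (· ⊗ₜ _) (map_add _ c c')).trans (TensorProduct.add_tmul _ _ _)
  refine exists_addHom_mulSource F fun c b s hB hC => funext fun l => ?_
  change (LinearMap.mulRight k (g l)).rangeRestrict (c * ⟨s, hC⟩) ⊗ₜ
      (LinearMap.mulLeft k (f l)).rangeRestrict b =
    (LinearMap.mulRight k (g l)).rangeRestrict c ⊗ₜ
      (LinearMap.mulLeft k (f l)).rangeRestrict (⟨s, hB⟩ * b)
  obtain ⟨a, ha⟩ := hs s ⟨hB, hC⟩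
  have h1 : s * e l = a l • e l := by
    rw [ha, Finset.sum_mul, Finset.sum_eq_single l]
    · rw [smul_mul_assoc, (he.idem l).eq]
    · intro j _ hj
      rw [smul_mul_assoc, he.ortho hj, smul_zero]
    · simp
  have h2 : e l * s = a l • e l := by
    rw [ha, Finset.mul_sum, Finset.sum_eq_single l]
    · rw [mul_smul_comm, (he.idem l).eq]
    · intro j _ hj
      rw [mul_smul_comm, he.ortho (Ne.symm hj), smul_zero]
    · simp
  have h3 : (LinearMap.mulRight k (g l)).rangeRestrict (c * ⟨s, hC⟩) =
      a l • (LinearMap.mulRight k (g l)).rangeRestrict c := by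
    refine Subtype.ext (Subtype.ext ?_)
    change (c : A) * s * g l = a l • ((c : A) * g l)
    rw [hg, mul_assoc, h1, mul_smul_comm]
  have h4 : (LinearMap.mulLeft k (f l)).rangeRestrict (⟨s, hB⟩ * b) =
      a l • (LinearMap.mulLeft k (f l)).rangeRestrict b := by
    refine Subtype.ext (Subtype.ext ?_)
    change (f l : A) * (s * b) = a l • ((f l : A) * b)
    rw [hf, ← mul_assoc, h2, smul_mul_assoc]
  rw [h3, h4, TensorProduct.smul_tmul]

/-- Since S is spanned by the e_l, the tensor product over S is the sum of the C e_l ⊗_k e_l B,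
compatibly with multiplication into A. -/
theorem mulInduced_bijective_iff_cornerMul (he : CompleteOrthogonalIdempotents e)
    (hf : ∀ i, (f i : A) = e i) (hg : ∀ i, (g i : A) = e i)
    (hs : ∀ s ∈ B ⊓ C, ∃ a : ι → k, s = ∑ i, a i • e i) :
    Function.Bijective (mulInduced B C) ↔ Function.Bijective (cornerMul f g) := by
  classical
  obtain ⟨θ, hθ⟩ := exists_hom_of_cornerSum (f := f) (g := g)
  obtain ⟨G, hG⟩ := exists_hom_to_cornerSum he hf hg hs
  have hGθ : ∀ x, G (θ x) = x := by
    intro x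
    induction x using cornerSum_induction with
    | zero => rw [map_zero, map_zero]
    | single l c x =>
      rw [hθ, hG]
      funext j
      by_cases hj : j = l
      · subst hj
        rw [Pi.single_eq_same]
        congr 1
        · refine Subtype.ext (Subtype.ext ?_)
          change (c : A) * g j * g j = c * g j
          rw [hg, mul_assoc, (he.idem j).eq]
        · refine Subtype.ext (Subtype.ext ?_)
          change (f j : A) * (f j * x) = f j * x
          rw [hf, ← mul_assoc, (he.idem j).eq]
      · rw [Pi.single_eq_of_ne hj]
        have h1 : (LinearMap.mulRight k (g j)).rangeRestrict (c * g l) = 0 := by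
          refine Subtype.ext (Subtype.ext ?_)
          change (c : A) * g l * g j = 0
          rw [hg, hg, mul_assoc, he.ortho (Ne.symm hj), mul_zero]
        exact (congrArg (· ⊗ₜ _) h1).trans (TensorProduct.zero_tmul _ _)
    | add x y hx hy => rw [map_add, map_add, hx, hy]
  have hθG : ∀ x, θ (G x) = x := by
    intro x
    induction x using mulTmul_induction with
    | tmul c x =>
      rw [hG, ← Finset.univ_sum_single (fun l =>
        (LinearMap.mulRight k (g l)).rangeRestrict c ⊗ₜ[k]
          (LinearMap.mulLeft k (f l)).rangeRestrict x), map_sum]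
      have h1 : ∀ l, θ (Pi.single l ((LinearMap.mulRight k (g l)).rangeRestrict c ⊗ₜ
          (LinearMap.mulLeft k (f l)).rangeRestrict x)) = mulTmul (c * g l) x := by
        intro l
        have hl : (f l : A) ∈ C := by rw [hf, ← hg]; exact (g l).2
        rw [hθ]
        refine (mulTmul_mul (c * g l) x (f l).2 hl).trans (congrArg (mulTmul · x) ?_)
        refine Subtype.ext ?_
        change (c : A) * g l * f l = c * g l
        rw [hg, hf, mul_assoc, (he.idem l).eq]
      have h4 : ∑ l, g l = 1 := by
        refine Subtype.ext ?_
        change C.val (∑ l, g l) = 1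
        rw [map_sum, ← he.complete]
        exact Finset.sum_congr rfl fun l _ => hg l
      rw [Finset.sum_congr rfl fun l _ => h1 l, ← sum_mulTmul, ← Finset.mul_sum, h4, mul_one]
    | add x y hx hy => rw [map_add, map_add, hx, hy]
  have hcomp : ⇑(cornerMul f g) = mulInduced B C ∘ θ := by
    funext x
    rw [Function.comp_apply]
    induction x using cornerSum_induction with
    | zero => rw [map_zero, map_zero, map_zero]
    | single l c x => rw [cornerMul_single, hθ, mulInduced_mulTmul]
    | add x y hx hy => rw [map_add, map_add, map_add, hx, hy]
  rw [hcomp]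
  exact (Function.Bijective.of_comp_iff _ ⟨Function.LeftInverse.injective hGθ,
    Function.RightInverse.surjective hθG⟩).symm

end MulSource

theorem mulInduced_bijective_iff [FiniteDimensional k A] (he : CompleteOrthogonalIdempotents e)
    (hf : ∀ i, (f i : A) = e i) (hg : ∀ i, (g i : A) = e i)
    (hs : ∀ s ∈ B ⊓ C, ∃ a : ι → k, s = ∑ i, a i • e i) :
    Function.Bijective (mulInduced B C) ↔
      (∀ r, r ∈ Submodule.span k {x | ∃ c b, x = C.val c * B.val b}) ∧
      Module.finrank k A = ∑ l, Module.finrank k (LinearMap.range (LinearMap.mulRight k (g l))) *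
        Module.finrank k (LinearMap.range (LinearMap.mulLeft k (f l))) := by
  rw [mulInduced_bijective_iff_cornerMul he hf hg hs, ← cornerMul_surjective_iff he hf hg,
    ← finrank_cornerSum]
  constructor
  · intro h
    exact ⟨h.2, (LinearEquiv.ofBijective _ h).finrank_eq.symm⟩
  · rintro ⟨h, hd⟩
    exact ⟨(LinearMap.injective_iff_surjective_of_finrank_eq_finrank hd.symm).2 h, h⟩

end ReedyAlg

namespace ReedyAlg

variable {k : Type u} [Field k]

/-! ### From condition (ii) to a triangular decomposition -/

section Labelled

variable {R : Type v} [Ring R] [Algebra k R] [FiniteDimensional k R]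
  {I : Type} [Fintype I] [DecidableEq I] {W : WeightSystem R I}
  {q : R →ₐ[k] (I → k)} {e : I → R}

theorem IsLabelled.exists_smul_of_forall_eq_zero (h : IsLabelled W q e) {i : I}
    (h0 : ∀ x, q x i = 0 → e i * x * e i = 0) (x : R) : ∃ a : k, e i * x * e i = a • e i := by
  refine ⟨q x i, ?_⟩
  have := h0 (x - algebraMap k R (q x i)) (by simp)
  rwa [mul_sub, sub_mul, sub_eq_zero, ← Algebra.commutes, mul_assoc (algebraMap k R _),
    h.e_mul_self, ← Algebra.smul_def] at this

/-- A radical element of the corner is a combination of products e_i r e_j s e_i with j ⋬ i. By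
directedness e_i r e_j ≠ 0 would imply j ⊴ i. -/
theorem IsLabelled.corner_of_simple (h : IsLabelled W q e) {le : I → I → Prop}
    (hq : IsQuasiHereditary W le) (hs : ∀ i, IsSimpleModule R (W.standard le i)) (i : I) (x : R) :
    ∃ a : k, e i * x * e i = a • e i := by
  have hi : le i i := by
    obtain ⟨c, level, -, hle⟩ := hq
    exact (hle i i).2 (Or.inl rfl)
  refine h.exists_smul_of_forall_eq_zero (fun x hx => ?_) x
  have h1 := h.mul_e_mem_span hi (hs i) (x := e i * x) (by
    rw [map_mul, h.q_e]
    ext b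
    by_cases hb : b = i
    · subst hb; simp [hx]
    · simp [hb])
  have h2 : ∀ z ∈ Submodule.span R {z | ∃ j, ¬ le j i ∧ ∃ s : R, z = e j * s * e i},
      ∀ r, e i * (r * z) = 0 := by
    intro z hz
    induction hz using Submodule.span_induction with
    | mem z hz =>
      obtain ⟨j, hj, s, rfl⟩ := hz
      intro r
      by_contra h0
      refine hj (h.directed_of_simple hq hs (i := j) (j := i) (x := r) ?_ fun h3 => h0 ?_)
      · rintro rfl
        exact hj hi
      · rw [mul_assoc (e j), ← mul_assoc r, ← mul_assoc (e i), ← mul_assoc (e i), h3, zero_mul]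
    | zero => simp
    | add y z _ _ hy hz => intro r; rw [mul_add, mul_add, hy, hz, add_zero]
    | smul a z _ hz => intro r; rw [smul_eq_mul, ← mul_assoc r]; exact hz _
  have h3 := h2 _ h1 1
  rwa [one_mul, mul_assoc (e i) x, ← mul_assoc (e i), h.e_mul_self, ← mul_assoc] at h3

/-- A nonzero radical element of the corner would be a nonzero endomorphism of `P i` with image in
the radical. As `P i` is its own standard module, `end_standard_eq_zero` excludes this. -/
theorem IsLabelled.corner_of_projective (h : IsLabelled W q e) {le : I → I → Prop}
    (hq : IsQuasiHereditary W le) {i : I} (hp : Module.Projective R (W.standard le i)) (x : R) :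
    ∃ a : k, e i * x * e i = a • e i := by
  have := IsArtinianRing.of_finite k R
  have hi : le i i := by
    obtain ⟨c, level, -, hle⟩ := hq
    exact (hle i i).2 (Or.inl rfl)
  refine h.exists_smul_of_forall_eq_zero (fun x hx => ?_) x
  by_contra h0
  obtain ⟨f, hf, hf'⟩ := h.exists_hom_ne_zero h0
  refine hf (LinearMap.ext fun y => ?_)
  have := W.end_standard_eq_zero hq f (hf' hx) y
  rwa [W.traceSum_eq_bot_of_projective hi hp, Submodule.mem_bot] at this

end Labelled

variable {A : Type v} [Ring A] [Algebra k A] [FiniteDimensional k A]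

theorem IsMaximalSemisimple.exists_isLabelled {S B : Subalgebra k A} (hB : IsElementary k B)
    (hS : IsMaximalSemisimple S B) {I : Type} [Fintype I] [DecidableEq I] (W : WeightSystem B I) :
    ∃ (q : B →ₐ[k] (I → k)) (e : I → B), IsLabelled W q e ∧ (∀ i, (e i : A) ∈ S) ∧
      ∀ s : B, (s : A) ∈ S → s = ∑ i, q s i • e i := by
  obtain ⟨m, q, hq, hker⟩ := hB.exists_algHom
  obtain ⟨e, he, heS, hspan⟩ := hS.exists_isSplit hq hker
  obtain ⟨σ, q', hq', hl⟩ := he.exists_isLabelled W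
  refine ⟨q', e ∘ σ, hl, fun i => heS _, fun s hs => ?_⟩
  conv_lhs => rw [hspan s hs]
  simp only [hq', Function.comp_apply]
  exact (σ.sum_comp fun i => q s i • e i).symm

theorem RestrictionsIso.apply_eq {B C : Subalgebra k A} {I : Type} [Fintype I] [DecidableEq I]
    {qB : B →ₐ[k] (I → k)} {qC : C →ₐ[k] (I → k)} {i j : I} {M N : Type v} [AddCommGroup M]
    [Module B M] [Nontrivial M] [AddCommGroup N] [Module C N] (h : RestrictionsIso B C M N)
    (hM : ActsBy qB i M) (hN : ActsBy qC j N) {s : A} (hB : s ∈ B) (hC : s ∈ C) :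
    qB ⟨s, hB⟩ i = qC ⟨s, hC⟩ j := by
  obtain ⟨f, hf⟩ := h
  obtain ⟨v, hv⟩ := exists_ne (0 : M)
  have h1 := hf s hB hC v
  have h2 := hf _ (B.algebraMap_mem (qB ⟨s, hB⟩ i)) (C.algebraMap_mem (qB ⟨s, hB⟩ i)) v
  have h3 : algebraMap k C (qB ⟨s, hB⟩ i) • f v = algebraMap k C (qC ⟨s, hC⟩ j) • f v := by
    rw [← hN ⟨s, hC⟩, ← h1, hM ⟨s, hB⟩]
    exact h2.symm
  rw [← sub_eq_zero, ← sub_smul, ← map_sub] at h3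
  exact sub_eq_zero.1 (smul_algebraMap_eq_zero ((map_ne_zero_iff f f.injective).2 hv) h3)

/-- The idempotents of two subalgebras coincide if they are labelled compatibly. -/
theorem IsSplit.idempotents_eq {B C : Subalgebra k A} {I : Type} [Fintype I] [DecidableEq I]
    {qB : B →ₐ[k] (I → k)} {qC : C →ₐ[k] (I → k)} {eB : I → B} {eC : I → C}
    (hB : IsSplit qB eB) (heB : ∀ i, (eB i : A) ∈ B ⊓ C)
    (hspan : ∀ s : C, (s : A) ∈ B ⊓ C → s = ∑ i, qC s i • eC i)
    (hq : ∀ i {s : A} (hB : s ∈ B) (hC : s ∈ C), qB ⟨s, hB⟩ i = qC ⟨s, hC⟩ i) (i : I) :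
    (eB i : A) = eC i := by
  have h1 := hspan ⟨eB i, (heB i).2⟩ (heB i)
  have h2 : ∀ j, qC ⟨eB i, (heB i).2⟩ j = if j = i then 1 else 0 := by
    intro j
    rw [← hq j (eB i).2 (heB i).2]
    change qB (eB i) j = _
    rw [hB.q_e, Pi.single_apply]
  simp only [h2, ite_smul, one_smul, zero_smul, Finset.sum_ite_eq', Finset.mem_univ, if_true] at h1
  exact congrArg Subtype.val h1

/-- The level function of a heredity chain of B serves as degree. It works for C as well, since the
two algebras share the partial order that it encodes. -/
theorem exists_isTriangular_of_bijective {B C : Subalgebra k A} (hB : IsElementary k B)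
    (hC : IsElementary k C) (hSB : IsMaximalSemisimple (B ⊓ C) B)
    (hSC : IsMaximalSemisimple (B ⊓ C) C) (hmul : Function.Bijective (mulInduced B C))
    {I : Type} [Fintype I] [DecidableEq I] {WB : WeightSystem B I} {WC : WeightSystem C I}
    {le : I → I → Prop} (hres : ∀ i, RestrictionsIso B C (WB.L i) (WC.L i))
    (hqB : IsQuasiHereditary WB le) (hsB : ∀ i, IsSimpleModule B (WB.standard le i))
    (hqC : IsQuasiHereditary WC le) (hpC : ∀ i, Module.Projective C (WC.standard le i)) :
    ∃ (e : I → A) (f : I → B) (g : I → C) (deg : I → ℕ), IsTriangular B.val C.val e f g deg := by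
  obtain ⟨qB, eB, hlB, heB, hspB⟩ := hSB.exists_isLabelled hB WB
  obtain ⟨qC, eC, hlC, -, hspC⟩ := hSC.exists_isLabelled hC WC
  have hq : ∀ i {s : A} (hB : s ∈ B) (hC : s ∈ C), qB ⟨s, hB⟩ i = qC ⟨s, hC⟩ i := by
    intro i s hs hs'
    have := WB.simple i
    have := IsSimpleModule.nontrivial B (WB.L i)
    exact (hres i).apply_eq (hlB.acts i) (hlC.acts i) hs hs'
  have heq := hlB.toIsSplit.idempotents_eq heB hspC hq
  obtain ⟨c, level, hc, hle⟩ := id hqB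
  have hrefl : ∀ i, le i i := fun i => (hle i i).2 (Or.inl rfl)
  have he : CompleteOrthogonalIdempotents (fun i => (eB i : A)) := hlB.complete.map (B.val : B →+* A)
  obtain ⟨hspan, hdim⟩ := (mulInduced_bijective_iff he (fun _ => rfl) (fun i => (heq i).symm)
    fun s hs => ⟨qB ⟨s, hs.1⟩, by
      have := congrArg B.val (hspB ⟨s, hs.1⟩ hs)
      rw [map_sum] at this
      exact this⟩).1 hmul
  refine ⟨_, eB, eC, level, he, fun _ => rfl, fun i => (heq i).symm, Subtype.val_injective,
    Subtype.val_injective, fun i h0 => ?_, hlB.corner_of_simple hqB hsB, fun i j b hij h0 => ?_,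
    fun i => hlC.corner_of_projective hqC (hpC i), fun i j b hij h0 => ?_, hspan, hdim⟩
  · have h1 : eB i = 0 := Subtype.ext h0
    have := hlB.q_e i
    rw [h1, map_zero] at this
    simpa using congrFun this i
  · exact ((hle i j).1 (hlB.directed_of_simple hqB hsB hij h0)).resolve_left hij
  · exact ((hle j i).1 (hlC.directed_of_projective (hrefl i) (hpC i) h0)).resolve_left hij.symm

/-- A triangular decomposition indexed by `Fin m` gives a Reedy decomposition. -/
theorem IsTriangular.isReedy_of_fin [Nontrivial A] {B C : Subalgebra k A} {m : ℕ} {e : Fin m → A}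
    {f : Fin m → B} {g : Fin m → C} {deg : Fin m → ℕ} (h : IsTriangular B.val C.val e f g deg) :
    IsReedy B C := by
  cases m with
  | zero =>
    have := h.complete.complete
    simp at this
  | succ n => exact h.isReedy

theorem IsTriangular.mulInduced_bijective {B C : Subalgebra k A} {ι : Type} [Fintype ι]
    [DecidableEq ι] {e : ι → A} {f : ι → B} {g : ι → C} {deg : ι → ℕ}
    (h : IsTriangular B.val C.val e f g deg) : Function.Bijective (mulInduced B C) := by
  obtain ⟨qB, qC, hqB, hqC, hs, -⟩ := h.exists_isSplit
  exact (mulInduced_bijective_iff h.complete h.map_f h.map_g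
    fun s hs' => ⟨_, hs s hs'.1 hs'.2⟩).2 ⟨h.span, h.dim⟩

end ReedyAlg

namespace ReedyAlg

variable {k : Type u} [Field k]

/-! ### Standard modules induced from an exact Borel subalgebra -/

section ExactBorel

variable {A B : Type v} [Ring A] [Ring B] [Algebra k A] [Algebra k B] [FiniteDimensional k A]
  [FiniteDimensional k B] {φ : B →ₐ[k] A} {I : Type} [Fintype I] [DecidableEq I]
  {WA : WeightSystem A I} {WB : WeightSystem B I} {le : I → I → Prop} {q : B →ₐ[k] (I → k)}
  {e : I → B}

/-- The left ideal of `A` generated by the kernel of the `j`-th character of `B`. -/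
def borelIdeal (φ : B →ₐ[k] A) (q : B →ₐ[k] (I → k)) (j : I) : Ideal A :=
  (coordKer q j).map (φ : B →+* A)

theorem mem_borelIdeal {j : I} (a : A) {b : B} (hb : q b j = 0) : a * φ b ∈ borelIdeal φ q j :=
  Ideal.mul_mem_left _ _ (Ideal.mem_map_of_mem (φ : B →+* A) (mem_coordKer.2 hb))

theorem borelIdeal_le {j : I} {N : Ideal A} (h : ∀ b, q b j = 0 → φ b ∈ N) :
    borelIdeal φ q j ≤ N :=
  Ideal.map_le_iff_le_comap.2 fun b hb => h b (mem_coordKer.1 hb)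

theorem exists_hom_of_borelIdeal {M : Type*} [AddCommGroup M] [Module A M] {j : I} (v : M)
    (hv : ∀ b, q b j = 0 → φ b • v = 0) :
    ∃ F : (A ⧸ borelIdeal φ q j) →ₗ[A] M, ∀ a, F (Submodule.Quotient.mk a) = a • v := by
  refine ⟨(borelIdeal φ q j).liftQ (LinearMap.toSpanSingleton A M v) ?_, fun a => ?_⟩
  · exact borelIdeal_le (N := LinearMap.ker (LinearMap.toSpanSingleton A M v)) hv
  · simp

theorem ActsBy.exists_lift_borelIdeal {M : Type v} [AddCommGroup M] [Module B M]
    [IsSimpleModule B M] {j : I} (hM : ActsBy q j M) {v : M} (hv : v ≠ 0) :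
    ∃ Ψ : Induced (φ : B →+* A) M →ₗ[A] A ⧸ borelIdeal φ q j,
      ∀ t, Ψ (Induced.tmul (φ : B →+* A) t v) = Submodule.Quotient.mk t := by
  have hgen := IsSimpleModule.toSpanSingleton_surjective B hv
  let : Module B (A ⧸ borelIdeal φ q j) := Module.compHom _ (φ : B →+* A)
  have hsmul : ∀ (b : B) (y : A ⧸ borelIdeal φ q j), b • y = φ b • y := fun _ _ => rfl
  have hker : LinearMap.ker (LinearMap.toSpanSingleton B M v) ≤ LinearMap.ker
      (LinearMap.toSpanSingleton B (A ⧸ borelIdeal φ q j) (Submodule.Quotient.mk 1)) := by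
    intro b hb
    rw [LinearMap.mem_ker, LinearMap.toSpanSingleton_apply] at hb ⊢
    rw [hsmul, ← Submodule.Quotient.mk_smul, Submodule.Quotient.mk_eq_zero, smul_eq_mul, mul_one,
      ← one_mul (φ b)]
    exact mem_borelIdeal 1 ((hM.ker_toSpanSingleton hv b).1 hb)
  let ψ : M →ₗ[B] A ⧸ borelIdeal φ q j :=
    (LinearMap.ker (LinearMap.toSpanSingleton B M v)).liftQ _ hker ∘ₗ
      ((LinearMap.toSpanSingleton B M v).quotKerEquivOfSurjective hgen).symm.toLinearMap
  have hψ : ψ v = Submodule.Quotient.mk 1 := by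
    have : ((LinearMap.toSpanSingleton B M v).quotKerEquivOfSurjective hgen).symm v =
        Submodule.Quotient.mk 1 := by
      rw [LinearEquiv.symm_apply_eq]
      simp
    change (LinearMap.ker (LinearMap.toSpanSingleton B M v)).liftQ _ hker
      (((LinearMap.toSpanSingleton B M v).quotKerEquivOfSurjective hgen).symm v) = _
    rw [this]
    change (1 : B) • (Submodule.Quotient.mk 1 : A ⧸ borelIdeal φ q j) = _
    rw [one_smul]
  obtain ⟨Ψ, hΨ⟩ := Induced.exists_lift (φ : B →+* A) ψ.toAddMonoidHom
    (fun b y => ψ.map_smul b y)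
  refine ⟨Ψ, fun t => (hΨ t v).trans ?_⟩
  change t • ψ v = _
  rw [hψ, ← Submodule.Quotient.mk_smul, smul_eq_mul, mul_one]

theorem induced_equiv_borelIdeal (hl : IsLabelled WB q e) (j : I) :
    Nonempty (Induced (φ : B →+* A) (WB.L j) ≃ₗ[A] A ⧸ borelIdeal φ q j) := by
  have := WB.simple j
  have := IsSimpleModule.nontrivial B (WB.L j)
  obtain ⟨v, hv⟩ := exists_ne (0 : WB.L j)
  obtain ⟨Φ, hΦ⟩ := exists_hom_of_borelIdeal (φ := φ) (q := q) (j := j)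
    (Induced.tmul (φ : B →+* A) 1 v) (fun b hb => by
      have h1 : b • v = 0 := by rw [hl.acts j b, hb, map_zero, zero_smul]
      rw [Induced.smul_tmul, mul_one, ← one_mul (φ b)]
      refine (Induced.mul_tmul (φ : B →+* A) _ _ _).trans ?_
      rw [h1, Induced.tmul_zero])
  obtain ⟨Ψ, hΨ⟩ := (hl.acts j).exists_lift_borelIdeal (φ := φ) hv
  refine ⟨LinearEquiv.ofLinearMap Ψ Φ ?_ ?_⟩
  · refine Submodule.linearMap_qext _ (LinearMap.ext fun r => ?_)
    change Ψ (Φ (Submodule.Quotient.mk r)) = Submodule.Quotient.mk r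
    rw [hΦ, Induced.smul_tmul, hΨ, mul_one]
  · refine LinearMap.ext fun z => ?_
    rw [LinearMap.comp_apply, LinearMap.id_apply]
    induction z using Induced.induction with
    | tmul t m =>
      obtain ⟨b, rfl⟩ := IsSimpleModule.toSpanSingleton_surjective B hv m
      have h1 : Induced.tmul (φ : B →+* A) t (LinearMap.toSpanSingleton B (WB.L j) v b) =
        Induced.tmul (φ : B →+* A) (t * φ b) v := (Induced.mul_tmul (φ : B →+* A) _ _ _).symm
      rw [h1, hΨ, hΦ, Induced.smul_tmul, mul_one]
    | add x y hx hy => rw [map_add, map_add, hx, hy]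

theorem IsExactBorel.standard_equiv (h : IsExactBorel (φ : B →+* A) WA WB le)
    (hl : IsLabelled WB q e) (j : I) :
    Nonempty ((A ⧸ borelIdeal φ q j) ≃ₗ[A] WA.standard le j) := by
  obtain ⟨ε⟩ := induced_equiv_borelIdeal (φ := φ) hl j
  obtain ⟨ε'⟩ := h.induced_simple j
  exact ⟨ε.symm ≪≫ₗ ε'⟩

theorem IsExactBorel.isSimpleModule_standard (h : IsExactBorel (φ : B →+* A) WA WB le) (i : I) :
    IsSimpleModule B (WB.standard le i) := by
  obtain ⟨ε⟩ := h.standard_simple i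
  have := WB.simple i
  exact IsSimpleModule.congr ε

theorem IsExactBorel.refl (h : IsExactBorel (φ : B →+* A) WA WB le) (i : I) : le i i := by
  obtain ⟨c, level, -, hle⟩ := h.ambient
  exact (hle i i).2 (Or.inl rfl)

theorem IsExactBorel.one_notMem (h : IsExactBorel (φ : B →+* A) WA WB le)
    (hl : IsLabelled WB q e) (j : I) : (1 : A) ∉ borelIdeal φ q j := by
  intro h1
  obtain ⟨ε⟩ := h.standard_equiv hl j
  have h2 : borelIdeal φ q j = ⊤ := (Ideal.eq_top_iff_one _).2 h1
  have h3 : Subsingleton (A ⧸ borelIdeal φ q j) := Submodule.Quotient.subsingleton_iff.2 h2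
  have h4 : Subsingleton (WA.standard le j) := ε.symm.injective.subsingleton
  have h5 := Submodule.Quotient.subsingleton_iff.1 h4
  exact (WA.isCoatom_ker j).1 (top_le_iff.1 (h5 ▸ WA.traceSum_le_ker (h.refl j)))

/-- An element of `e i D` is killed by the kernel of the `i`-th character as soon as the weights
reached from `i` do not occur in `D`. -/
theorem IsExactBorel.smul_eq_zero (h : IsExactBorel (φ : B →+* A) WA WB le)
    (hl : IsLabelled WB q e) {D : Type*} [AddCommGroup D] [Module A D] {i : I} {v : D}
    (hv : φ (e i) • v = v) (hD : ∀ l (y : D), l ≠ i → le i l → φ (e l) • y = 0) (b : B)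
    (hb : q b i = 0) : φ b • v = 0 := by
  have h1 : φ b • v = ∑ l, φ (e l * b * e i) • v := by
    rw [← Finset.sum_smul, ← map_sum, ← Finset.sum_mul, ← Finset.sum_mul, hl.complete.complete,
      one_mul, map_mul, mul_smul, hv]
  rw [h1]
  refine Finset.sum_eq_zero fun l _ => ?_
  by_cases hli : l = i
  · subst hli
    obtain ⟨a, ha⟩ := hl.corner_of_simple h.quasiHereditary h.isSimpleModule_standard l b
    have h2 := congrFun (congrArg q ha) l
    simp [hl.q_e, hb] at h2
    rw [ha, ← h2, zero_smul, map_zero, zero_smul]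
  · by_cases h0 : e l * b * e i = 0
    · rw [h0, map_zero, zero_smul]
    · rw [mul_assoc, map_mul, mul_smul]
      exact hD l _ hli
        (hl.directed_of_simple h.quasiHereditary h.isSimpleModule_standard (Ne.symm hli) h0)

/-- This says e_i Δ(j) = 0, by induction on the level of i. A vector of e_i Δ(j) is moved by B into
components of smaller level, which vanish by induction. It thus defines a homomorphism Δ(i) → Δ(j),
and there is none but zero. -/
theorem IsExactBorel.e_mul_mem (h : IsExactBorel (φ : B →+* A) WA WB le)
    (hl : IsLabelled WB q e) {i j : I} (hij : ¬ le i j) (a : A) :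
    φ (e i) * a ∈ borelIdeal φ q j := by
  obtain ⟨c, level, hc, hle⟩ := h.ambient
  induction hn : level i using Nat.strong_induction_on generalizing i a with
  | _ n ih =>
    subst hn
    set v : A ⧸ borelIdeal φ q j := Submodule.Quotient.mk (φ (e i) * a)
    have hv : φ (e i) • v = v := by
      rw [← Submodule.Quotient.mk_smul, smul_eq_mul, ← mul_assoc, ← map_mul, hl.e_mul_self]
    obtain ⟨F, hF⟩ := exists_hom_of_borelIdeal (φ := φ) (q := q) v (h.smul_eq_zero hl hv
      (fun l y hli hil => by
        obtain ⟨y, rfl⟩ := Submodule.Quotient.mk_surjective _ y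
        have h1 : level l < level i := ((hle i l).1 hil).resolve_left (Ne.symm hli)
        rw [← Submodule.Quotient.mk_smul, smul_eq_mul, Submodule.Quotient.mk_eq_zero]
        refine ih (level l) h1 (fun hlj => hij ((hle i j).2 (Or.inr ?_))) y rfl
        rcases (hle l j).1 hlj with rfl | h2
        · exact h1
        · exact h2.trans h1))
    obtain ⟨ε⟩ := h.standard_equiv hl i
    obtain ⟨ε'⟩ := h.standard_equiv hl j
    have h1 := WA.hom_standard_eq_zero hij (ε'.toLinearMap ∘ₗ F ∘ₗ ε.symm.toLinearMap)
    have h2 := LinearMap.congr_fun h1 (ε (Submodule.Quotient.mk 1))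
    simp only [LinearMap.comp_apply, LinearEquiv.coe_coe, LinearEquiv.symm_apply_apply, hF,
      one_smul, LinearMap.zero_apply, map_eq_zero_iff ε' ε'.injective] at h2
    exact (Submodule.Quotient.mk_eq_zero _).1 h2

/-- A vector of e_j Δ(j) defines an endomorphism of Δ(j), which is a scalar. The vector is thus a
multiple of the generator. -/
theorem IsExactBorel.exists_sub_mem (h : IsExactBorel (φ : B →+* A) WA WB le)
    (hl : IsLabelled WB q e)
    (hend : ∀ i (f : WA.L i →ₗ[A] WA.L i), ∃ a : k, ∀ x, f x = algebraMap k A a • x)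
    (j : I) (a : A) : ∃ c : k, φ (e j) * a - algebraMap k A c ∈ borelIdeal φ q j := by
  have := IsArtinianRing.of_finite k A
  set v : A ⧸ borelIdeal φ q j := Submodule.Quotient.mk (φ (e j) * a)
  have hv : φ (e j) • v = v := by
    rw [← Submodule.Quotient.mk_smul, smul_eq_mul, ← mul_assoc, ← map_mul, hl.e_mul_self]
  obtain ⟨F, hF⟩ := exists_hom_of_borelIdeal (φ := φ) (q := q) v (h.smul_eq_zero hl hv
    (fun l y hli hil => by
      obtain ⟨y, rfl⟩ := Submodule.Quotient.mk_surjective _ y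
      rw [← Submodule.Quotient.mk_smul, smul_eq_mul, Submodule.Quotient.mk_eq_zero]
      refine h.e_mul_mem hl (fun hlj => ?_) y
      obtain ⟨c, level, hc, hle⟩ := h.ambient
      have h1 := ((hle _ _).1 hil).resolve_left (Ne.symm hli)
      have h2 := ((hle _ _).1 hlj).resolve_left hli
      omega))
  obtain ⟨ε⟩ := h.standard_equiv hl j
  obtain ⟨c, hc⟩ := WA.end_standard h.ambient (hend j)
    (ε.toLinearMap ∘ₗ F ∘ₗ ε.symm.toLinearMap)
  have h2 := hc (ε (Submodule.Quotient.mk 1))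
  simp only [LinearMap.comp_apply, LinearEquiv.coe_coe, LinearEquiv.symm_apply_apply, hF,
    one_smul, ← map_smul] at h2
  refine ⟨c, (Submodule.Quotient.eq _).1 ((ε.injective h2).trans ?_)⟩
  rw [← Submodule.Quotient.mk_smul, smul_eq_mul, mul_one]

/-- The simple module `L i` is generated by a vector of `e i L`, and only weights `j ⊴ i` occur
in it. -/
theorem IsExactBorel.exists_generator (h : IsExactBorel (φ : B →+* A) WA WB le)
    (hl : IsLabelled WB q e) (i : I) : ∃ v : WA.L i, v ≠ 0 ∧ φ (e i) • v = v ∧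
      (∀ a ∈ borelIdeal φ q i, a • v = 0) ∧ ∀ j (y : WA.L i), φ (e j) • y ≠ 0 → le j i := by
  have := WA.simple i
  obtain ⟨ε⟩ := h.standard_equiv hl i
  let F : (A ⧸ borelIdeal φ q i) →ₗ[A] WA.L i :=
    (WA.traceSum le i).liftQ (WA.π i) (WA.traceSum_le_ker (h.refl i)) ∘ₗ ε.toLinearMap
  have hG : Function.Surjective
      ((WA.traceSum le i).liftQ (WA.π i) (WA.traceSum_le_ker (h.refl i))) := fun y => by
    obtain ⟨x, rfl⟩ := WA.π_surjective i y
    exact ⟨Submodule.Quotient.mk x, rfl⟩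
  have hF : Function.Surjective F := hG.comp ε.surjective
  have hv : ∀ a, F (Submodule.Quotient.mk a) = a • F (Submodule.Quotient.mk 1) := by
    intro a
    rw [← map_smul, ← Submodule.Quotient.mk_smul, smul_eq_mul, mul_one]
  have hK : ∀ a ∈ borelIdeal φ q i, a • F (Submodule.Quotient.mk 1) = 0 := by
    intro a ha
    rw [← hv, (Submodule.Quotient.mk_eq_zero _).2 ha, map_zero]
  refine ⟨F (Submodule.Quotient.mk 1), fun h0 => ?_, ?_, hK, fun j y hy => ?_⟩
  · have := IsSimpleModule.nontrivial A (WA.L i)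
    obtain ⟨y, hy⟩ := exists_ne (0 : WA.L i)
    obtain ⟨x, rfl⟩ := hF y
    obtain ⟨a, rfl⟩ := Submodule.Quotient.mk_surjective _ x
    exact hy (by rw [hv, h0, smul_zero])
  · have h1 := hK (1 * φ (1 - e i)) (mem_borelIdeal 1 (by
      rw [map_sub, map_one, hl.q_e, Pi.sub_apply, Pi.single_eq_same, Pi.one_apply, sub_self]))
    rw [one_mul, map_sub, map_one, sub_smul, one_smul, sub_eq_zero] at h1
    exact h1.symm
  · by_contra hji
    obtain ⟨x, rfl⟩ := hF y
    obtain ⟨a, rfl⟩ := Submodule.Quotient.mk_surjective _ x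
    refine hy ?_
    rw [hv, ← mul_smul]
    exact hK _ (h.e_mul_mem hl hji a)

end ExactBorel

end ReedyAlg

namespace ReedyAlg

variable {k : Type u} [Field k]

/-! ### The dimension formula of an exact Borel subalgebra -/

section Dimension

variable {A B : Type v} [Ring A] [Ring B] [Algebra k A] [Algebra k B] [FiniteDimensional k A]
  [FiniteDimensional k B] {φ : B →ₐ[k] A} {I : Type} [Fintype I] [DecidableEq I]
  {WA : WeightSystem A I} {WB : WeightSystem B I} {le : I → I → Prop} {q : B →ₐ[k] (I → k)}
  {e : I → B}

/-- Exactness at J in 0 → J → B, composed with the identification of A ⊗_B B with A. -/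
theorem IsExactBorel.exists_mul_injective (h : IsExactBorel (φ : B →+* A) WA WB le) (J : Ideal B) :
    ∃ μ : Induced (φ : B →+* A) J →ₗ[A] A, Function.Injective μ ∧
      ∀ t (y : J), μ (Induced.tmul (φ : B →+* A) t y) = t * φ y := by
  obtain ⟨μ, hμ⟩ := Induced.exists_lift (φ : B →+* A) (M := J) (P := A)
    ((φ : B →+* A).toAddMonoidHom.comp J.subtype.toAddMonoidHom) (fun r m => by simp)
  refine ⟨μ, (injective_iff_map_eq_zero μ).2 fun z hz => ?_, hμ⟩
  have h1 : ∀ z, Induced.map (φ : B →+* A) J.subtype z =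
      Induced.tmul (φ : B →+* A) (μ z) (1 : B) := by
    intro z
    induction z using Induced.induction with
    | tmul t y =>
      rw [Induced.map_tmul, hμ]
      refine Eq.trans ?_ (Induced.mul_tmul (φ : B →+* A) t (y : B) (1 : B)).symm
      rw [smul_eq_mul, mul_one, Submodule.subtype_apply]
    | add x y hx hy => rw [map_add, map_add, hx, hy, Induced.add_tmul]
  have := IsNoetherianRing.of_finite k B
  have h0 : ∀ w, Induced.map (φ : B →+* A) (0 : PUnit.{v + 1} →ₗ[B] J) w = 0 := by
    intro w
    induction w using Induced.induction with
    | tmul t m => exact Induced.tmul_zero _ _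
    | add x y hx hy => rw [map_add, hx, hy, add_zero]
  have h2 := h.exact (ModuleCat.of B PUnit) (ModuleCat.of B J) (ModuleCat.of B B)
    (0 : PUnit.{v + 1} →ₗ[B] J) J.subtype (by
      intro y
      constructor
      · intro hy
        exact ⟨0, (Subtype.ext hy).symm⟩
      · rintro ⟨w, rfl⟩
        rfl)
  obtain ⟨w, rfl⟩ := (h2 z).1 ((h1 z).trans (by rw [hz, Induced.zero_tmul]))
  exact h0 w

theorem finrank_quotient_map_mkQ {U₀ U : Ideal A} (h : U₀ ≤ U) :
    Module.finrank k (A ⧸ U₀) = Module.finrank k (A ⧸ U) + Module.finrank k (Submodule.map U₀.mkQ U) := by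
  have h1 := Submodule.finrank_quotient_add_finrank ((Submodule.map U₀.mkQ U).restrictScalars k)
  rw [← h1]
  congr 1
  exact ((Submodule.quotientQuotientEquivQuotient U₀ U h).restrictScalars k).finrank_eq

/-- The composition factors of the regular module, and how they induce. -/
theorem IsExactBorel.finrank_step (h : IsExactBorel (φ : B →+* A) WA WB le)
    (hl : IsLabelled WB q e) {J₀ J : Ideal B} (hJ : J₀ ⋖ J) :
    ∃ j, Module.finrank k (A ⧸ J₀.map (φ : B →+* A)) =
        Module.finrank k (A ⧸ J.map (φ : B →+* A)) + Module.finrank k (A ⧸ borelIdeal φ q j) ∧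
      ∀ i, Module.finrank k ((J.restrictScalars k).map (LinearMap.mulLeft k (e i))) =
        Module.finrank k ((J₀.restrictScalars k).map (LinearMap.mulLeft k (e i))) +
          if i = j then 1 else 0 := by
  have hsimple : IsSimpleModule B (J ⧸ J₀.submoduleOf J) := covBy_iff_quot_is_simple hJ.le |>.1 hJ
  obtain ⟨j, hj⟩ := hl.exists_actsBy (J ⧸ J₀.submoduleOf J)
  obtain ⟨y, hyJ, hy⟩ := SetLike.exists_of_lt hJ.lt
  set x := e j * y with hx
  have hxJ : x ∈ J := J.mul_mem_left _ hyJ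
  have hex : e j * x = x := by rw [hx, ← mul_assoc, hl.e_mul_self]
  let v : J ⧸ J₀.submoduleOf J := Submodule.Quotient.mk ⟨x, hxJ⟩
  have hmk : ∀ z : J, (Submodule.Quotient.mk z : J ⧸ J₀.submoduleOf J) = 0 ↔ (z : B) ∈ J₀ :=
    fun z => Submodule.Quotient.mk_eq_zero _
  have hv : v ≠ 0 := by
    have h1 : v = Submodule.Quotient.mk ⟨y, hyJ⟩ :=
      hj.e_smul hl.toIsSplit (Submodule.Quotient.mk ⟨y, hyJ⟩)
    rw [h1, Ne, hmk]
    exact hy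
  have hx0 : x ∉ J₀ := fun h0 => hv ((hmk _).2 h0)
  have hbx : ∀ b, q b j = 0 → b * x ∈ J₀ := fun b hb =>
    (hmk (b • (⟨x, hxJ⟩ : J))).1 ((hj.ker_toSpanSingleton hv b).2 hb)
  have hspan : ∀ z ∈ J, ∃ c : k, z - c • x ∈ J₀ := by
    intro z hz
    obtain ⟨b, hb⟩ := IsSimpleModule.toSpanSingleton_surjective B hv (Submodule.Quotient.mk ⟨z, hz⟩)
    refine ⟨q b j, ?_⟩
    rw [Algebra.smul_def]
    refine (hmk ((⟨z, hz⟩ : J) - algebraMap k B (q b j) • (⟨x, hxJ⟩ : J))).1 ?_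
    rw [Submodule.Quotient.mk_sub, ← hb, LinearMap.toSpanSingleton_apply, hj b v]
    exact sub_self _
  refine ⟨j, ?_, fun i => ?_⟩
  · rw [finrank_quotient_map_mkQ (k := k) (Ideal.map_mono (f := (φ : B →+* A)) hJ.le)]
    congr 1
    let F : A →ₗ[A] A ⧸ J₀.map (φ : B →+* A) :=
      LinearMap.toSpanSingleton A _ (Submodule.Quotient.mk (φ x))
    have hF : ∀ t, F t = Submodule.Quotient.mk (t * φ x) := fun _ => rfl
    have hrange : LinearMap.range F =
        Submodule.map (J₀.map (φ : B →+* A)).mkQ (J.map (φ : B →+* A)) := by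
      refine le_antisymm ?_ (Submodule.map_le_iff_le_comap.2 (Ideal.map_le_iff_le_comap.2 ?_))
      · rintro _ ⟨t, rfl⟩
        exact ⟨t * φ x, Ideal.mul_mem_left _ _ (Ideal.mem_map_of_mem (φ : B →+* A) hxJ), rfl⟩
      · intro z hz
        obtain ⟨c, hc⟩ := hspan z hz
        refine ⟨algebraMap k A c, (hF _).trans ((Submodule.Quotient.eq _).2 ?_)⟩
        have h1 := Ideal.mem_map_of_mem (φ : B →+* A) hc
        rw [← neg_mem_iff, neg_sub]
        simpa [Algebra.smul_def] using h1
    -- If t φ(x) lies in A J₀, then injectivity of A ⊗ J → A shows that t ⊗ x comes from A ⊗ J₀. Its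
    -- image in A ⊗ (J / J₀), which maps to A modulo the Borel ideal by sending t ⊗ x to t, is
    -- therefore zero.
    have hker : LinearMap.ker F = borelIdeal φ q j := by
      refine le_antisymm (fun t ht => ?_) (borelIdeal_le fun b hb => ?_)
      · have h1 : t * φ x ∈ J₀.map (φ : B →+* A) := (Submodule.Quotient.mk_eq_zero _).1 ht
        obtain ⟨μ, hμ, hμ'⟩ := h.exists_mul_injective J
        obtain ⟨μ₀, -, hμ₀⟩ := h.exists_mul_injective J₀
        have h2 : J₀.map (φ : B →+* A) ≤ LinearMap.range μ₀ :=
          Ideal.map_le_iff_le_comap.2 fun b hb =>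
            ⟨Induced.tmul (φ : B →+* A) 1 ⟨b, hb⟩, by rw [hμ₀, one_mul]; rfl⟩
        obtain ⟨w, hw⟩ := h2 h1
        obtain ⟨Ψ, hΨ⟩ := hj.exists_lift_borelIdeal (φ := φ) hv
        have h3 : ∀ w, μ (Induced.map (φ : B →+* A) (Submodule.inclusion hJ.le) w) = μ₀ w := by
          intro w
          induction w using Induced.induction with
          | tmul t m => rw [Induced.map_tmul, hμ', hμ₀]; rfl
          | add x y hx hy => rw [map_add, map_add, map_add, hx, hy]
        have h4 : ∀ w, Induced.map (φ : B →+* A) (J₀.submoduleOf J).mkQ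
            (Induced.map (φ : B →+* A) (Submodule.inclusion hJ.le) w) = 0 := by
          intro w
          induction w using Induced.induction with
          | tmul t m =>
            rw [Induced.map_tmul, Induced.map_tmul]
            have : (J₀.submoduleOf J).mkQ (Submodule.inclusion hJ.le m) = 0 := (hmk _).2 m.2
            rw [this, Induced.tmul_zero]
          | add x y hx hy => rw [map_add, map_add, hx, hy, add_zero]
        have h5 : Induced.map (φ : B →+* A) (Submodule.inclusion hJ.le) w =
            Induced.tmul (φ : B →+* A) t ⟨x, hxJ⟩ := hμ (by rw [h3, hw, hμ'])
        have h6 := hΨ t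
        rw [← Submodule.Quotient.mk_eq_zero, ← h6]
        have h7 := h4 w
        rw [h5, Induced.map_tmul] at h7
        exact (congrArg Ψ h7).trans (map_zero Ψ)
      · refine (Submodule.Quotient.mk_eq_zero _).2 ?_
        change φ b * φ x ∈ _
        rw [← map_mul]
        exact Ideal.mem_map_of_mem (φ : B →+* A) (hbx b hb)
    rw [← hrange, ← hker]
    exact (F.quotKerEquivRange.restrictScalars k).finrank_eq.symm
  · have h1 : J.restrictScalars k = J₀.restrictScalars k ⊔ Submodule.span k {x} := by
      refine le_antisymm (fun z hz => ?_) (sup_le (fun z hz => hJ.le hz)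
        ((Submodule.span_singleton_le_iff_mem _ _).2 hxJ))
      obtain ⟨c, hc⟩ := hspan z hz
      exact Submodule.mem_sup.2 ⟨_, hc, c • x, Submodule.mem_span_singleton.2 ⟨c, rfl⟩, by abel⟩
    rw [h1, Submodule.map_sup, Submodule.map_span, Set.image_singleton, LinearMap.mulLeft_apply]
    by_cases hij : i = j
    · subst hij
      rw [hex, if_pos rfl, Submodule.finrank_sup_span_singleton]
      rintro ⟨z, hz, hz'⟩
      exact hx0 (hz' ▸ J₀.mul_mem_left _ hz)
    · have h2 : e i * x = 0 := by rw [← hex, ← mul_assoc, hl.e_mul_e, if_neg hij, zero_mul]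
      rw [h2, Submodule.span_zero_singleton, sup_bot_eq, if_neg hij, add_zero]

/-- Induction along left ideals of B: a composition factor of weight j adds dim Δ(j) to the induced
module and 1 to the dimension of the e_j-component. -/
theorem IsExactBorel.finrank_eq (h : IsExactBorel (φ : B →+* A) WA WB le)
    (hl : IsLabelled WB q e) :
    Module.finrank k A = ∑ j, Module.finrank k (A ⧸ borelIdeal φ q j) *
      Module.finrank k (LinearMap.range (LinearMap.mulLeft k (e j))) := by
  have := IsNoetherianRing.of_finite k B
  have := IsArtinianRing.of_finite k B
  have key : ∀ J : Ideal B, Module.finrank k A =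
      Module.finrank k (A ⧸ J.map (φ : B →+* A)) +
        ∑ j, Module.finrank k (A ⧸ borelIdeal φ q j) *
          Module.finrank k ((J.restrictScalars k).map (LinearMap.mulLeft k (e j))) := by
    intro J
    induction J using WellFoundedLT.induction with
    | ind J ih =>
      by_cases hJ : J = ⊥
      · subst hJ
        have h1 : (⊥ : Ideal B).map (φ : B →+* A) = ⊥ := Ideal.map_bot
        rw [h1, Submodule.restrictScalars_bot]
        have h2 : ∀ j, Module.finrank k
            ((⊥ : Submodule k B).map (LinearMap.mulLeft k (e j))) = 0 := fun j => by
          rw [Submodule.map_bot, finrank_bot]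
        simp only [h2, mul_zero, Finset.sum_const_zero, add_zero]
        exact ((Submodule.quotEquivOfEqBot (⊥ : Ideal A) rfl).restrictScalars k).finrank_eq.symm
      · obtain ⟨J₀, -, hJ₀⟩ := exists_le_covBy_of_lt (bot_lt_iff_ne_bot.2 hJ)
        obtain ⟨j, h1, h2⟩ := h.finrank_step hl hJ₀
        rw [ih J₀ hJ₀.lt, h1]
        simp only [h2, mul_add, Finset.sum_add_distrib, mul_ite, mul_one, mul_zero,
          Finset.sum_ite_eq', Finset.mem_univ, if_true]
        ring
  have h1 := key ⊤
  rw [Ideal.map_top, Submodule.restrictScalars_top] at h1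
  have h3 : ∀ j, Module.finrank k ((⊤ : Submodule k B).map (LinearMap.mulLeft k (e j))) =
      Module.finrank k (LinearMap.range (LinearMap.mulLeft k (e j))) := fun j => by
    rw [Submodule.map_top]
  simp only [h3] at h1
  have h2 : Module.finrank k (A ⧸ (⊤ : Ideal A)) = 0 := Module.finrank_zero_of_subsingleton
  rwa [h2, zero_add] at h1

end Dimension
end ReedyAlg

namespace ReedyAlg

variable {k : Type u} [Field k]

/-! ### Dual modules, Nakayama's lemma and images of radicals -/

section Dual

variable {R : Type v} [Ring R] [Algebra k R] {M N : Type v} [AddCommGroup M] [Module R M]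
  [AddCommGroup N] [Module Rᵐᵒᵖ N]

theorem IsDualModule.exists_pairing (h : IsDualModule k R M N) : ∃ p : N →+ M →+ k,
    Function.Injective p ∧ (∀ (x : N) (a : k) (m : M), p x (algebraMap k R a • m) = a * p x m) ∧
    ∀ (x : N) (r : R) (m : M), p (MulOpposite.op r • x) m = p x (r • m) := by
  obtain ⟨p, h1, h2, h3⟩ := h
  refine ⟨p, fun x y hxy => ?_, h1, h2⟩
  obtain ⟨z, -, hz⟩ := h3 (p y) (h1 y)
  exact (hz x hxy).trans (hz y rfl).symm

theorem IsDualModule.actsBy (h : IsDualModule k R M N) {I : Type} {q : R →ₐ[k] (I → k)} {i : I}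
    (hM : ActsBy q i M) : ActsBy (q.fromOpposite fun _ _ => mul_comm _ _) i N := by
  obtain ⟨p, hp, h1, h2⟩ := h.exists_pairing
  intro r x
  refine hp (AddMonoidHom.ext fun m => ?_)
  have h3 := h2 x r.unop m
  rw [MulOpposite.op_unop] at h3
  rw [h3, hM]
  exact (h2 x (algebraMap k R (q r.unop i)) m).symm

end Dual

section Nakayama

variable {A : Type v} [Ring A] [Algebra k A]

theorem eq_top_of_le_sup_mul {N Y : Submodule k A} {n : ℕ} (hN : N ^ n = ⊥) (hY : N * Y ≤ Y)
    (h : ⊤ ≤ Y ⊔ N * ⊤) : Y = ⊤ := by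
  have h1 : ∀ m, N ^ m * Y ≤ Y := by
    intro m
    induction m with
    | zero => rw [pow_zero, one_mul]
    | succ m ih => rw [pow_succ, mul_assoc]; exact (mul_le_mul' le_rfl hY).trans ih
  have h2 : ∀ m, ⊤ ≤ Y ⊔ N ^ m * ⊤ := by
    intro m
    induction m with
    | zero => rw [pow_zero, one_mul]; exact le_sup_right
    | succ m ih =>
      refine ih.trans (sup_le le_sup_left ((mul_le_mul' le_rfl h).trans ?_))
      rw [Submodule.mul_sup, ← mul_assoc, ← pow_succ]
      exact sup_le_sup (h1 m) le_rfl
  have := h2 n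
  rwa [hN, Submodule.bot_mul, sup_bot_eq, top_le_iff] at this

theorem eq_top_of_le_sup_mul_right {N Y : Submodule k A} {n : ℕ} (hN : N ^ n = ⊥)
    (hY : Y * N ≤ Y) (h : ⊤ ≤ Y ⊔ ⊤ * N) : Y = ⊤ := by
  have h1 : ∀ m, Y * N ^ m ≤ Y := by
    intro m
    induction m with
    | zero => rw [pow_zero, mul_one]
    | succ m ih => rw [pow_succ', ← mul_assoc]; exact (mul_le_mul' hY le_rfl).trans ih
  have h2 : ∀ m, ⊤ ≤ Y ⊔ ⊤ * N ^ m := by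
    intro m
    induction m with
    | zero => rw [pow_zero, mul_one]; exact le_sup_right
    | succ m ih =>
      refine ih.trans (sup_le le_sup_left ((mul_le_mul' h le_rfl).trans ?_))
      rw [Submodule.sup_mul, mul_assoc, ← pow_succ']
      exact sup_le_sup (h1 m) le_rfl
  have := h2 n
  rwa [hN, Submodule.mul_bot, sup_bot_eq, top_le_iff] at this

end Nakayama

section RadImage

variable {A B : Type v} [Ring A] [Ring B] [Algebra k A] [Algebra k B] {I : Type}

/-- The image in `A` of the kernel of `q`. -/
def radImage (φ : B →ₐ[k] A) (q : B →ₐ[k] (I → k)) : Submodule k A :=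
  (LinearMap.ker q.toLinearMap).map φ.toLinearMap

theorem mem_radImage {φ : B →ₐ[k] A} {q : B →ₐ[k] (I → k)} {b : B} (hb : q b = 0) :
    φ b ∈ radImage φ q := ⟨b, hb, rfl⟩

theorem IsSplit.exists_radImage_pow_eq_bot [Fintype I] [DecidableEq I] [FiniteDimensional k B]
    {φ : B →ₐ[k] A} {q : B →ₐ[k] (I → k)} {e : I → B} (h : IsSplit q e) :
    ∃ n, radImage φ q ^ n = ⊥ := by
  obtain ⟨n, hn⟩ := h.exists_ker_pow_eq_bot
  exact ⟨n, by rw [radImage, ← Submodule.map_pow, hn, Submodule.map_bot]⟩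

/-- The maximal ideal of B of weight j becomes part of the radical after right multiplication by
e_j. -/
theorem mul_mem_of_mem_borelIdeal [Fintype I] [DecidableEq I] {φ : B →ₐ[k] A}
    {q : B →ₐ[k] (I → k)} {e : I → B} (h : IsSplit q e) {j : I} {x : A}
    (hx : x ∈ borelIdeal φ q j) : x * φ (e j) ∈ (⊤ : Submodule k A) * radImage φ q := by
  refine Submodule.span_induction (p := fun x _ => x * φ (e j) ∈ (⊤ : Submodule k A) *
    radImage φ q) ?_ (by simp) (fun x y _ _ hx hy => by rw [add_mul]; exact add_mem hx hy) ?_ hx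
  · rintro _ ⟨b, hb, rfl⟩
    rw [← one_mul ((φ : B →+* A) b * φ (e j))]
    refine Submodule.mul_mem_mul Submodule.mem_top ?_
    change φ b * φ (e j) ∈ _
    rw [← map_mul]
    refine mem_radImage ?_
    have hb' : q b j = 0 := mem_coordKer.1 hb
    rw [map_mul, h.q_e]
    ext l
    by_cases hl : l = j
    · subst hl; simp [hb']
    · simp [hl]
  · intro a x _ hx
    rw [smul_eq_mul, mul_assoc]
    refine Submodule.mul_induction_on hx (fun m _ n hn => ?_) fun x y hx hy => ?_
    · rw [← mul_assoc]
      exact Submodule.mul_mem_mul Submodule.mem_top hn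
    · rw [mul_add]
      exact add_mem hx hy

theorem unop_mem_of_mem_radImage {C : Type v} [Ring C] [Algebra k C] {γ : C →ₐ[k] A}
    {q : C →ₐ[k] (I → k)} {z : Aᵐᵒᵖ} (hz : z ∈ (⊤ : Submodule k Aᵐᵒᵖ) *
      radImage (AlgHom.op γ) (q.fromOpposite fun _ _ => mul_comm _ _)) :
    z.unop ∈ radImage γ q * (⊤ : Submodule k A) := by
  refine Submodule.mul_induction_on hz (fun m _ n hn => ?_) fun x y hx hy => ?_
  · obtain ⟨c, hc, rfl⟩ := hn
    exact Submodule.mul_mem_mul (mem_radImage (φ := γ) (b := c.unop) hc) Submodule.mem_top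
  · exact add_mem hx hy

end RadImage

end ReedyAlg

namespace ReedyAlg

variable {k : Type u} [Field k]

/-! ### Filtration by levels and dimension estimates -/

section ExactBorel

variable {A B : Type v} [Ring A] [Ring B] [Algebra k A] [Algebra k B] [FiniteDimensional k A]
  [FiniteDimensional k B] {φ : B →ₐ[k] A} {I : Type} [Fintype I] [DecidableEq I]
  {WA : WeightSystem A I} {WB : WeightSystem B I} {le : I → I → Prop} {q : B →ₐ[k] (I → k)}
  {e : I → B} {level : I → ℕ}

theorem IsExactBorel.dir (h : IsExactBorel (φ : B →+* A) WA WB le) (hl : IsLabelled WB q e)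
    (hle : ∀ i j, le i j ↔ i = j ∨ level j < level i) {i j : I} {b : B} (hij : i ≠ j)
    (hb : e j * b * e i ≠ 0) : level j < level i :=
  ((hle i j).1 (hl.directed_of_simple h.quasiHereditary h.isSimpleModule_standard hij
    hb)).resolve_left hij

theorem IsExactBorel.map_mul_e_mem (h : IsExactBorel (φ : B →+* A) WA WB le)
    (hl : IsLabelled WB q e) (hle : ∀ i j, le i j ↔ i = j ∨ level j < level i) {j : I} {b : B}
    (hb : q b = 0) : φ (b * e j) ∈ idealLT (φ ∘ e) level (level j) := by
  have h1 : b * e j = ∑ l, e l * b * e j := by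
    rw [← Finset.sum_mul, ← Finset.sum_mul, hl.complete.complete, one_mul]
  rw [h1, map_sum]
  refine sum_mem fun l _ => ?_
  by_cases h0 : e l * b * e j = 0
  · rw [h0, map_zero]; exact zero_mem _
  · by_cases hlj : l = j
    · subst hlj
      obtain ⟨a, ha⟩ := hl.corner_of_simple h.quasiHereditary h.isSimpleModule_standard l b
      have h2 := congrFun (congrArg q ha) l
      simp only [map_mul, hb, mul_zero, zero_mul, Pi.zero_apply, map_smul, hl.q_e, Pi.smul_apply,
        Pi.single_eq_same, smul_eq_mul, mul_one] at h2
      exact absurd (by rw [ha, ← h2, zero_smul]) h0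
    · rw [mul_assoc, map_mul]
      exact mul_mem_idealLT (e := φ ∘ e) (h.dir hl hle (Ne.symm hlj) h0) _

/-- Modulo lower levels A e_j is the image of a linear section of A → Δ(j), because rad B e_j passes
through idempotents of lower level. This bounds the contribution of j to dim A. -/
theorem IsExactBorel.exists_section (h : IsExactBorel (φ : B →+* A) WA WB le)
    (hl : IsLabelled WB q e) (hle : ∀ i j, le i j ↔ i = j ∨ level j < level i) (j : I) :
    ∃ σ : (A ⧸ borelIdeal φ q j) →ₗ[k] A,
      ∀ x, ∃ u, x * φ (e j) - σ u ∈ idealLT (φ ∘ e) level (level j) := by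
  let p : A →ₗ[k] A ⧸ borelIdeal φ q j := (borelIdeal φ q j).mkQ.restrictScalars k
  obtain ⟨s, hs⟩ := p.exists_rightInverse_of_surjective
    (LinearMap.range_eq_top.2 (Submodule.mkQ_surjective (borelIdeal φ q j)))
  refine ⟨LinearMap.mulRight k (φ (e j)) ∘ₗ s, fun x => ⟨Submodule.Quotient.mk x, ?_⟩⟩
  have h1 : x - s (Submodule.Quotient.mk x) ∈ borelIdeal φ q j :=
    (Submodule.Quotient.eq _).1 (LinearMap.congr_fun hs (Submodule.Quotient.mk x)).symm
  have h2 : ∀ z ∈ (⊤ : Submodule k A) * radImage φ q,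
      z * φ (e j) ∈ idealLT (φ ∘ e) level (level j) := by
    intro z hz
    refine Submodule.mul_induction_on hz (fun m _ n hn => ?_) fun x y hx hy => ?_
    · obtain ⟨b, hb, rfl⟩ := hn
      rw [mul_assoc]
      refine Ideal.mul_mem_left _ _ ?_
      change φ b * φ (e j) ∈ _
      rw [← map_mul]
      exact h.map_mul_e_mem hl hle hb
    · rw [add_mul]
      exact add_mem hx hy
  have h3 := h2 _ (mul_mem_of_mem_borelIdeal hl.toIsSplit h1)
  rw [mul_assoc, ← map_mul, hl.e_mul_self, sub_mul] at h3
  exact h3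

theorem IsExactBorel.sub_mem_mul_radImage (h : IsExactBorel (φ : B →+* A) WA WB le)
    (hl : IsLabelled WB q e)
    (hend : ∀ i (f : WA.L i →ₗ[A] WA.L i), ∃ a : k, ∀ x, f x = algebraMap k A a • x)
    (j : I) (a : A) :
    ∃ c : k, φ (e j) * a * φ (e j) - c • φ (e j) ∈ (⊤ : Submodule k A) * radImage φ q := by
  obtain ⟨c, hc⟩ := h.exists_sub_mem hl hend j a
  refine ⟨c, ?_⟩
  have := mul_mem_of_mem_borelIdeal hl.toIsSplit hc
  rwa [sub_mul, ← Algebra.smul_def] at this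

end ExactBorel

theorem finrank_tensor_sum_le {ι : Type*} [Fintype ι] {A : Type*} [Ring A] [Algebra k A]
    {U V : ι → Type*} [∀ i, AddCommGroup (U i)] [∀ i, Module k (U i)]
    [∀ i, FiniteDimensional k (U i)] [∀ i, AddCommGroup (V i)] [∀ i, Module k (V i)]
    [∀ i, FiniteDimensional k (V i)] (σ : ∀ i, U i →ₗ[k] A) (τ : ∀ i, V i →ₗ[k] A)
    (h : ∀ x, x ∈ Submodule.span k {z | ∃ i u v, z = σ i u * τ i v}) :
    Module.finrank k A ≤ ∑ i, Module.finrank k (U i) * Module.finrank k (V i) := by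
  classical
  let F : ((i : ι) → U i ⊗[k] V i) →ₗ[k] A :=
    ∑ i, TensorProduct.lift ((LinearMap.mul k A).compl₁₂ (σ i) (τ i)) ∘ₗ LinearMap.proj i
  have hF : ∀ i u v, F (Pi.single i (u ⊗ₜ v)) = σ i u * τ i v := by
    intro i u v
    rw [LinearMap.sum_apply, Finset.sum_eq_single i]
    · simp
    · intro j _ hj
      simp [Pi.single_eq_of_ne hj]
    · simp
  have hsurj : LinearMap.range F = ⊤ := by
    refine eq_top_iff.2 fun x _ => Submodule.span_le.2 ?_ (h x)
    rintro _ ⟨i, u, v, rfl⟩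
    exact ⟨_, hF i u v⟩
  have h1 := LinearMap.finrank_range_le F
  rw [hsurj, finrank_top, Module.finrank_pi_fintype] at h1
  simpa only [Module.finrank_tensorProduct] using h1

section Counting

variable {A : Type v} [Ring A] [Algebra k A] [FiniteDimensional k A] {B C : Subalgebra k A}
  {I : Type} [Fintype I] [DecidableEq I] {e : I → A} {f : I → B} {g : I → C}
  {qB : B →ₐ[k] (I → k)} {qC : C →ₐ[k] (I → k)} {level : I → ℕ}

/-- The hypothesis gives A = C + A rad B + rad C A. Nilpotency of rad C removes the last term, and
then nilpotency of rad B yields A = C B. -/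
theorem mem_span_mul_of_radImage (hB : IsSplit qB f) (hC : IsSplit qC g)
    (he : CompleteOrthogonalIdempotents e) (hg : ∀ i, (g i : A) = e i)
    (hA : ∀ i j a, ∃ c : k, e i * a * e j - c • e j ∈
      (⊤ : Submodule k A) * radImage B.val qB ⊔ radImage C.val qC * ⊤) (r : A) :
    r ∈ Submodule.span k {x | ∃ c b, x = C.val c * B.val b} := by
  obtain ⟨n, hn⟩ := hB.exists_radImage_pow_eq_bot (φ := B.val)
  obtain ⟨m, hm⟩ := hC.exists_radImage_pow_eq_bot (φ := C.val)
  have hBle : radImage B.val qB ≤ Subalgebra.toSubmodule B := by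
    rintro _ ⟨b, -, rfl⟩
    exact b.2
  have hCle : radImage C.val qC ≤ Subalgebra.toSubmodule C := by
    rintro _ ⟨c, -, rfl⟩
    exact c.2
  have h1 : Subalgebra.toSubmodule C ⊔ (⊤ : Submodule k A) * radImage B.val qB = ⊤ := by
    refine eq_top_of_le_sup_mul hm ?_ ?_
    · rw [Submodule.mul_sup, ← mul_assoc]
      refine sup_le_sup ((mul_le_mul' hCle le_rfl).trans ?_) (mul_le_mul' le_top le_rfl)
      exact Submodule.mul_le.2 fun x hx y hy => C.mul_mem hx hy
    · intro x _
      have h2 : x = ∑ i, ∑ j, e i * x * e j := by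
        simp only [← Finset.mul_sum, ← Finset.sum_mul, he.complete, mul_one, one_mul]
      rw [h2]
      refine sum_mem fun i _ => sum_mem fun j _ => ?_
      obtain ⟨c, hc⟩ := hA i j x
      rw [← sub_add_cancel (e i * x * e j) (c • e j)]
      refine add_mem ?_ ?_
      · rw [sup_assoc]
        exact Submodule.mem_sup_right hc
      · refine Submodule.mem_sup_left (Submodule.mem_sup_left ?_)
        rw [← hg]
        exact Submodule.smul_mem _ c (g j).2
  have h2 : Subalgebra.toSubmodule C * Subalgebra.toSubmodule B = ⊤ := by
    refine eq_top_of_le_sup_mul_right hn ?_ ?_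
    · rw [mul_assoc]
      refine mul_le_mul' le_rfl ((mul_le_mul' le_rfl hBle).trans ?_)
      exact Submodule.mul_le.2 fun x hx y hy => B.mul_mem hx hy
    · rw [← h1]
      refine sup_le_sup (fun c hc => ?_) (by rw [h1])
      rw [← mul_one c]
      exact Submodule.mul_mem_mul hc B.one_mem
  have h3 : r ∈ Subalgebra.toSubmodule C * Subalgebra.toSubmodule B := h2 ▸ Submodule.mem_top
  refine Submodule.mul_induction_on h3 (fun c hc b hb => ?_) fun x y hx hy => add_mem hx hy
  exact Submodule.subset_span ⟨⟨c, hc⟩, ⟨b, hb⟩, rfl⟩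

/-- B acts on the generator of Δ(j) by scalars, so A = C B makes C g_j map onto Δ(j). -/
theorem finrank_borelIdeal_le (hB : IsSplit qB f) (hf : ∀ i, (f i : A) = e i)
    (hg : ∀ i, (g i : A) = e i)
    (hspan : ∀ r, r ∈ Submodule.span k {x | ∃ c b, x = C.val c * B.val b}) (j : I) :
    Module.finrank k (A ⧸ borelIdeal B.val qB j) ≤
      Module.finrank k (LinearMap.range (LinearMap.mulRight k (g j))) := by
  let F : LinearMap.range (LinearMap.mulRight k (g j)) →ₗ[k] A ⧸ borelIdeal B.val qB j :=
    (borelIdeal B.val qB j).mkQ.restrictScalars k ∘ₗ C.val.toLinearMap ∘ₗ Submodule.subtype _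
  have hF : LinearMap.range F = ⊤ := by
    refine eq_top_iff.2 fun x _ => ?_
    obtain ⟨r, rfl⟩ := Submodule.Quotient.mk_surjective _ x
    have hr := hspan r
    induction hr using Submodule.span_induction with
    | mem r hr =>
      obtain ⟨c, b, rfl⟩ := hr
      refine ⟨qB b j • ⟨c * g j, c, rfl⟩, (Submodule.Quotient.eq _).2 ?_⟩
      have h1 : qB (qB b j • f j - b) j = 0 := by
        rw [map_sub, map_smul, hB.q_e]
        simp
      have h2 := mem_borelIdeal (φ := B.val) (C.val c) h1
      have h3 : C.val c * B.val (qB b j • f j - b) =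
          qB b j • (C.val c * C.val (g j)) - C.val c * B.val b := by
        have : C.val (g j) = B.val (f j) := (hg j).trans (hf j).symm
        rw [this, map_sub, map_smul, mul_sub, mul_smul_comm]
      rw [h3] at h2
      exact h2
    | zero => exact zero_mem (LinearMap.range F)
    | add x y _ _ hx hy => exact add_mem (hx Submodule.mem_top) (hy Submodule.mem_top)
    | smul a x _ hx => exact Submodule.smul_mem (LinearMap.range F) a (hx Submodule.mem_top)
  have h1 := LinearMap.finrank_range_le F
  rwa [hF, finrank_top] at h1

/-- The chain d ≤ ∑ a_j a'_j ≤ ∑ a'_j c_j = d consists of equalities, and a'_j > 0 allows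
cancellation to a_j = c_j. -/
theorem eq_of_sum_mul_eq {ι : Type*} [Fintype ι] {a a' b c : ι → ℕ} {d : ℕ}
    (h1 : d = ∑ j, a j * b j) (h2 : d = ∑ j, a' j * c j) (h3 : d ≤ ∑ j, a j * a' j)
    (h4 : ∀ j, a j ≤ c j) (h5 : ∀ j, 0 < a' j) : d = ∑ j, c j * b j := by
  have h6 : ∀ j ∈ Finset.univ, a j * a' j ≤ a' j * c j := fun j _ => by
    rw [mul_comm]
    exact Nat.mul_le_mul_left _ (h4 j)
  have h7 := (Finset.sum_eq_sum_iff_of_le h6).1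
    (le_antisymm (Finset.sum_le_sum h6) (h2 ▸ h3))
  rw [h1]
  refine Finset.sum_congr rfl fun j hj => ?_
  have h8 := h7 j hj
  rw [mul_comm (a j)] at h8
  rw [Nat.eq_of_mul_eq_mul_left (h5 j) h8]

end Counting
end ReedyAlg

namespace ReedyAlg

/-! ### From condition (iii) to a triangular decomposition -/

variable {k : Type u} [Field k] {A : Type v} [Ring A] [Algebra k A] {B C : Subalgebra k A}
  {I : Type} [Fintype I] [DecidableEq I]

/-- Two families of idempotents of `S`, one of them spanning `S`, coincide if their labellings are
compatible with a partial order. -/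
theorem idempotents_eq_of_le {qB : B →ₐ[k] (I → k)} {eB : I → B} {x : I → B}
    (hx : CompleteOrthogonalIdempotents x) (hspan : ∀ i, x i = ∑ j, qB (x i) j • eB j)
    {le : I → I → Prop} {level : I → ℕ} (hle : ∀ i j, le i j ↔ i = j ∨ level j < level i)
    (h : ∀ i, ∃ j, le j i ∧ qB (x i) j ≠ 0) (i : I) : x i = eB i := by
  choose σ hσ hσ0 using h
  have hmul : ∀ i j l, i ≠ j → qB (x i) l * qB (x j) l = 0 := by
    intro i j l hij
    have := congrFun (congrArg qB (hx.ortho hij)) l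
    rwa [map_mul, map_zero] at this
  have hinj : Function.Injective σ := by
    intro i j hij
    by_contra hne
    exact mul_ne_zero (hσ0 i) (hij ▸ hσ0 j) (hmul i j _ hne)
  -- Orthogonality makes σ injective, hence a permutation. It never decreases the level and
  -- preserves the sum of all levels, so it preserves every level; the order then leaves only σ i =
  -- i.
  have hlevel : ∀ i ∈ Finset.univ, level i ≤ level (σ i) := by
    intro i _
    rcases (hle _ _).1 (hσ i) with h1 | h1
    · rw [h1]
    · exact h1.le
  have hsum := (Equiv.ofBijective σ (Finite.injective_iff_bijective.1 hinj)).sum_comp level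
  have heq := (Finset.sum_eq_sum_iff_of_le hlevel).1 hsum.symm
  have hid : ∀ i, σ i = i := by
    intro i
    rcases (hle _ _).1 (hσ i) with h1 | h1
    · exact h1
    · have := heq i (Finset.mem_univ i)
      omega
  simp only [hid] at hσ0
  have h1 : qB (x i) i = 1 := by
    have := congrFun (congrArg qB (hx.idem i).eq) i
    rw [map_mul, Pi.mul_apply] at this
    exact mul_left_cancel₀ (hσ0 i) (by rw [this, mul_one])
  have h2 : ∀ j, j ≠ i → qB (x i) j = 0 := fun j hj =>
    (mul_eq_zero.1 (hmul i j j (Ne.symm hj))).resolve_right (hσ0 j)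
  rw [hspan i, Finset.sum_eq_single i]
  · rw [h1, one_smul]
  · intro j _ hj
    rw [h2 j hj, zero_smul]
  · simp

variable [FiniteDimensional k A]

theorem exists_isTriangular_of_borel (hB : IsElementary k B) (hC : IsElementary k C)
    (hSB : IsMaximalSemisimple (B ⊓ C) B) (hSC : IsMaximalSemisimple (B ⊓ C) C)
    {WA : WeightSystem A I} {WB : WeightSystem B I} {WC : WeightSystem C I} {le : I → I → Prop}
    (hend : ∀ i (f : WA.L i →ₗ[A] WA.L i), ∃ a : k, ∀ x, f x = algebraMap k A a • x)
    (hborel : IsExactBorel (B.val : B →+* A) WA WB le) (hdelta : IsDeltaSubalgebra k C WA WC le) :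
    ∃ (e : I → A) (f : I → B) (g : I → C) (deg : I → ℕ), IsTriangular B.val C.val e f g deg := by
  obtain ⟨qB, f, hlB, -, hspB⟩ := hSB.exists_isLabelled hB WB
  obtain ⟨qC, g, hlC, hgS, -⟩ := hSC.exists_isLabelled hC WC
  obtain ⟨WA', WC', hdA, hdC, hborel'⟩ := hdelta
  obtain ⟨ch, level, -, hle⟩ := id hborel.ambient
  let γ : Cᵐᵒᵖ →ₐ[k] Aᵐᵒᵖ := AlgHom.op C.val
  let qC' : Cᵐᵒᵖ →ₐ[k] (I → k) := qC.fromOpposite fun _ _ => mul_comm _ _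
  have hborel' : IsExactBorel (γ : Cᵐᵒᵖ →+* Aᵐᵒᵖ) WA' WC' le := hborel'
  have hlC' : IsLabelled WC' qC' (MulOpposite.op ∘ g) :=
    { hlC.toIsSplit.op with acts := fun i => (hdC i).actsBy (hlC.acts i) }
  set e : I → A := fun i => (f i : A)
  have he : CompleteOrthogonalIdempotents e := hlB.complete.map (B.val : B →+* A)
  have hgB : ∀ i, (g i : A) ∈ B := fun i => (hgS i).1
  -- The labellings of the idempotents by B and by C are a priori unrelated. By duality g_i acts
  -- nontrivially on the simple A-module of weight i, whereas e_j does so only for j ⊴ i. Hence some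
  -- e_j with j ⊴ i occurs in g_i, as `idempotents_eq_of_le` requires.
  have hg : ∀ i, (g i : A) = e i := by
    let x : I → B := fun i => ⟨g i, hgB i⟩
    have hx : CompleteOrthogonalIdempotents x := by
      have h1 := hlC.complete.map (C.val : C →+* A)
      refine ⟨⟨fun i => Subtype.ext (h1.idem i), fun i j hij => Subtype.ext (h1.ortho hij)⟩, ?_⟩
      refine Subtype.ext ?_
      rw [AddSubmonoidClass.coe_finsetSum]
      exact h1.complete
    intro i
    refine congrArg Subtype.val (idempotents_eq_of_le hx (fun i => hspB (x i) (hgS i)) hle ?_ i)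
    intro i
    obtain ⟨v, hv, hev, hK, hsupp⟩ := hborel.exists_generator (φ := B.val) hlB i
    obtain ⟨v', hv', hev', -, -⟩ := hborel'.exists_generator hlC' i
    obtain ⟨p, hp, -, hp2⟩ := (hdA i).exists_pairing
    have h1 : ∃ m, p v' m ≠ 0 := by
      by_contra! h0
      exact hv' (hp (AddMonoidHom.ext fun m => by rw [h0, map_zero, AddMonoidHom.zero_apply]))
    obtain ⟨m, hm⟩ := h1
    rw [← hev'] at hm
    have h2 : (g i : A) • m ≠ 0 := by
      intro h0
      refine hm ((hp2 v' (g i : A) m).trans ?_)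
      rw [h0, map_zero]
    have h3 : (g i : A) = ∑ j, qB (x i) j • B.val (f j) := by
      have := congrArg B.val (hspB (x i) (hgS i))
      rw [map_sum] at this
      exact this
    rw [h3, Finset.sum_smul] at h2
    obtain ⟨j, -, hj⟩ := Finset.exists_ne_zero_of_sum_ne_zero h2
    refine ⟨j, hsupp j m fun h0 => hj ?_, fun h0 => hj (by rw [h0, zero_smul, zero_smul])⟩
    rw [Algebra.smul_def, mul_smul, h0, smul_zero]
  have hγ : ∀ i, γ (MulOpposite.op (g i)) = MulOpposite.op (e i) := fun i =>
    congrArg MulOpposite.op (hg i)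
  have hγe : ⇑γ ∘ MulOpposite.op ∘ g = MulOpposite.op ∘ e := funext hγ
  -- If i ⋬ j, then e_i Δ(j) = 0 puts the component into A rad B. If i ◁ j, the same argument in the
  -- opposite algebra puts it into rad C A. On the diagonal e_j Δ(j) = k leaves a scalar.
  have hA : ∀ i j a, ∃ c : k, e i * a * e j - c • e j ∈
      (⊤ : Submodule k A) * radImage B.val qB ⊔ radImage C.val qC * ⊤ := by
    intro i j a
    by_cases hij : i = j
    · subst hij
      obtain ⟨c, hc⟩ := hborel.sub_mem_mul_radImage (φ := B.val) hlB hend i a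
      exact ⟨c, Submodule.mem_sup_left hc⟩
    · refine ⟨0, ?_⟩
      rw [zero_smul, sub_zero]
      by_cases hij' : le i j
      · have hji : ¬ le j i := by
          intro h0
          have h1 := ((hle i j).1 hij').resolve_left hij
          have h2 := ((hle j i).1 h0).resolve_left (Ne.symm hij)
          omega
        have h1 := hborel'.e_mul_mem hlC' hji (MulOpposite.op a)
        have h2 := unop_mem_of_mem_radImage (mul_mem_of_mem_borelIdeal hlC'.toIsSplit h1)
        refine Submodule.mem_sup_right ?_
        have h3 : e i * (a * e j) ∈ radImage C.val qC * (⊤ : Submodule k A) := by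
          rw [← hg i, ← hg j]
          exact h2
        rwa [← mul_assoc] at h3
      · exact Submodule.mem_sup_left (mul_mem_of_mem_borelIdeal hlB.toIsSplit
          (hborel.e_mul_mem (φ := B.val) hlB hij' a))
  have hspan := mem_span_mul_of_radImage hlB.toIsSplit hlC.toIsSplit he hg hA
  have hdirB : ∀ i j b, i ≠ j → f j * b * f i ≠ 0 → level j < level i := fun i j b hij hb =>
    hborel.dir (φ := B.val) hlB hle hij hb
  have hdirC : ∀ i j c, i ≠ j → g j * c * g i ≠ 0 → level i < level j := by
    intro i j c hij hc
    refine hborel'.dir hlC' hle (b := MulOpposite.op c) (Ne.symm hij) fun h0 => hc ?_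
    have := congrArg MulOpposite.unop h0
    simpa [mul_assoc] using this
  -- By induction on the level, A e_j A is spanned modulo lower levels by products of the sections
  -- of the two standard modules of weight j.
  have hcount : Module.finrank k A ≤ ∑ j, Module.finrank k (A ⧸ borelIdeal B.val qB j) *
      Module.finrank k (Aᵐᵒᵖ ⧸ borelIdeal γ qC' j) := by
    choose σ hσ using fun j => hborel.exists_section (φ := B.val) hlB hle j
    choose τ hτ using fun j => hborel'.exists_section hlC' hle j
    let τ' := fun j => (MulOpposite.opLinearEquiv k).symm.toLinearMap ∘ₗ τ j
    refine finrank_tensor_sum_le σ τ' fun x => ?_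
    set Z := Submodule.span k {z | ∃ i u v, z = σ i u * τ' i v}
    have key : ∀ n, ∀ x ∈ idealLT e level n, x ∈ Z := by
      intro n
      induction n with
      | zero =>
        intro x hx
        rw [idealLT_zero] at hx
        rw [(Submodule.mem_bot A).1 hx]
        exact zero_mem _
      | succ n ih =>
        have h1 : ∀ j, level j < n + 1 → ∀ a b, a * e j * b ∈ Z := by
          intro j hj a b
          obtain ⟨u, hu⟩ := hσ j a
          obtain ⟨v, hv⟩ := hτ j (MulOpposite.op b)
          have hu' : a * e j - σ j u ∈ idealLT e level n :=
            idealLT_mono (Nat.lt_succ_iff.1 hj) hu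
          have hv' : e j * b - τ' j v ∈ idealLT e level n := by
            refine idealLT_mono (Nat.lt_succ_iff.1 hj) ?_
            rw [hγe] at hv
            have h2 := unop_mem_idealLT hv
            simpa [hγ, τ'] using h2
          have h2 : a * e j * b = (a * e j - σ j u) * (e j * b) + σ j u * (e j * b - τ' j v) +
              σ j u * τ' j v := by
            have : a * e j * (e j * b) = a * e j * b := by
              rw [← mul_assoc, mul_assoc a, (he.idem j).eq]
            rw [sub_mul, mul_sub, this]
            abel
          rw [h2]
          exact add_mem (ih _ (add_mem (Ideal.mul_mem_right _ _ hu') (Ideal.mul_mem_left _ _ hv')))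
            (Submodule.subset_span ⟨j, u, v, rfl⟩)
        intro x hx
        have h3 : ∀ a, a * x ∈ Z := by
          refine Submodule.span_induction (p := fun x _ => ∀ a, a * x ∈ Z) ?_ (by simp)
            (fun x y _ _ hx hy a => by rw [mul_add]; exact add_mem (hx a) (hy a))
            (fun r x _ hx a => by rw [smul_eq_mul, ← mul_assoc]; exact hx _) hx
          rintro _ ⟨j, s, hj, rfl⟩ a
          rw [← mul_assoc]
          exact h1 j hj a s
        simpa using h3 1
    refine key (Finset.univ.sup level + 1) x ?_
    rw [idealLT_eq_top he fun i => Nat.lt_succ_of_le (Finset.le_sup (Finset.mem_univ i))]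
    exact Submodule.mem_top
  have hdimB := hborel.finrank_eq (k := k) (φ := B.val) hlB
  have hdimC := hborel'.finrank_eq (k := k) hlC'
  have hop : Module.finrank k Aᵐᵒᵖ = Module.finrank k A :=
    (MulOpposite.opLinearEquiv k : A ≃ₗ[k] Aᵐᵒᵖ).finrank_eq.symm
  simp only [Function.comp_apply, finrank_range_mulLeft_op, hop] at hdimC
  have hpos : ∀ j, 0 < Module.finrank k (Aᵐᵒᵖ ⧸ borelIdeal γ qC' j) := by
    intro j
    have h1 := hborel'.one_notMem hlC' j
    have : Nontrivial (Aᵐᵒᵖ ⧸ borelIdeal γ qC' j) :=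
      Submodule.Quotient.nontrivial_iff.2 fun h0 => h1 (h0 ▸ Submodule.mem_top)
    exact Module.finrank_pos
  -- The estimate of dim Δ(j) by dim C g_j is needed on one side only; on the other it suffices that
  -- the standard modules are nonzero.
  have hdim := eq_of_sum_mul_eq hdimB hdimC hcount
    (finrank_borelIdeal_le hlB.toIsSplit (fun _ => rfl) hg hspan) hpos
  refine ⟨e, f, g, level, he, fun _ => rfl, hg, Subtype.val_injective, Subtype.val_injective,
    fun i h0 => ?_, hlB.corner_of_simple hborel.quasiHereditary
      (hborel.isSimpleModule_standard (φ := B.val)), hdirB, fun i c => ?_, hdirC, hspan, hdim⟩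
  · have h1 : f i = 0 := Subtype.ext h0
    have := hlB.q_e i
    rw [h1, map_zero] at this
    simpa using congrFun this i
  · obtain ⟨a, ha⟩ := hlC'.corner_of_simple hborel'.quasiHereditary
      hborel'.isSimpleModule_standard i (MulOpposite.op c)
    refine ⟨a, ?_⟩
    have := congrArg MulOpposite.unop ha
    simpa [mul_assoc] using this

end ReedyAlg

theorem theorem4p1 {k : Type u} [Field k] {A : Type v} [Ring A] [Algebra k A] [Nontrivial A]
    [FiniteDimensional k A] (B C : Subalgebra k A) :
    List.TFAE [
      ReedyAlg.IsReedy B C,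
      ReedyAlg.IsElementary k B ∧ ReedyAlg.IsElementary k C ∧
        ReedyAlg.IsMaximalSemisimple (B ⊓ C) B ∧ ReedyAlg.IsMaximalSemisimple (B ⊓ C) C ∧
        Function.Bijective (ReedyAlg.mulInduced B C) ∧
        ∃ (m : ℕ) (WB : ReedyAlg.WeightSystem B (Fin m)) (WC : ReedyAlg.WeightSystem C (Fin m))
          (le : Fin m → Fin m → Prop),
          (∀ i, ReedyAlg.RestrictionsIso B C (WB.L i) (WC.L i)) ∧
          ReedyAlg.IsQuasiHereditary WB le ∧
          (∀ i, IsSimpleModule B (WB.standard le i)) ∧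
          ReedyAlg.IsQuasiHereditary WC le ∧
          (∀ i, Module.Projective C (WC.standard le i)),
      ReedyAlg.IsElementary k B ∧ ReedyAlg.IsElementary k C ∧
        ReedyAlg.IsMaximalSemisimple (B ⊓ C) B ∧ ReedyAlg.IsMaximalSemisimple (B ⊓ C) C ∧
        ∃ (m : ℕ) (WA : ReedyAlg.WeightSystem A (Fin m)) (WB : ReedyAlg.WeightSystem B (Fin m))
          (WC : ReedyAlg.WeightSystem C (Fin m)) (le : Fin m → Fin m → Prop),
          (∀ i (f : WA.L i →ₗ[A] WA.L i), ∃ a : k, ∀ x, f x = algebraMap k A a • x) ∧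
          ReedyAlg.IsQuasiHereditary WA le ∧
          ReedyAlg.IsExactBorel (B.val : B →+* A) WA WB le ∧
          ReedyAlg.IsDeltaSubalgebra k C WA WC le] := by
  tfae_have 1 → 2 := fun h => by
    obtain ⟨n, e, f, g, deg, h⟩ := h.exists_isTriangular
    obtain ⟨qB, qC, hB, hC, -, -⟩ := h.exists_isSplit
    exact ⟨hB.isElementary, hC.isElementary, h.isMaximalSemisimple.1, h.isMaximalSemisimple.2,
      h.mulInduced_bijective, n + 1, h.exists_weights⟩
  tfae_have 1 → 3 := fun h => by
    obtain ⟨n, e, f, g, deg, h⟩ := h.exists_isTriangular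
    obtain ⟨qB, qC, hB, hC, -, -⟩ := h.exists_isSplit
    exact ⟨hB.isElementary, hC.isElementary, h.isMaximalSemisimple.1, h.isMaximalSemisimple.2,
      n + 1, h.exists_borel⟩
  tfae_have 2 → 1 := by
    rintro ⟨hB, hC, hSB, hSC, hmul, m, WB, WC, le, hres, hqB, hsB, hqC, hpC⟩
    obtain ⟨e, f, g, deg, h⟩ := ReedyAlg.exists_isTriangular_of_bijective hB hC hSB hSC hmul hres
      hqB hsB hqC hpC
    exact h.isReedy_of_fin
  tfae_have 3 → 1 := by
    rintro ⟨hB, hC, hSB, hSC, m, WA, WB, WC, le, hend, hq, hborel, hdelta⟩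
    obtain ⟨e, f, g, deg, h⟩ := ReedyAlg.exists_isTriangular_of_borel hB hC hSB hSC hend hborel hdelta
    exact h.isReedy_of_fin
  tfae_finish
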